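/- **Setting.** Let $\mathcal X_1,\mathcal X_2,\mathcal Y_1,\mathcal Y_2$ be measurable spaces (for example discrete alphabets) and let $W=\mu_{Y_1Y_2|X_1X_2}$ be a channel, i.e. a Markov kernel from $\mathcal X_1\times\mathcal X_2$ to $\mathcal Y_1\times\mathcal Y_2$, used $n$ times without memory; the $n$-fold channel is $W^n$. There are nine independent messages $M_s$, $s=ij$ with $i,j\in\{0,1,2\}$, each $M_s$ uniform on a finite non-empty set $\mathcal M_{s,n}$. Put $$S_0=\{00,01,02\},\qquad S_i=\{i0,i1,i2\},\qquad D_j=\{00,0j,10,20,1j,2j\}\qquad(i,j\in\{1,2\}).$$ Encoder $i$ knows $M_{S_0}=(M_s)_{s\in S_0}$ and $M_{S_i}$, and sends $X_i^n$; Decoder $j$ observes $Y_j^n$ and has to reproduce $M_{D_j}$. A rate vector $R=(R_s)_s$ is *achievable* if there are (possibly stochastic) encoders $M_{S_0\cup S_i}\mapsto X_i^n$, conditionally independent given the messages, and (possibly stochastic) decoders $Y_j^n\mapsto\widehat M_{D_j}$, $n=1,2,\dots$, such that $\liminf_n\frac1n\log_2|\mathcal M_{s,n}|\ge R_s$ for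 all $s$ and the probability that some decoder $j$ does not reproduce $M_{D_j}$ correctly tends to $0$. **Region.** Let $\overline\mu$ be a joint law of random variables $Z_s$ ($s\in S_0\cup S_1\cup S_2$) with finite alphabets and of $X_1,X_2$ such that $(Z_{S_1},X_1)$ and $(Z_{S_2},X_2)$ are conditionally independent given $Z_{S_0}$; let $(Y_1,Y_2)$ be the output of $W$ for the input $(X_1,X_2)$. Let $\overline{\mathcal R}_{\mathrm{CRNG}}(\overline\mu)$ be the set of all $(R_s)_s$ with all $R_s\ge0$ for which there are $r_s\ge0$ such that $$\sum_{s\in T}(R_s+r_s)\le H(Z_T)\quad (T\subseteq S_0),\qquad \sum_{s\in T}(R_s+r_s)\le H(Z_T|Z_{S_0})\quad(i\in\{1,2\},\ T\subseteq S_i),$$ $$\sum_{s\in T}r_s\ge H(Z_T|Y_j,Z_{D_j\setminus T})\quad(j\in\{1,2\},\ T\subseteq D_j),$$ where $H$ denotes (conditional) entropy in base $2$. Let $\overline{\mathcal R}_{\mathrm{CRNG}}$ be the closure of the convex hull of $\bigcup_{\overline\mu}\overline{\mathcal R}_{\mathrm{CRNG}}(\overline\mu)$. **Constrained-random-number-generator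 codes.** Such a code of length $n$ is given by sequences $Z_s^n$ of length $n$ over finite alphabets $\mathcal Z_s$, with laws $\mu_{Z_{S_0}^n}$, $\mu_{Z_{S_i}^n|Z_{S_0}^n}$ and $\mu_{X_i^n|Z_{S_0}^nZ_{S_i}^n}$, functions $f_s:\mathcal Z_s^n\to\mathcal C_s$ and $g_s:\mathcal Z_s^n\to\mathcal M_{s,n}$, and vectors $c_s\in\mathcal C_s$. For messages $m$, a generator shared by both encoders draws $z_{S_0}$ from $\mu_{Z_{S_0}^n}$ conditioned on $f_s(z_s)=c_s$, $g_s(z_s)=m_s$ $(s\in S_0)$. Encoder $i$ draws $z_{S_i}$ from $\mu_{Z^n_{S_i}|Z_{S_0}^n}(\cdot|z_{S_0})$ conditioned on $f_s(z_s)=c_s$, $g_s(z_s)=m_s$ $(s\in S_i)$, and sends $X_i^n$ drawn from $\mu_{X_i^n|Z_{S_0}^nZ_{S_i}^n}(\cdot|z_{S_0},z_{S_i})$. Decoder $j$ draws $\widehat z_{D_j}$ from the conditional law $\mu_{Z_{D_j}^n|Y_j^n}(\cdot|y_j)$ conditioned on $f_s(\widehat z_s)=c_s$ $(s\in D_j)$,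 and outputs $(g_s(\widehat z_s))_{s\in D_j}$. Conditioning on an event of probability zero counts as an error. **Theorem.** Every $R\in\overline{\mathcal R}_{\mathrm{CRNG}}$ is achievable, and it is achieved by constrained-random-number-generator codes: there are such codes, $n=1,2,\dots$, with $\liminf_n\frac1n\log_2|\mathcal M_{s,n}|\ge R_s$ for all $s$ and with error probability tending to $0$. Moreover, the output of the generator shared by the encoders can be fixed to be a function of $m_{S_0}$ alone (one of the possible outputs for $m_{S_0}$), so that the encoders use no shared randomness, and the error probability still tends to $0$. -/

import Mathlib

open MeasureTheory ProbabilityTheory Filter Topology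
open scoped ENNReal

namespace InterferenceChannel

noncomputable section

/-! ### Messages -/

/-- Message index `ij`. Left digit: the encoder that has access to the message (`0` = both).
Right digit: the decoder that has to reproduce it (`0` = both). Encoders and decoders are numbered
by `Fin 2`; the digit of encoder (or decoder) `i : Fin 2` is `i.succ`. -/
abbrev Msg : Type := Fin 3 × Fin 3

/-- `S₀ = {00, 01, 02}`. -/
def common : Finset Msg := Finset.univ.filter fun s => s.1 = 0

/-- `S_i = {i0, i1, i2}`. -/
def priv (i : Fin 2) : Finset Msg := Finset.univ.filter fun s => s.1 = i.succ

/-- Everything that encoder `i` has access to, `S₀ ∪ S_i`. -/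
def avail (i : Fin 2) : Finset Msg := common ∪ priv i

/-- `D_j = {00, 10, 20, 0j, 1j, 2j}`, the messages reproduced by decoder `j`. -/
def decoded (j : Fin 2) : Finset Msg := Finset.univ.filter fun s => s.2 = 0 ∨ s.2 = j.succ

/-- Subfamilies `a_T = (a_s)_{s ∈ T}`. -/
abbrev Tuple (A : Msg → Type*) (T : Finset Msg) := (s : T) → A s

/-! ### Entropy (base 2) of finite-valued random variables -/

/-- `H(A)`. -/
def entropy {Ω α : Type*} [MeasurableSpace Ω] [Fintype α] [MeasurableSpace α]
    (μ : Measure Ω) (A : Ω → α) : ℝ :=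
  ∑ a, Real.negMulLog ((μ.map A).real {a}) / Real.log 2

/-- `H(A | B)`, for a finite-valued `A` and a `B` with values in any measurable space:
the mean over `b` of the entropy of the conditional law of `A` given `B = b`. -/
def condEntropy {Ω α β : Type*} [MeasurableSpace Ω] [Fintype α] [Nonempty α] [MeasurableSpace α]
    [StandardBorelSpace α] [MeasurableSpace β]
    (μ : Measure Ω) [IsFiniteMeasure μ] (A : Ω → α) (B : Ω → β) : ℝ :=
  ∫ b, ∑ a, Real.negMulLog ((condDistrib A B μ b).real {a}) / Real.log 2 ∂(μ.map B)

/-! ### Auxiliary variables, channel inputs, channel outputs -/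

/-- The joint law of the auxiliary variables `Z_s` and of the channel inputs `X_1, X_2`:
`Z_{S₀}` has law `base`; given `Z_{S₀}`, the pairs `(Z_{S_1}, X_1)` and `(Z_{S_2}, X_2)` are
independent, and the law of `(Z_{S_i}, X_i)` is given as the law `side i` of `Z_{S_i}` followed by
the law `input i` of `X_i` given `(Z_{S₀}, Z_{S_i})`. -/
structure Source (Z : Msg → Type) [∀ s, MeasurableSpace (Z s)]
    (X : Fin 2 → Type*) [∀ i, MeasurableSpace (X i)] where
  base : Measure (Tuple Z common)
  side : ∀ i, Kernel (Tuple Z common) (Tuple Z (priv i))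
  input : ∀ i, Kernel (Tuple Z common × Tuple Z (priv i)) (X i)
  base_prob : IsProbabilityMeasure base
  side_markov : ∀ i, IsMarkovKernel (side i)
  input_markov : ∀ i, IsMarkovKernel (input i)

attribute [instance] Source.base_prob Source.side_markov Source.input_markov

section Joint

variable {Z : Msg → Type} [∀ s, Fintype (Z s)] [∀ s, MeasurableSpace (Z s)]
  {X Y : Fin 2 → Type*} [∀ i, MeasurableSpace (X i)] [∀ j, MeasurableSpace (Y j)]

/-- The probability of `Z = z`. -/
def Source.weight (P : Source Z X) (z : ∀ s, Z s) : ℝ≥0∞ :=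
  P.base {common.restrict z} *
    ∏ i, P.side i (common.restrict z) {(priv i).restrict z}

/-- The law of the channel inputs `(X_1, X_2)` given `Z = z`. -/
def Source.inputs (P : Source Z X) (z : ∀ s, Z s) : Measure (∀ i, X i) :=
  Measure.pi fun i => P.input i (common.restrict z, (priv i).restrict z)

/-- The joint law of all `Z_s` and of the outputs `(Y_1, Y_2)` of the channel `V`. -/
def Source.joint (P : Source Z X) (V : Kernel (∀ i, X i) (∀ j, Y j)) :
    Measure ((∀ s, Z s) × (∀ j, Y j)) :=
  ∑ z, P.weight z • (Measure.dirac z).prod (V ∘ₘ P.inputs z)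

instance (P : Source Z X) (z : ∀ s, Z s) : IsProbabilityMeasure (P.inputs z) := by
  unfold Source.inputs; infer_instance

instance (P : Source Z X) (V : Kernel (∀ i, X i) (∀ j, Y j)) [IsMarkovKernel V] :
    IsFiniteMeasure (P.joint V) := by
  constructor
  simp only [Source.joint, Measure.coe_finsetSum, Measure.smul_apply, Finset.sum_apply,
    smul_eq_mul, measure_univ, mul_one]
  refine ENNReal.sum_lt_top.2 fun z _ => ?_
  refine ENNReal.mul_lt_top (measure_lt_top _ _) (ENNReal.prod_lt_top fun i _ => ?_)
  exact measure_lt_top _ _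

end Joint

/-! ### The region -/

section Region

variable {X Y : Fin 2 → Type*} [∀ i, MeasurableSpace (X i)] [∀ j, MeasurableSpace (Y j)]

/-- The rate vectors allowed by one joint law `P`, with auxiliary alphabets of arbitrary finite
sizes `k s + 1`. -/
def regionOf (W : Kernel (∀ i, X i) (∀ j, Y j)) [IsMarkovKernel W] {k : Msg → ℕ}
    (P : Source (fun s => Fin (k s + 1)) X) : Set (Msg → ℝ) :=
  {R | (∀ s, 0 ≤ R s) ∧ ∃ r : Msg → ℝ, (∀ s, 0 ≤ r s) ∧
    (∀ T ⊆ common,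
      ∑ s ∈ T, (R s + r s) ≤ entropy (P.joint W) (fun ω => T.restrict ω.1)) ∧
    (∀ i, ∀ T ⊆ priv i,
      ∑ s ∈ T, (R s + r s) ≤ condEntropy (P.joint W) (fun ω => T.restrict ω.1)
        (fun ω => common.restrict ω.1)) ∧
    (∀ j, ∀ T ⊆ decoded j,
      condEntropy (P.joint W) (fun ω => T.restrict ω.1)
        (fun ω => (ω.2 j, (decoded j \ T).restrict ω.1)) ≤ ∑ s ∈ T, r s)}

/-- The convex closure of the union of `regionOf W P` over all joint laws `P`. -/
def region (W : Kernel (∀ i, X i) (∀ j, Y j)) [IsMarkovKernel W] : Set (Msg → ℝ) :=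
  closure (convexHull ℝ (⋃ (k : Msg → ℕ) (P : Source (fun s => Fin (k s + 1)) X), regionOf W P))

end Region

/-! ### Codes -/

/-- A stochastic code with message sets `{0, …, N s - 1}`, for a channel with input alphabets `X i`
and output alphabets `Y j`. -/
structure Code (N : Msg → ℕ) (X Y : Fin 2 → Type*)
    [∀ i, MeasurableSpace (X i)] [∀ j, MeasurableSpace (Y j)] where
  enc : ∀ i, Tuple (fun s => Fin (N s)) (avail i) → Measure (X i)
  dec : ∀ j, Kernel (Y j) (Tuple (fun s => Fin (N s)) (decoded j))
  enc_prob : ∀ i m, IsProbabilityMeasure (enc i m)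
  dec_markov : ∀ j, IsMarkovKernel (dec j)

/-- The probability that some decoder makes an error, for independent uniform messages. -/
def Code.errorProb {N : Msg → ℕ} {X Y : Fin 2 → Type*}
    [∀ i, MeasurableSpace (X i)] [∀ j, MeasurableSpace (Y j)]
    (K : Code N X Y) (V : Kernel (∀ i, X i) (∀ j, Y j)) : ℝ≥0∞ :=
  (∑ m : (∀ s, Fin (N s)),
    ∫⁻ x, ∫⁻ y, Measure.pi (fun j => K.dec j (y j)) {w | ∃ j, w j ≠ (decoded j).restrict m}
      ∂(V x) ∂(Measure.pi fun i => K.enc i ((avail i).restrict m))) / ∏ s, (N s : ℝ≥0∞)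

/-- The data of a code built from constrained-random-number generators: the laws of the sequences
`Z_s` and of the channel inputs, functions `f s` with values `c s` fixed in advance,
and functions `g s` with values in the message sets. -/
structure CRNG (Z : Msg → Type) [∀ s, MeasurableSpace (Z s)]
    (X : Fin 2 → Type*) [∀ i, MeasurableSpace (X i)] (N : Msg → ℕ) where
  src : Source Z X
  L : Msg → ℕ
  f : ∀ s, Z s → Fin (L s)
  g : ∀ s, Z s → Fin (N s)
  c : ∀ s, Fin (L s)

namespace CRNG

variable {Z : Msg → Type} [∀ s, Fintype (Z s)] [∀ s, MeasurableSpace (Z s)]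
  {X Y : Fin 2 → Type*} [∀ i, MeasurableSpace (X i)] [∀ j, MeasurableSpace (Y j)] {N : Msg → ℕ}

/-- `{z_T : f_s(z_s) = c_s for all s ∈ T}`. -/
def bin (G : CRNG Z X N) (T : Finset Msg) : Set (Tuple Z T) :=
  {z | ∀ s : T, G.f s (z s) = G.c s}

/-- `{z_T : f_s(z_s) = c_s and g_s(z_s) = m_s for all s ∈ T}`. -/
def msgBin (G : CRNG Z X N) (T : Finset Msg) (m : Tuple (fun s => Fin (N s)) T) :
    Set (Tuple Z T) :=
  {z | ∀ s : T, G.f s (z s) = G.c s ∧ G.g s (z s) = m s}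

/-- The generator of `Z_{S₀}`, used by both encoders: the law of `Z_{S₀}` conditioned on
the bin of the message (the zero measure if that bin has probability zero). -/
def genCommon (G : CRNG Z X N) (m : Tuple (fun s => Fin (N s)) common) :
    Measure (Tuple Z common) :=
  cond G.src.base (G.msgBin common m)

/-- The generator of `Z_{S_i}`, used by encoder `i`: the law of `Z_{S_i}` given `Z_{S₀} = z₀`,
conditioned on the bin of the message (the zero measure if that bin has probability zero). -/
def genPriv (G : CRNG Z X N) (i : Fin 2) (z₀ : Tuple Z common)
    (m : Tuple (fun s => Fin (N s)) (priv i)) : Measure (Tuple Z (priv i)) :=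
  cond (G.src.side i z₀) (G.msgBin (priv i) m)

variable [∀ s, Nonempty (Z s)] [∀ s, StandardBorelSpace (Z s)]

/-- The conditional law of `Z_{D_j}` given `Y_j`. -/
def posterior (G : CRNG Z X N) (V : Kernel (∀ i, X i) (∀ j, Y j)) [IsMarkovKernel V]
    (j : Fin 2) : Kernel (Y j) (Tuple Z (decoded j)) :=
  condDistrib (fun ω => (decoded j).restrict ω.1) (fun ω => ω.2 j) (G.src.joint V)

/-- The generator used by decoder `j`: the conditional law of `Z_{D_j}` given `Y_j = y`,
conditioned on the bin (the zero measure if that bin has probability zero). -/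
def genDec (G : CRNG Z X N) (V : Kernel (∀ i, X i) (∀ j, Y j)) [IsMarkovKernel V]
    (j : Fin 2) (y : Y j) : Measure (Tuple Z (decoded j)) :=
  cond (G.posterior V j y) (G.bin (decoded j))

/-- The error probability of the code in which both encoders share the output of the generator of
`Z_{S₀}`, encoder `i` then runs its own generator and sends `X_i` with law `input i`, and decoder
`j` outputs the `g`-values of the output of its generator. It is one minus the
probability of correct decoding, so a generator with a zero denominator counts as an error. -/
def errorProb (G : CRNG Z X N) (V : Kernel (∀ i, X i) (∀ j, Y j)) [IsMarkovKernel V] : ℝ≥0∞ :=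
  1 - (∑ m : (∀ s, Fin (N s)),
    ∫⁻ z₀, ∫⁻ z, ∫⁻ x, ∫⁻ y,
        ∏ j, G.genDec V j (y j) {w | ∀ s : decoded j, G.g s (w s) = m s}
      ∂(V x) ∂(Measure.pi fun i => G.src.input i (z₀, z i))
      ∂(Measure.pi fun i => G.genPriv i z₀ ((priv i).restrict m))
      ∂(G.genCommon (common.restrict m))) / ∏ s, (N s : ℝ≥0∞)

/-- `K` is the code with independent encoders that is obtained when the shared output
of the generator of `Z_{S₀}` is fixed to be `τ m_{S₀}`, one of its possible values. Whenever a
generator has a zero denominator, `K` may do anything. -/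
def Implements (G : CRNG Z X N) (V : Kernel (∀ i, X i) (∀ j, Y j)) [IsMarkovKernel V]
    (τ : Tuple (fun s => Fin (N s)) common → Tuple Z common) (K : Code N X Y) : Prop :=
  (∀ m, G.src.base (G.msgBin common m) ≠ 0 → G.genCommon m {τ m} ≠ 0) ∧
  (∀ i, ∀ m : (∀ s, Fin (N s)), G.src.base (G.msgBin common (common.restrict m)) ≠ 0 →
    G.src.side i (τ (common.restrict m)) (G.msgBin (priv i) ((priv i).restrict m)) ≠ 0 →
    K.enc i ((avail i).restrict m) =
      (G.genPriv i (τ (common.restrict m)) ((priv i).restrict m)).bind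
        fun z => G.src.input i (τ (common.restrict m), z)) ∧
  (∀ j, ∀ y : Y j, G.posterior V j y (G.bin (decoded j)) ≠ 0 →
    K.dec j y = (G.genDec V j y).map fun z (s : decoded j) => G.g s (z s))

end CRNG

/-! ### Achievability over a stationary memoryless channel -/

section Achievability

variable {X Y : Fin 2 → Type*} [∀ i, MeasurableSpace (X i)] [∀ j, MeasurableSpace (Y j)]

/-- `n` independent uses of the channel `W`. -/
def memoryless (W : Kernel (∀ i, X i) (∀ j, Y j)) [IsMarkovKernel W] (n : ℕ) :
    Kernel (∀ i, Fin n → X i) (∀ j, Fin n → Y j) where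
  toFun x := (Measure.pi fun t => W fun i => x i t).map fun y j t => y t j
  measurable' := by
    have h : Measurable fun x : (∀ i, Fin n → X i) => Measure.pi fun t => W fun i => x i t := by
      refine Measurable.measure_of_isPiSystem_of_isProbabilityMeasure
        (S := Set.pi Set.univ '' Set.pi Set.univ fun _ => {s | MeasurableSet s})
        generateFrom_pi.symm isPiSystem_pi ?_
      rintro _ ⟨s, hs, rfl⟩
      simp only [Measure.pi_pi]
      refine Finset.measurable_prod _ fun t _ => ?_
      exact (Kernel.measurable_coe W (hs t (Set.mem_univ t))).comp (by fun_prop)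
    exact (Measure.measurable_map _ (by fun_prop)).comp h

instance (W : Kernel (∀ i, X i) (∀ j, Y j)) [IsMarkovKernel W] (n : ℕ) :
    IsMarkovKernel (memoryless W n) :=
  ⟨fun _ => Measure.isProbabilityMeasure_map (by fun_prop : Measurable _).aemeasurable⟩

/-- The message sets are non-empty, and `liminf (log₂ N_{n,s}) / n ≥ R_s` for every `s`. -/
def HasRates (N : ℕ → Msg → ℕ) (R : Msg → ℝ) : Prop :=
  (∀ n s, 0 < N n s) ∧
  ∀ s, (R s : EReal) ≤ liminf (fun n => ((Real.logb 2 (N n s) / n : ℝ) : EReal)) atTop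

/-- `R` is an achievable rate vector. -/
def Achievable (W : Kernel (∀ i, X i) (∀ j, Y j)) [IsMarkovKernel W] (R : Msg → ℝ) : Prop :=
  ∃ (N : ℕ → Msg → ℕ) (K : ∀ n, Code (N n) (fun i => Fin n → X i) (fun j => Fin n → Y j)),
    HasRates N R ∧ Tendsto (fun n => (K n).errorProb (memoryless W n)) atTop (𝓝 0)

/-- `R` is achieved by codes built from constrained-random-number generators, where `Z_s` ranges
over sequences of length `n` over finite alphabets: both with the shared output of the generator of
`Z_{S₀}`, and with that output fixed, so that the encoders are independent. -/
def CRNGAchievable (W : Kernel (∀ i, X i) (∀ j, Y j)) [IsMarkovKernel W] (R : Msg → ℝ) : Prop :=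
  ∃ (N k : ℕ → Msg → ℕ)
    (G : ∀ n, CRNG (fun s => Fin n → Fin (k n s + 1)) (fun i => Fin n → X i) (N n))
    (τ : ∀ n, Tuple (fun s => Fin (N n s)) common →
      Tuple (fun s => Fin n → Fin (k n s + 1)) common)
    (K : ∀ n, Code (N n) (fun i => Fin n → X i) (fun j => Fin n → Y j)),
    HasRates N R ∧
    Tendsto (fun n => (G n).errorProb (memoryless W n)) atTop (𝓝 0) ∧
    (∀ n, (G n).Implements (memoryless W n) (τ n) (K n)) ∧
    Tendsto (fun n => (K n).errorProb (memoryless W n)) atTop (𝓝 0)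

end Achievability

end

end InterferenceChannel

namespace InterferenceChannel

noncomputable section

set_option linter.unusedSectionVars false

/-! ### Random hash functions -/

section Hash

open scoped BigOperators

/-! The codes come from random binning: every auxiliary sequence gets two labels, by independent
uniformly random functions `f s` and `g s`. Encoding is then a leftover-hashing problem and decoding
a Slepian–Wolf problem, and the two kinds of entropy inequalities in the region are exactly what
these two problems require.

Encoding. As long as the rates of `f` and `g` together stay below the entropies, `g(Z)` is on
average nearly uniform and independent of `f(Z)`. This is a second-moment computation from collision
probabilities (`expect_collision`, `expect_sum_abs_hashDev_le`). Feeding uniform messages into the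
generators therefore produces nearly the original law of `Z`. The common messages must be uniform
given all hashes, the private ones only given the common sequence and the encoder's own hashes.

Decoding. As long as the rate of `f` on `T` exceeds the conditional entropy of `Z_T` given `Y_j` and
the rest of `Z_{D_j}`, for every `T`, the true sequence is with high probability the only typical
one in its bin (`Source.expect_not_uniqueRegion_le`). The decoder under study samples from the
posterior instead, but this at most doubles the error probability of any decoder
(`two_mul_sum_le_lintegral_condDistrib`).

Choice of the code. `CRNG.errorProb_le` adds up these errors for a source supported on the bin `f =
c`. Such a source is obtained by conditioning the given one on `f(Z) = c`; this event is a product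
over the components, so the conditional independence of the two encoders survives
(`Source.condOn_prob`). Times the probability of `f(Z) = c`, the error terms become deviations under
the unconditioned law, which can be summed over `c`. Hence some `c` is good (`Source.exists_value`),
and averaging over `f` and `g` gives good hash functions (`Source.exists_crng`).

Asymptotics. For independent letters all masses are products, surprisals have finite variance
(`memLp_surprisal`), and Chebyshev's inequality gives typicality (`pi_deviation_le`). The law of a
letter may depend on its position, so the convex hull is reached by time sharing
(`exists_block_crng_uniform`, `exists_seq_sum_ge`), once all laws live on common alphabets
(`regionOf_mono_alphabet`). The closure and the limit are a diagonal argument.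

Shared randomness. Success is an average over the output of the shared generator, so for each common
message some possible output does at least as well (`CRNG.exists_implements`). -/

lemma expect_collision_single {Z : Type*} [Fintype Z] [DecidableEq Z] {K : ℕ} [NeZero K]
    {a b : Z} (hab : a ≠ b) :
    𝔼 h : Z → Fin K, (if h a = h b then (1 : ℝ) else 0) = 1 / K := by
  have hb : b ≠ a := fun h => hab h.symm
  have h1 : ∑ h : Z → Fin K, (if h a = h b then (1 : ℝ) else 0)
      = Fintype.card ({j // j ≠ a} → Fin K) := by
    -- The value at `a` is split off: a collision forces it to equal the value at `b`, so colliding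
    -- functions are counted by the remaining values.
    rw [← (Equiv.funSplitAt a (Fin K)).symm.sum_comp, Fintype.sum_prod_type_right]
    simp [Equiv.funSplitAt, Equiv.piSplitAt, hb]
  have h2 : Fintype.card (Z → Fin K) = K * Fintype.card ({j // j ≠ a} → Fin K) := by
    rw [Fintype.card_congr (Equiv.funSplitAt a (Fin K)), Fintype.card_prod, Fintype.card_fin]
  rw [Fintype.expect_eq_sum_div_card, h1, h2]
  have h3 : (Fintype.card ({j // j ≠ a} → Fin K) : ℝ) ≠ 0 := by
    exact_mod_cast Fintype.card_ne_zero
  have h4 : (K : ℝ) ≠ 0 := by exact_mod_cast NeZero.ne K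
  push_cast
  field_simp

lemma sum_indicator_mul {ι : Type*} (L : ι → ℕ) (F : Finset ι) (u v : ∀ s : F, Fin (L s)) [DecidableEq ι] :
    ∑ c : (∀ s : F, Fin (L s)), (if ∀ s, u s = c s then (1 : ℝ) else 0) *
      (if ∀ s, v s = c s then 1 else 0) = if ∀ s, u s = v s then 1 else 0 := by
  simp only [← funext_iff]
  simp

variable {ι : Type*} [Fintype ι] [DecidableEq ι]

lemma expect_prod {H : ι → Type*} [∀ s, Fintype (H s)] (φ : ∀ s, H s → ℝ) :
    𝔼 f : (∀ s, H s), ∏ s, φ s (f s) = ∏ s, 𝔼 h, φ s h := by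
  simp only [Fintype.expect_eq_sum_div_card, Finset.prod_div_distrib, Fintype.card_pi,
    Nat.cast_prod]
  rw [Finset.prod_univ_sum, Fintype.piFinset_univ]

variable {Z : ι → Type*} [∀ s, Fintype (Z s)] [∀ s, DecidableEq (Z s)]

/-- The components are hashed independently; a component where the arguments agree collides surely,
any other one with probability `1 / K s`. -/
lemma expect_collision (K : ι → ℕ) [∀ s, NeZero (K s)] (F : Finset ι) (z z' : ∀ s, Z s) :
    𝔼 f : (∀ s, Z s → Fin (K s)),
        (if ∀ s ∈ F, f s (z s) = f s (z' s) then (1 : ℝ) else 0)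
      = ∏ s ∈ F with z s ≠ z' s, 1 / (K s : ℝ) := by
  have h1 : ∀ f : (∀ s, Z s → Fin (K s)),
      (if ∀ s ∈ F, f s (z s) = f s (z' s) then (1 : ℝ) else 0)
        = ∏ s, (fun h : Z s → Fin (K s) => if s ∈ F → h (z s) = h (z' s) then (1 : ℝ) else 0)
          (f s) := by
    intro f
    rw [Finset.prod_ite_zero]
    simp
  simp only [h1]
  rw [expect_prod (fun s (h : Z s → Fin (K s)) => if s ∈ F → h (z s) = h (z' s) then (1 : ℝ) else 0),
    Finset.prod_filter, ← Finset.prod_subset (Finset.subset_univ F)]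
  · refine Finset.prod_congr rfl fun s hs => ?_
    by_cases h : z s = z' s
    · simp [h]
    · simp only [hs, true_imp_iff]
      rw [expect_collision_single h, if_pos h]
  · intro s _ hs
    simp [hs]

/-- In terms of the agreement set the denominator no longer depends on `z` and `z'`, so it cancels
against the number of hash values in the second-moment bound. -/
lemma expect_collision_eq (K : ι → ℕ) [∀ s, NeZero (K s)] (F : Finset ι) (z z' : ∀ s, Z s) :
    𝔼 f : (∀ s, Z s → Fin (K s)),
        (if ∀ s ∈ F, f s (z s) = f s (z' s) then (1 : ℝ) else 0)
      = (∏ s ∈ F with z s = z' s, (K s : ℝ)) / ∏ s ∈ F, (K s : ℝ) := by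
  rw [expect_collision, ← Finset.prod_filter_mul_prod_filter_not F (fun s => z s = z' s)]
  have h1 : ∏ s ∈ F with z s = z' s, (K s : ℝ) ≠ 0 :=
    Finset.prod_ne_zero_iff.2 fun s _ => by exact_mod_cast NeZero.ne (K s)
  rw [Finset.prod_div_distrib, Finset.prod_const_one]
  field_simp

/-- The deviation of the joint weight of `(c, m)` from the weight of `c` divided by the number of
values of `m`. -/
def hashDev (L N : ι → ℕ) (F A : Finset ι) (p : (∀ s, Z s) → ℝ) (f : ∀ s, Z s → Fin (L s))
    (g : ∀ s, Z s → Fin (N s)) (c : ∀ s : F, Fin (L s)) (m : ∀ s : A, Fin (N s)) : ℝ :=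
  ∑ z, p z * ((if ∀ s : F, f s (z s) = c s then 1 else 0) *
    ((if ∀ s : A, g s (z s) = m s then 1 else 0) - 1 / ∏ s ∈ A, (N s : ℝ)))

/-- Expanding the square gives pairs `z, z'`. Summing over `c` leaves the collision indicator of
`f`; summing the product of two centred indicators over `m` leaves the centred collision indicator
of `g`. -/
lemma sum_sq_hashDev (L N : ι → ℕ) [∀ s, NeZero (N s)] (F A : Finset ι) (p : (∀ s, Z s) → ℝ)
    (f : ∀ s, Z s → Fin (L s)) (g : ∀ s, Z s → Fin (N s)) :
    ∑ c, ∑ m, hashDev L N F A p f g c m ^ 2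
      = ∑ z, ∑ z', p z * p z' * ((if ∀ s ∈ F, f s (z s) = f s (z' s) then 1 else 0) *
        ((if ∀ s ∈ A, g s (z s) = g s (z' s) then 1 else 0) - 1 / ∏ s ∈ A, (N s : ℝ))) := by
  have hN : (∏ s ∈ A, (N s : ℝ)) ≠ 0 :=
    Finset.prod_ne_zero_iff.2 fun s _ => by exact_mod_cast NeZero.ne (N s)
  have hcard : (Fintype.card (∀ s : A, Fin (N s)) : ℝ) = ∏ s ∈ A, (N s : ℝ) := by
    rw [Fintype.card_pi]; push_cast
    simp only [Fintype.card_fin]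
    exact Finset.prod_coe_sort A (fun s => (N s : ℝ))
  have hm : ∀ z z' : (∀ s, Z s), ∑ m : (∀ s : A, Fin (N s)),
      ((if ∀ s : A, g s (z s) = m s then (1 : ℝ) else 0) - 1 / ∏ s ∈ A, (N s : ℝ)) *
      ((if ∀ s : A, g s (z' s) = m s then (1 : ℝ) else 0) - 1 / ∏ s ∈ A, (N s : ℝ))
      = (if ∀ s ∈ A, g s (z s) = g s (z' s) then 1 else 0) - 1 / ∏ s ∈ A, (N s : ℝ) := by
    intro z z'
    have e := sum_indicator_mul N A (fun s => g s (z s)) (fun s => g s (z' s))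
    have e1 : ∀ z : (∀ s, Z s), ∑ m : (∀ s : A, Fin (N s)),
        (if ∀ s : A, g s (z s) = m s then (1 : ℝ) else 0) = 1 := by
      intro z
      have : ∀ m : (∀ s : A, Fin (N s)), (∀ s : A, g s (z s) = m s) ↔
        (fun s : A => g s (z s)) = m := fun m => funext_iff.symm
      simp_rw [this]
      rw [Finset.sum_ite_eq, if_pos (Finset.mem_univ _)]
    simp only [sub_mul, mul_sub, Finset.sum_sub_distrib, ← Finset.sum_mul, ← Finset.mul_sum, e, e1]
    simp only [Finset.sum_const, Finset.card_univ, nsmul_eq_mul, hcard, Subtype.forall]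
    field_simp
    ring
  have hsq : ∀ c m, hashDev L N F A p f g c m ^ 2 = ∑ z, ∑ z', p z * p z' *
      (((if ∀ s : F, f s (z s) = c s then 1 else 0) *
        (if ∀ s : F, f s (z' s) = c s then 1 else 0)) *
       (((if ∀ s : A, g s (z s) = m s then (1 : ℝ) else 0) - 1 / ∏ s ∈ A, (N s : ℝ)) *
      ((if ∀ s : A, g s (z' s) = m s then (1 : ℝ) else 0) - 1 / ∏ s ∈ A, (N s : ℝ)))) := by
    intro c m
    rw [hashDev, sq, Finset.sum_mul_sum]
    refine Finset.sum_congr rfl fun z _ => Finset.sum_congr rfl fun z' _ => ?_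
    ring
  simp only [hsq]
  simp_rw [Finset.sum_comm (s := (Finset.univ : Finset (∀ s : A, Fin (N s))))
    (t := (Finset.univ : Finset (∀ s, Z s)))]
  simp_rw [Finset.sum_comm (s := (Finset.univ : Finset (∀ s : F, Fin (L s))))
    (t := (Finset.univ : Finset (∀ s, Z s)))]
  refine Finset.sum_congr rfl fun z _ => Finset.sum_congr rfl fun z' _ => ?_
  simp only [← Finset.mul_sum, hm, ← Finset.sum_mul]
  rw [sum_indicator_mul L F (fun s => f s (z s)) (fun s => f s (z' s))]
  simp only [Subtype.forall]

/-- Leftover hashing for several sources: on average over the hash functions, the value of `g` is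
close to uniform and independent of the value of `f`. -/
lemma expect_sum_abs_hashDev_le (L N : ι → ℕ) [∀ s, NeZero (L s)] [∀ s, NeZero (N s)]
    (F A : Finset ι) (hAF : A ⊆ F) (p : (∀ s, Z s) → ℝ) (hp : ∀ z, 0 ≤ p z) {Q t : ℝ}
    (hQ0 : 0 ≤ Q) (ht : 0 < t)
    (hQ : ∀ T ⊆ F, ∏ s ∈ T ∩ A, N s ≠ 1 → ∀ z : (∀ s, Z s),
      (∏ s ∈ T, (L s : ℝ)) * (∏ s ∈ T ∩ A, (N s : ℝ)) * ∑ z' with ∀ s ∈ T, z' s = z s, p z' ≤ Q)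
    (hQt : (2 : ℝ) ^ F.card * ((∑ z, p z) * Q) ≤ t ^ 2) :
    𝔼 f : (∀ s, Z s → Fin (L s)), 𝔼 g : (∀ s, Z s → Fin (N s)),
      ∑ c, ∑ m, |hashDev L N F A p f g c m| ≤ t := by
  set LF : ℝ := ∏ s ∈ F, (L s : ℝ) with hLF
  set NA : ℝ := ∏ s ∈ A, (N s : ℝ) with hNA
  have hLpos : ∀ s, (0 : ℝ) < L s := fun s => by exact_mod_cast Nat.pos_of_ne_zero (NeZero.ne (L s))
  have hNpos : ∀ s, (0 : ℝ) < N s := fun s => by exact_mod_cast Nat.pos_of_ne_zero (NeZero.ne (N s))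
  have hLF0 : 0 < LF := Finset.prod_pos fun s _ => hLpos s
  have hNA0 : 0 < NA := Finset.prod_pos fun s _ => hNpos s
  -- second moment
  have hsecond : 𝔼 f : (∀ s, Z s → Fin (L s)), 𝔼 g : (∀ s, Z s → Fin (N s)),
      ∑ c, ∑ m, hashDev L N F A p f g c m ^ 2
      = ∑ z, ∑ z', p z * p z' * ((∏ s ∈ F with z s = z' s, (L s : ℝ)) / LF *
        ((∏ s ∈ A with z s = z' s, (N s : ℝ)) / NA - 1 / NA)) := by
    simp only [sum_sq_hashDev, Finset.expect_sum_comm]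
    refine Finset.sum_congr rfl fun z _ => Finset.sum_congr rfl fun z' _ => ?_
    simp only [← Finset.mul_expect, ← Finset.expect_mul, Finset.expect_sub_distrib]
    rw [expect_collision_eq, expect_collision_eq, Fintype.expect_const]
  have hbound : LF * NA * 𝔼 f : (∀ s, Z s → Fin (L s)), 𝔼 g : (∀ s, Z s → Fin (N s)),
      ∑ c, ∑ m, hashDev L N F A p f g c m ^ 2 ≤ t ^ 2 := by
    rw [hsecond]
    refine le_trans ?_ hQt
    have hterm : ∀ z, LF * NA * ∑ z', p z * p z' * ((∏ s ∈ F with z s = z' s, (L s : ℝ)) / LF *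
        ((∏ s ∈ A with z s = z' s, (N s : ℝ)) / NA - 1 / NA)) ≤ p z * ((2 : ℝ) ^ F.card * Q) := by
      intro z
      -- The agreement set of `z` and `z'` is one of the subsets `T` of `F`, and summing over all of
      -- them removes the dependence of `T` on `z'`. A set `T` with only one message value
      -- contributes nothing because of the centring, so `hQ` need not cover it.
      have h1 : ∀ z', LF * NA * (p z * p z' * ((∏ s ∈ F with z s = z' s, (L s : ℝ)) / LF *
          ((∏ s ∈ A with z s = z' s, (N s : ℝ)) / NA - 1 / NA))) ≤
          p z * ∑ T ∈ F.powerset, if ∏ s ∈ T ∩ A, N s ≠ 1 then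
            (if ∀ s ∈ T, z' s = z s then
              (∏ s ∈ T, (L s : ℝ)) * (∏ s ∈ T ∩ A, (N s : ℝ)) * p z' else 0) else 0 := by
        intro z'
        have e1 : LF * NA * (p z * p z' * ((∏ s ∈ F with z s = z' s, (L s : ℝ)) / LF *
          ((∏ s ∈ A with z s = z' s, (N s : ℝ)) / NA - 1 / NA))) =
          p z * ((∏ s ∈ F with z s = z' s, (L s : ℝ)) *
            ((∏ s ∈ A with z s = z' s, (N s : ℝ)) - 1) * p z') := by
          field_simp
        rw [e1]
        refine mul_le_mul_of_nonneg_left ?_ (hp z)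
        set T : Finset ι := {s ∈ F | z s = z' s} with hT
        have hTA : T ∩ A = {s ∈ A | z s = z' s} := by
          ext s; simp only [hT, Finset.mem_inter, Finset.mem_filter]
          exact ⟨fun h => ⟨h.2, h.1.2⟩, fun h => ⟨⟨hAF h.1, h.2⟩, h.1⟩⟩
        have hnn : ∀ T' ∈ F.powerset, (0 : ℝ) ≤ if ∏ s ∈ T' ∩ A, N s ≠ 1 then
            (if ∀ s ∈ T', z' s = z s then
              (∏ s ∈ T', (L s : ℝ)) * (∏ s ∈ T' ∩ A, (N s : ℝ)) * p z' else 0) else 0 := by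
          intro T' _
          have := hp z'
          split_ifs <;> positivity
        rw [← hTA]
        by_cases h1 : ∏ s ∈ T ∩ A, N s = 1
        · have : (∏ s ∈ T ∩ A, (N s : ℝ)) = 1 := by exact_mod_cast h1
          rw [this]
          simpa using Finset.sum_nonneg hnn
        · have hmem : T ∈ F.powerset := Finset.mem_powerset.2 (Finset.filter_subset _ _)
          refine le_trans ?_ (Finset.single_le_sum hnn hmem)
          have hag : ∀ s ∈ T, z' s = z s := fun s hs => (Finset.mem_filter.1 hs).2.symm
          rw [if_pos h1, if_pos hag]
          have h2 : (0 : ℝ) ≤ ∏ s ∈ T, (L s : ℝ) := Finset.prod_nonneg fun s _ => (hLpos s).le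
          have := hp z'
          gcongr
          linarith
      rw [Finset.mul_sum]
      refine (Finset.sum_le_sum fun z' _ => h1 z').trans ?_
      rw [← Finset.mul_sum, Finset.sum_comm]
      refine mul_le_mul_of_nonneg_left ?_ (hp z)
      have h2 : ∀ T ∈ F.powerset, (∑ z', if ∏ s ∈ T ∩ A, N s ≠ 1 then
            (if ∀ s ∈ T, z' s = z s then
              (∏ s ∈ T, (L s : ℝ)) * (∏ s ∈ T ∩ A, (N s : ℝ)) * p z' else 0) else 0) ≤ Q := by
        intro T hT
        by_cases h1 : ∏ s ∈ T ∩ A, N s = 1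
        · simpa [h1] using hQ0
        · simp only [ne_eq, h1, not_false_eq_true, if_true]
          rw [← Finset.sum_filter, ← Finset.mul_sum]
          exact hQ T (Finset.mem_powerset.1 hT) h1 z
      refine (Finset.sum_le_card_nsmul _ _ _ h2).trans ?_
      rw [Finset.card_powerset, nsmul_eq_mul]
      push_cast
      exact le_rfl
    rw [Finset.mul_sum]
    refine (Finset.sum_le_sum fun z _ => hterm z).trans ?_
    rw [← Finset.sum_mul]
    exact le_of_eq (by ring)
  -- Cauchy–Schwarz over the `LF * NA` pairs `(c, m)`; then `x ≤ x² / (2t) + t / 2`, which is linear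
  -- in the second moment and so takes the place of Jensen's inequality.
  have hpt : ∀ f g, ∑ c, ∑ m, |hashDev L N F A p f g c m| ≤
      (1 / (2 * t)) * (LF * NA * ∑ c, ∑ m, hashDev L N F A p f g c m ^ 2) + t / 2 := by
    intro f g
    have hcard : (((Finset.univ : Finset ((∀ s : F, Fin (L s)) × (∀ s : A, Fin (N s)))).card : ℕ) : ℝ)
        = LF * NA := by
      rw [Finset.card_univ, Fintype.card_prod, Fintype.card_pi, Fintype.card_pi]; push_cast
      simp only [Fintype.card_fin]
      rw [Finset.prod_coe_sort F (fun s => (L s : ℝ)), Finset.prod_coe_sort A (fun s => (N s : ℝ))]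
    have h := sq_sum_le_card_mul_sum_sq
      (s := (Finset.univ : Finset ((∀ s : F, Fin (L s)) × (∀ s : A, Fin (N s)))))
      (f := fun cm => |hashDev L N F A p f g cm.1 cm.2|)
    rw [hcard, Fintype.sum_prod_type, Fintype.sum_prod_type] at h
    simp only [sq_abs] at h
    set x := ∑ c, ∑ m, |hashDev L N F A p f g c m|
    have h3 : x ≤ 1 / (2 * t) * x ^ 2 + t / 2 := by
      have : 1 / (2 * t) * x ^ 2 + t / 2 - x = (x - t) ^ 2 / (2 * t) := by field_simp; ring
      have h4 : 0 ≤ (x - t) ^ 2 / (2 * t) := by positivity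
      linarith
    refine h3.trans ?_
    have : 0 ≤ 1 / (2 * t) := by positivity
    gcongr
  calc _ ≤ 𝔼 f : (∀ s, Z s → Fin (L s)), 𝔼 g : (∀ s, Z s → Fin (N s)),
      ((1 / (2 * t)) * (LF * NA * ∑ c, ∑ m, hashDev L N F A p f g c m ^ 2) + t / 2) :=
        Finset.expect_le_expect fun f _ => Finset.expect_le_expect fun g _ => hpt f g
    _ = (1 / (2 * t)) * (LF * NA * 𝔼 f : (∀ s, Z s → Fin (L s)), 𝔼 g : (∀ s, Z s → Fin (N s)),
      ∑ c, ∑ m, hashDev L N F A p f g c m ^ 2) + t / 2 := by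
        simp only [Finset.expect_add_distrib, Fintype.expect_const, ← Finset.mul_expect]
    _ ≤ (1 / (2 * t)) * t ^ 2 + t / 2 := by gcongr
    _ = t := by field_simp; ring

end Hash

/-! ### Splitting tuples into the common and the private part -/

section Split

lemma mem_common_or_priv (s : Msg) (h : s ∉ common) (h0 : s ∉ priv 0) : s ∈ priv 1 := by
  revert s; decide

lemma common_disjoint_priv (i : Fin 2) (s : Msg) (h : s ∈ priv i) : s ∉ common := by
  revert i s; decide

lemma priv_disjoint (s : Msg) (h : s ∈ priv 1) : s ∉ priv 0 := by
  revert s; decide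

lemma mem_parts (s : Msg) : s ∈ common ∨ ∃ i, s ∈ priv i := by
  revert s; decide

/-- A family is the same as its common part together with its private parts. -/
def splitEquiv (Z : Msg → Type*) :
    (∀ s, Z s) ≃ Tuple Z common × (∀ i, Tuple Z (priv i)) where
  toFun z := (common.restrict z, fun i => (priv i).restrict z)
  invFun z s := if h : s ∈ common then z.1 ⟨s, h⟩ else
    if h0 : s ∈ priv 0 then z.2 0 ⟨s, h0⟩ else z.2 1 ⟨s, mem_common_or_priv s h h0⟩
  left_inv z := by
    funext s
    simp only [Finset.restrict]
    split_ifs <;> rfl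
  right_inv z := by
    refine Prod.ext ?_ ?_
    · funext s
      simp [Finset.restrict]
    · funext i s
      have hs := common_disjoint_priv i s s.2
      fin_cases i
      · simp [Finset.restrict, hs]
      · have h1 := priv_disjoint s s.2
        simp [Finset.restrict, hs, h1]

lemma sum_split {Z : Msg → Type*} [∀ s, Fintype (Z s)] {M : Type*} [AddCommMonoid M]
    (G : Tuple Z common → (∀ i, Tuple Z (priv i)) → M) :
    ∑ z : (∀ s, Z s), G (common.restrict z) (fun i => (priv i).restrict z)
      = ∑ z₀, ∑ z, G z₀ z := by
  rw [← Fintype.sum_prod_type', ← (splitEquiv Z).sum_comp]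
  rfl

lemma sum_split_prod {Z : Msg → Type*} [∀ s, Fintype (Z s)] {M : Type*} [CommSemiring M]
    (a : Tuple Z common → M) (b : ∀ i, Tuple Z common → Tuple Z (priv i) → M) :
    ∑ z : (∀ s, Z s), a (common.restrict z) * ∏ i, b i (common.restrict z) ((priv i).restrict z)
      = ∑ z₀, a z₀ * ∏ i, ∑ z, b i z₀ z := by
  rw [sum_split (fun z₀ z => a z₀ * ∏ i, b i z₀ (z i))]
  refine Finset.sum_congr rfl fun z₀ _ => ?_
  rw [← Finset.mul_sum, Finset.prod_univ_sum, Fintype.piFinset_univ]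

lemma prod_split {M : Type*} [CommMonoid M] (a : Msg → M) :
    ∏ s, a s = (∏ s ∈ common, a s) * ∏ i, ∏ s ∈ priv i, a s := by
  have h : (Finset.univ : Finset Msg) = common ∪ (priv 0 ∪ priv 1) := by decide
  rw [h, Finset.prod_union (by decide), Finset.prod_union (by decide), Fin.prod_univ_two]

end Split

/-! ### Weights and the joint law -/

section Weights

variable {Z : Msg → Type} [∀ s, Fintype (Z s)] [∀ s, MeasurableSpace (Z s)]
  {X Y : Fin 2 → Type*} [∀ i, MeasurableSpace (X i)] [∀ j, MeasurableSpace (Y j)]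

/-- The probability of `Z = z`, as a real number. -/
def Source.prob (P : Source Z X) (z : ∀ s, Z s) : ℝ := (P.weight z).toReal

/-- The law of the channel outputs given `Z = z`. -/
def Source.out (P : Source Z X) (V : Kernel (∀ i, X i) (∀ j, Y j)) (z : ∀ s, Z s) :
    Measure (∀ j, Y j) := V ∘ₘ P.inputs z

instance (P : Source Z X) (V : Kernel (∀ i, X i) (∀ j, Y j)) [IsMarkovKernel V]
    (z : ∀ s, Z s) : IsProbabilityMeasure (P.out V z) := by
  unfold Source.out; infer_instance

lemma Source.prob_eq (P : Source Z X) (z : ∀ s, Z s) :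
    P.prob z = P.base.real {common.restrict z} *
      ∏ i, (P.side i (common.restrict z)).real {(priv i).restrict z} := by
  simp [Source.prob, Source.weight, measureReal_def, ENNReal.toReal_mul]

lemma Source.prob_nonneg (P : Source Z X) (z : ∀ s, Z s) : 0 ≤ P.prob z := ENNReal.toReal_nonneg

lemma Source.weight_ne_top (P : Source Z X) (z : ∀ s, Z s) : P.weight z ≠ ∞ :=
  ENNReal.mul_ne_top (measure_ne_top _ _) (ENNReal.prod_ne_top fun _ _ => measure_ne_top _ _)

variable [∀ s, MeasurableSingletonClass (Z s)]

lemma sum_real_singleton {α : Type*} [Fintype α] [MeasurableSpace α] [MeasurableSingletonClass α]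
    (μ : Measure α) [IsProbabilityMeasure μ] : ∑ a, μ.real {a} = 1 := by
  rw [sum_measureReal_singleton]
  simp

/-- Given the common part, the private parts are independent, so the average of a product splits
into inner sums. The marginal formulas that follow are special cases. -/
lemma Source.sum_prob_split (P : Source Z X) (a : Tuple Z common → ℝ)
    (b : ∀ i, Tuple Z common → Tuple Z (priv i) → ℝ) :
    ∑ z, P.prob z * (a (common.restrict z) *
        ∏ i, b i (common.restrict z) ((priv i).restrict z))
      = ∑ z₀, P.base.real {z₀} * a z₀ * ∏ i, ∑ z, (P.side i z₀).real {z} * b i z₀ z := by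
  rw [← sum_split_prod (fun z₀ => P.base.real {z₀} * a z₀)
    (fun i z₀ z => (P.side i z₀).real {z} * b i z₀ z)]
  refine Finset.sum_congr rfl fun z _ => ?_
  rw [P.prob_eq, Finset.prod_mul_distrib]
  ring

lemma Source.sum_prob (P : Source Z X) : ∑ z, P.prob z = 1 := by
  have h := P.sum_prob_split (fun _ => 1) (fun _ _ _ => 1)
  simpa [sum_real_singleton] using h

lemma Source.sum_prob_base (P : Source Z X) (a : Tuple Z common → ℝ) :
    ∑ z, P.prob z * a (common.restrict z) = ∑ z₀, P.base.real {z₀} * a z₀ := by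
  have h := P.sum_prob_split a (fun _ _ _ => 1)
  simpa [sum_real_singleton] using h

lemma Source.sum_prob_side (P : Source Z X) (i : Fin 2)
    (b : Tuple Z common → Tuple Z (priv i) → ℝ) :
    ∑ z, P.prob z * b (common.restrict z) ((priv i).restrict z)
      = ∑ z₀, P.base.real {z₀} * ∑ z, (P.side i z₀).real {z} * b z₀ z := by
  -- The factor of the other encoder is the constant one. The transport is needed because the type
  -- of the private part depends on the encoder.
  have h := P.sum_prob_split (fun _ => 1)
    (fun i' z₀ z => if h : i' = i then b z₀ (h ▸ z) else 1)
  have e1 : ∀ z : (∀ s, Z s), ∏ i', (if h : i' = i then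
      b (common.restrict z) (h ▸ (priv i').restrict z) else 1)
      = b (common.restrict z) ((priv i).restrict z) := by
    intro z
    rw [Finset.prod_eq_single i]
    · simp
    · intro i' _ hi; simp [hi]
    · simp
  have e2 : ∀ z₀, ∏ i', ∑ z, (P.side i' z₀).real {z} * (if h : i' = i then b z₀ (h ▸ z) else 1)
      = ∑ z, (P.side i z₀).real {z} * b z₀ z := by
    intro z₀
    rw [Finset.prod_eq_single i]
    · simp
    · intro i' _ hi; simp [hi]
    · simp
  simp only [e1, e2, one_mul, mul_one] at h
  exact h

lemma Source.joint_apply (P : Source Z X) (V : Kernel (∀ i, X i) (∀ j, Y j)) [IsMarkovKernel V]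
    {S : Set ((∀ s, Z s) × (∀ j, Y j))} (hS : MeasurableSet S) :
    P.joint V S = ∑ z, P.weight z * P.out V z {y | (z, y) ∈ S} := by
  simp only [Source.joint, Measure.coe_finsetSum, Finset.sum_apply, Measure.smul_apply,
    smul_eq_mul]
  refine Finset.sum_congr rfl fun z _ => ?_
  rw [Measure.dirac_prod, Measure.map_apply measurable_prodMk_left hS]
  rfl

lemma Source.joint_real_apply (P : Source Z X) (V : Kernel (∀ i, X i) (∀ j, Y j))
    [IsMarkovKernel V] {S : Set ((∀ s, Z s) × (∀ j, Y j))} (hS : MeasurableSet S) :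
    (P.joint V).real S = ∑ z, P.prob z * (P.out V z).real {y | (z, y) ∈ S} := by
  rw [measureReal_def, P.joint_apply V hS, ENNReal.toReal_sum]
  · simp [ENNReal.toReal_mul, measureReal_def, Source.prob]
  · exact fun z _ => ENNReal.mul_ne_top (P.weight_ne_top z) (measure_ne_top _ _)

lemma Source.lintegral_joint (P : Source Z X) (V : Kernel (∀ i, X i) (∀ j, Y j))
    [IsMarkovKernel V] {F : (∀ s, Z s) × (∀ j, Y j) → ℝ≥0∞} (hF : Measurable F) :
    ∫⁻ ω, F ω ∂(P.joint V) = ∑ z, P.weight z * ∫⁻ y, F (z, y) ∂(P.out V z) := by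
  simp only [Source.joint, lintegral_finsetSum_measure, lintegral_smul_measure, smul_eq_mul]
  refine Finset.sum_congr rfl fun z _ => ?_
  rw [Measure.dirac_prod, lintegral_map hF measurable_prodMk_left]
  rfl

instance (P : Source Z X) (V : Kernel (∀ i, X i) (∀ j, Y j)) [IsMarkovKernel V] :
    IsProbabilityMeasure (P.joint V) := by
  refine ⟨?_⟩
  have h := P.joint_real_apply V MeasurableSet.univ
  simp only [Set.mem_univ, Set.ofPred_true, probReal_univ, mul_one, P.sum_prob] at h
  rw [measureReal_def, ENNReal.toReal_eq_one_iff] at h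
  exact h

end Weights

/-! ### Sampling from the posterior -/

/-- Sampling from the posterior is at most twice as bad as any decoder. -/
lemma two_mul_sum_le_lintegral_condDistrib {Ω α β : Type*} [MeasurableSpace Ω] [Fintype α]
    [Nonempty α] [MeasurableSpace α] [MeasurableSingletonClass α] [StandardBorelSpace α]
    [MeasurableSpace β] (μ : Measure Ω) [IsProbabilityMeasure μ] {A : Ω → α} {B : Ω → β}
    (hA : Measurable A) (hB : Measurable B) {E : α → Set β} (hE : ∀ a, MeasurableSet (E a))
    (hdisj : Pairwise fun a a' => Disjoint (E a) (E a')) :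
    2 * μ {ω | B ω ∈ E (A ω)} ≤ ∫⁻ ω, condDistrib A B μ (B ω) {A ω} ∂μ + 1 := by
  have h0 : μ {ω | B ω ∈ E (A ω)} ≤ ∑ a, μ {ω | A ω = a ∧ B ω ∈ E a} := by
    refine le_trans (measure_mono ?_) (measure_iUnion_fintype_le μ _)
    intro ω hω
    exact Set.mem_iUnion.2 ⟨A ω, rfl, hω⟩
  refine (mul_le_mul_right h0 2).trans ?_
  set π := condDistrib A B μ with hπ
  have hcomp : μ.map (fun ω => (B ω, A ω)) = μ.map B ⊗ₘ π :=
    (compProd_map_condDistrib hA.aemeasurable).symm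
  have : IsProbabilityMeasure (μ.map B) := Measure.isProbabilityMeasure_map hB.aemeasurable
  have hm1 : Measurable fun p : β × α => π p.1 {p.2} := by
    refine measurable_from_prod_countable_left fun a => ?_
    exact π.measurable_coe (MeasurableSet.singleton a)
  have h1 : ∫⁻ ω, π (B ω) {A ω} ∂μ = ∫⁻ b, ∑ a, π b {a} * π b {a} ∂(μ.map B) := by
    rw [← lintegral_map (f := fun p : β × α => π p.1 {p.2}) hm1 (hB.prodMk hA), hcomp,
      Measure.lintegral_compProd hm1]
    simp [lintegral_fintype]
  have h2 : ∑ a, μ {ω | A ω = a ∧ B ω ∈ E a} = ∫⁻ b, ∑ a, (E a).indicator (fun b => π b {a}) b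
      ∂(μ.map B) := by
    rw [lintegral_finsetSum]
    · refine Finset.sum_congr rfl fun a _ => ?_
      have hs : MeasurableSet ((E a) ×ˢ ({a} : Set α)) := (hE a).prod (MeasurableSet.singleton a)
      rw [lintegral_indicator (hE a), ← Measure.compProd_apply_prod (hE a) (MeasurableSet.singleton a),
        ← hcomp, Measure.map_apply (hB.prodMk hA) hs]
      congr 1
      ext ω
      simp [and_comm]
    · exact fun a _ => (π.measurable_coe (MeasurableSet.singleton a)).indicator (hE a)
  rw [h1, h2, ← lintegral_const_mul]
  · have : (1 : ℝ≥0∞) = ∫⁻ _, 1 ∂(μ.map B) := by simp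
    rw [this, ← lintegral_add_right _ measurable_const]
    refine lintegral_mono fun b => ?_
    -- At most one `a` is decoded from `b`. If `x` is its posterior mass, guessing it succeeds with
    -- probability `x`, sampling with probability at least `x²`, and `2x ≤ x² + 1`.
    by_cases hb : ∃ a, b ∈ E a
    · obtain ⟨a, ha⟩ := hb
      have hs : ∑ a, (E a).indicator (fun b => π b {a}) b = π b {a} := by
        rw [Finset.sum_eq_single a]
        · simp [ha]
        · intro a' _ haa
          refine Set.indicator_of_notMem (fun h => ?_) _
          exact Set.disjoint_left.1 (hdisj haa) h ha
        · simp
      simp only [hs]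
      have h4 : π b {a} * π b {a} ≤ ∑ a, π b {a} * π b {a} :=
        Finset.single_le_sum (f := fun a => π b {a} * π b {a}) (fun _ _ => zero_le)
          (Finset.mem_univ a)
      refine le_trans ?_ (add_le_add_left h4 1)
      have h5 : π b {a} ≠ ∞ := measure_ne_top _ _
      lift π b {a} to NNReal using h5 with x
      norm_cast
      have : (2 * (x : ℝ)) ≤ x * x + 1 := by nlinarith [sq_nonneg ((x : ℝ) - 1)]
      exact_mod_cast this
    · push Not at hb
      simp [hb]
  · exact Finset.measurable_fun_sum _ fun a _ =>
      (π.measurable_coe (MeasurableSet.singleton a)).indicator (hE a)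

/-! ### The error probability of a code built from constrained-random-number generators -/

/-- The product of two-stage laws with a finite first stage. -/
lemma pi_bind_fintype {ι : Type*} [Fintype ι] [DecidableEq ι] {α X : ι → Type*} [∀ i, Fintype (α i)]
    [∀ i, MeasurableSpace (α i)] [∀ i, MeasurableSingletonClass (α i)]
    [∀ i, MeasurableSpace (X i)] (μ : ∀ i, Measure (α i)) [∀ i, IsFiniteMeasure (μ i)]
    (κ : ∀ i, α i → Measure (X i)) [∀ i a, IsProbabilityMeasure (κ i a)] :
    Measure.pi (fun i => (μ i).bind (κ i))
      = ∑ z : (∀ i, α i), (∏ i, μ i {z i}) • Measure.pi fun i => κ i (z i) := by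
  have hb : ∀ i (S : Set (X i)), MeasurableSet S →
      (μ i).bind (κ i) S = ∑ a, μ i {a} * κ i a S := by
    intro i S hS
    rw [Measure.bind_apply hS (measurable_of_finite _).aemeasurable, lintegral_fintype]
    simp [mul_comm]
  have hf : ∀ i, IsFiniteMeasure ((μ i).bind (κ i)) := by
    intro i
    refine ⟨?_⟩
    rw [hb i _ MeasurableSet.univ]
    exact ENNReal.sum_lt_top.2 fun a _ => ENNReal.mul_lt_top (measure_lt_top _ _)
      (measure_lt_top _ _)
  refine Measure.pi_eq fun s hs => ?_
  simp only [Measure.coe_finsetSum, Finset.sum_apply, Measure.smul_apply, smul_eq_mul,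
    Measure.pi_pi]
  simp_rw [fun i => hb i (s i) (hs i)]
  rw [Finset.prod_univ_sum, Fintype.piFinset_univ]
  simp only [Finset.prod_mul_distrib]

/-- The maximum is taken over the atoms of positive mass only, so the chosen value is also a
possible outcome. -/
lemma exists_average_le {α : Type*} [Fintype α] [MeasurableSpace α] [MeasurableSingletonClass α]
    (μ : Measure α) [IsProbabilityMeasure μ] (A : α → ℝ≥0∞) :
    ∃ a, μ {a} ≠ 0 ∧ ∑ b, μ {b} * A b ≤ A a := by
  classical
  have h1 : ∑ a, μ {a} = 1 := by simp
  have hne : (Finset.univ.filter fun a => μ {a} ≠ 0).Nonempty := by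
    by_contra h
    rw [Finset.not_nonempty_iff_eq_empty, Finset.filter_eq_empty_iff] at h
    simp only [Finset.mem_univ, true_imp_iff, not_not] at h
    simp [h] at h1
  obtain ⟨a, ha, hmax⟩ := Finset.exists_max_image _ A hne
  refine ⟨a, (Finset.mem_filter.1 ha).2, ?_⟩
  calc ∑ b, μ {b} * A b ≤ ∑ b, μ {b} * A a := by
        refine Finset.sum_le_sum fun b _ => ?_
        by_cases hb : μ {b} = 0
        · simp [hb]
        · gcongr
          exact hmax b (by simp [hb])
    _ = A a := by rw [← Finset.sum_mul, h1, one_mul]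

namespace CRNG

variable {Z : Msg → Type} [∀ s, Fintype (Z s)] [∀ s, MeasurableSpace (Z s)]
  {X Y : Fin 2 → Type*} [∀ i, MeasurableSpace (X i)] [∀ j, MeasurableSpace (Y j)] {N : Msg → ℕ}
  [∀ s, Nonempty (Z s)] [∀ s, MeasurableSingletonClass (Z s)]

instance (G : CRNG Z X N) (m : Tuple (fun s => Fin (N s)) common) :
    IsFiniteMeasure (G.genCommon m) := by
  unfold genCommon; infer_instance

instance (G : CRNG Z X N) (i : Fin 2) (z₀ : Tuple Z common)
    (m : Tuple (fun s => Fin (N s)) (priv i)) : IsFiniteMeasure (G.genPriv i z₀ m) := by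
  unfold genPriv; infer_instance

variable [∀ s, StandardBorelSpace (Z s)]

instance (G : CRNG Z X N) (V : Kernel (∀ i, X i) (∀ j, Y j)) [IsMarkovKernel V] (j : Fin 2) :
    IsMarkovKernel (G.posterior V j) := by
  unfold posterior; infer_instance

instance (G : CRNG Z X N) (V : Kernel (∀ i, X i) (∀ j, Y j)) [IsMarkovKernel V] (j : Fin 2)
    (y : Y j) : IsFiniteMeasure (G.genDec V j y) := by
  unfold genDec; infer_instance

lemma genDec_apply (G : CRNG Z X N) (V : Kernel (∀ i, X i) (∀ j, Y j)) [IsMarkovKernel V]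
    (j : Fin 2) (y : Y j) (S : Set (Tuple Z (decoded j))) :
    G.genDec V j y S = (G.posterior V j y (G.bin (decoded j)))⁻¹ *
      G.posterior V j y (G.bin (decoded j) ∩ S) :=
  cond_apply (Set.toFinite _).measurableSet _ _

lemma measurable_genDec (G : CRNG Z X N) (V : Kernel (∀ i, X i) (∀ j, Y j)) [IsMarkovKernel V]
    (j : Fin 2) : Measurable (G.genDec V j) := by
  refine Measure.measurable_of_measurable_coe _ fun S _ => ?_
  simp only [genDec_apply]
  exact ((G.posterior V j).measurable_coe (Set.toFinite _).measurableSet).inv.mul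
    ((G.posterior V j).measurable_coe (Set.toFinite _).measurableSet)

/-- The probability that both decoders output `m` if the auxiliary variables are `z`. -/
def success (G : CRNG Z X N) (V : Kernel (∀ i, X i) (∀ j, Y j)) [IsMarkovKernel V]
    (m : ∀ s, Fin (N s)) (z : ∀ s, Z s) : ℝ≥0∞ :=
  ∫⁻ y, ∏ j, G.genDec V j (y j) {w | ∀ s : decoded j, G.g s (w s) = m s} ∂(G.src.out V z)

lemma measurable_success_integrand (G : CRNG Z X N) (V : Kernel (∀ i, X i) (∀ j, Y j))
    [IsMarkovKernel V] (m : ∀ s, Fin (N s)) :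
    Measurable fun y : (∀ j, Y j) =>
      ∏ j, G.genDec V j (y j) {w | ∀ s : decoded j, G.g s (w s) = m s} := by
  refine Finset.measurable_fun_prod _ fun j _ => ?_
  exact ((Measure.measurable_coe (Set.toFinite _).measurableSet).comp
    (G.measurable_genDec V j)).comp (measurable_pi_apply j)

lemma lintegral_lintegral_inputs (G : CRNG Z X N) (V : Kernel (∀ i, X i) (∀ j, Y j))
    [IsMarkovKernel V] (z : ∀ s, Z s) {F : (∀ j, Y j) → ℝ≥0∞} (hF : Measurable F) :
    ∫⁻ x, ∫⁻ y, F y ∂(V x) ∂(Measure.pi fun i =>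
      G.src.input i (common.restrict z, (priv i).restrict z)) = ∫⁻ y, F y ∂(G.src.out V z) := by
  rw [Source.out, Measure.lintegral_bind V.aemeasurable hF.aemeasurable]
  rfl

/-- The generators have finite alphabets, so their integrals are sums; only the channel inputs and
outputs remain integrated, inside `success`. -/
lemma errorProb_eq (G : CRNG Z X N) (V : Kernel (∀ i, X i) (∀ j, Y j)) [IsMarkovKernel V] :
    G.errorProb V = 1 - (∑ m : (∀ s, Fin (N s)), ∑ z : (∀ s, Z s),
      G.genCommon (common.restrict m) {common.restrict z} *
        ((∏ i, G.genPriv i (common.restrict z) ((priv i).restrict m) {(priv i).restrict z}) *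
          G.success V m z)) / ∏ s, (N s : ℝ≥0∞) := by
  rw [errorProb]
  congr 2
  refine Finset.sum_congr rfl fun m _ => ?_
  have h := sum_split (Z := Z) (M := ℝ≥0∞) (fun z₀ z => G.genCommon (common.restrict m) {z₀} *
        ((∏ i, G.genPriv i z₀ ((priv i).restrict m) {z i}) *
          G.success V m ((splitEquiv Z).symm (z₀, z))))
  have e : ∀ z : (∀ s, Z s), (splitEquiv Z).symm
      (common.restrict z, fun i => (priv i).restrict z) = z := fun z =>
    (splitEquiv Z).symm_apply_apply z
  simp only [e] at h
  rw [h, lintegral_fintype]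
  refine Finset.sum_congr rfl fun z₀ _ => ?_
  rw [mul_comm, lintegral_fintype, Finset.mul_sum]
  refine Finset.sum_congr rfl fun z _ => ?_
  congr 1
  rw [mul_comm, Measure.pi_singleton, success]
  congr 1
  rw [← G.lintegral_lintegral_inputs V _ (G.measurable_success_integrand V m)]
  have e2 := (splitEquiv Z).apply_symm_apply (z₀, z)
  have e3 : common.restrict ((splitEquiv Z).symm (z₀, z)) = z₀ := congrArg Prod.fst e2
  have e4 : ∀ i, (priv i).restrict ((splitEquiv Z).symm (z₀, z)) = z i :=
    fun i => congrFun (congrArg Prod.snd e2) i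
  simp only [e3, e4]

/-- Fixing the shared output of the generator of `Z_{S₀}`. -/
theorem exists_implements (G : CRNG Z X N) (V : Kernel (∀ i, X i) (∀ j, Y j)) [IsMarkovKernel V]
    (hN : ∀ s, 0 < N s) :
    ∃ (τ : Tuple (fun s => Fin (N s)) common → Tuple Z common) (K : Code N X Y),
      G.Implements V τ K ∧ K.errorProb V ≤ G.errorProb V := by
  classical
  have hNe : ∀ s, Nonempty (Fin (N s)) := fun s => ⟨⟨0, hN s⟩⟩
  have hsub0 : ∀ i, common ⊆ avail i := fun i => Finset.subset_union_left
  have hsubi : ∀ i, priv i ⊆ avail i := fun i => Finset.subset_union_right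
  -- the contribution of the pair `(m₀, z₀)`
  let A : Tuple (fun s => Fin (N s)) common → Tuple Z common → ℝ≥0∞ := fun m₀ z₀ =>
    ∑ m : (∀ i, Tuple (fun s => Fin (N s)) (priv i)), ∑ z : (∀ i, Tuple Z (priv i)),
      (∏ i, G.genPriv i z₀ (m i) {z i}) *
        G.success V ((splitEquiv fun s => Fin (N s)).symm (m₀, m))
          ((splitEquiv Z).symm (z₀, z))
  -- If the bin is null the generator is the zero measure, the average vanishes, and any value will
  -- do.
  have hτ : ∀ m₀, ∃ z₀, (G.src.base (G.msgBin common m₀) ≠ 0 → G.genCommon m₀ {z₀} ≠ 0) ∧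
      ∑ z, G.genCommon m₀ {z} * A m₀ z ≤ A m₀ z₀ := by
    intro m₀
    by_cases h : G.src.base (G.msgBin common m₀) = 0
    · refine ⟨Classical.arbitrary _, fun h' => absurd h h', ?_⟩
      simp [genCommon, cond_eq_zero_of_meas_eq_zero h]
    · have : IsProbabilityMeasure (G.genCommon m₀) := cond_isProbabilityMeasure h
      obtain ⟨a, ha, hle⟩ := exists_average_le (G.genCommon m₀) (A m₀)
      exact ⟨a, fun _ => ha, hle⟩
  choose τ hτ1 hτ2 using hτ
  have hX : ∀ i, Nonempty (X i) := fun i =>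
    nonempty_of_isProbabilityMeasure (G.src.input i (Classical.arbitrary _))
  let ok : ∀ i, Tuple (fun s => Fin (N s)) (avail i) → Prop := fun i m =>
    G.src.side i (τ (Finset.restrict₂ (π := fun s => Fin (N s)) (hsub0 i) m))
        (G.msgBin (priv i) (Finset.restrict₂ (π := fun s => Fin (N s)) (hsubi i) m)) ≠ 0
  -- Point masses at arbitrary values fill in wherever a generator has a zero denominator. There the
  -- generator counts as an error anyway, so this can only help.
  let K : Code N X Y :=
    { enc := fun i m => if ok i m then
          (G.genPriv i (τ (Finset.restrict₂ (π := fun s => Fin (N s)) (hsub0 i) m)) (Finset.restrict₂ (π := fun s => Fin (N s)) (hsubi i) m)).bind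
            fun z => G.src.input i (τ (Finset.restrict₂ (π := fun s => Fin (N s)) (hsub0 i) m), z)
        else Measure.dirac (Classical.arbitrary _)
      dec := fun j =>
        { toFun := fun y => if G.posterior V j y (G.bin (decoded j)) = 0 then
              Measure.dirac (Classical.arbitrary _)
            else (G.genDec V j y).map fun z (s : decoded j) => G.g s (z s)
          measurable' := by
            refine Measurable.ite ?_ measurable_const ?_
            · exact (G.posterior V j).measurable_coe (Set.toFinite _).measurableSet
                (measurableSet_singleton 0)
            · exact (Measure.measurable_map _ (measurable_of_finite _)).comp
                (G.measurable_genDec V j) }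
      enc_prob := by
        intro i m
        split_ifs with h
        · have : IsProbabilityMeasure (G.genPriv i (τ (Finset.restrict₂ (π := fun s => Fin (N s)) (hsub0 i) m))
              (Finset.restrict₂ (π := fun s => Fin (N s)) (hsubi i) m)) := cond_isProbabilityMeasure h
          exact isProbabilityMeasure_bind (measurable_of_finite _).aemeasurable
            (Filter.Eventually.of_forall fun z => inferInstance)
        · infer_instance
      dec_markov := by
        intro j
        refine ⟨fun y => ?_⟩
        change IsProbabilityMeasure (if _ then _ else _)
        split_ifs with h
        · infer_instance
        · have : IsProbabilityMeasure (G.genDec V j y) := cond_isProbabilityMeasure h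
          exact Measure.isProbabilityMeasure_map (measurable_of_finite _).aemeasurable }
  refine ⟨τ, K, ⟨hτ1, ?_, ?_⟩, ?_⟩
  · intro i m _ h
    have : ok i ((avail i).restrict m) := h
    change (if _ then _ else _) = _
    rw [if_pos this]
    rfl
  · intro j y h
    change (if _ then _ else _) = _
    rw [if_neg h]
  -- the success probability of the code for a given message
  let σ : (∀ s, Fin (N s)) → ℝ≥0∞ := fun m =>
    ∫⁻ x, ∫⁻ y, ∏ j, K.dec j (y j) {(decoded j).restrict m} ∂(V x)
      ∂(Measure.pi fun i => K.enc i ((avail i).restrict m))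
  have hencp : ∀ i m, IsProbabilityMeasure (K.enc i m) := K.enc_prob
  have hdecp : ∀ j, IsMarkovKernel (K.dec j) := K.dec_markov
  have hmeas : ∀ m : (∀ s, Fin (N s)), Measurable fun y : (∀ j, Y j) =>
      ∏ j, K.dec j (y j) {(decoded j).restrict m} := by
    intro m
    refine Finset.measurable_fun_prod _ fun j _ => ?_
    exact ((K.dec j).measurable_coe (measurableSet_singleton _)).comp (measurable_pi_apply j)
  have hle1 : ∀ (m : ∀ s, Fin (N s)) (y : ∀ j, Y j),
      ∏ j, K.dec j (y j) {(decoded j).restrict m} ≤ 1 :=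
    fun m y => Finset.prod_le_one' fun j _ => prob_le_one
  have hσle : ∀ m, σ m ≤ 1 := by
    intro m
    calc σ m ≤ ∫⁻ x, ∫⁻ y, 1 ∂(V x) ∂(Measure.pi fun i => K.enc i ((avail i).restrict m)) :=
          lintegral_mono fun x => lintegral_mono fun y => hle1 m y
      _ = 1 := by simp
  have hpoint : ∀ m : (∀ s, Fin (N s)), ∫⁻ x, ∫⁻ y, Measure.pi (fun j => K.dec j (y j))
      {w | ∃ j, w j ≠ (decoded j).restrict m} ∂(V x)
        ∂(Measure.pi fun i => K.enc i ((avail i).restrict m)) = 1 - σ m := by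
    intro m
    have e1 : ∀ y : (∀ j, Y j), Measure.pi (fun j => K.dec j (y j))
        {w | ∃ j, w j ≠ (decoded j).restrict m}
          = 1 - ∏ j, K.dec j (y j) {(decoded j).restrict m} := by
      intro y
      have : {w : (∀ j, Tuple (fun s => Fin (N s)) (decoded j)) |
          ∃ j, w j ≠ (decoded j).restrict m} = {fun j => (decoded j).restrict m}ᶜ := by
        ext w
        simp only [Set.mem_ofPred_eq, Set.mem_compl_iff, Set.mem_singleton_iff]
        rw [← not_forall.trans Iff.rfl, not_iff_not]
        exact funext_iff.symm
      rw [this, prob_compl_eq_one_sub (measurableSet_singleton _), Measure.pi_singleton]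
    simp only [e1]
    have e2 : ∀ x, ∫⁻ y, (1 - ∏ j, K.dec j (y j) {(decoded j).restrict m}) ∂(V x)
        = 1 - ∫⁻ y, ∏ j, K.dec j (y j) {(decoded j).restrict m} ∂(V x) := by
      intro x
      rw [lintegral_sub (hmeas m) _ (Filter.Eventually.of_forall fun y => hle1 m y)]
      · simp
      · refine ne_top_of_le_ne_top ENNReal.one_ne_top ((lintegral_mono fun y => hle1 m y).trans ?_)
        simp
    simp only [e2]
    rw [lintegral_sub ((hmeas m).lintegral_kernel)
      (ne_top_of_le_ne_top ENNReal.one_ne_top (hσle m))]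
    · simp [σ]
    · refine Filter.Eventually.of_forall fun x => (lintegral_mono fun y => hle1 m y).trans ?_
      simp
  have hcardN : ∑ _m : (∀ s, Fin (N s)), (1 : ℝ≥0∞) = ∏ s, (N s : ℝ≥0∞) := by
    simp [Fintype.card_pi]
  have hN0 : ∏ s, (N s : ℝ≥0∞) ≠ 0 :=
    Finset.prod_ne_zero_iff.2 fun s _ => by exact_mod_cast (hN s).ne'
  have hNtop : ∏ s, (N s : ℝ≥0∞) ≠ ∞ := ENNReal.prod_ne_top fun s _ => ENNReal.natCast_ne_top _
  have hK : K.errorProb V = 1 - (∑ m, σ m) / ∏ s, (N s : ℝ≥0∞) := by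
    rw [Code.errorProb]
    simp only [hpoint]
    have hsum : ∑ m, (1 - σ m) + ∑ m, σ m = ∏ s, (N s : ℝ≥0∞) := by
      rw [← Finset.sum_add_distrib, ← hcardN]
      exact Finset.sum_congr rfl fun m _ => tsub_add_cancel_of_le (hσle m)
    have hfin : ∑ m, σ m ≠ ∞ := (ENNReal.sum_lt_top.2 fun m _ =>
      (hσle m).trans_lt ENNReal.one_lt_top).ne
    rw [← ENNReal.eq_sub_of_add_eq hfin hsum |>.symm, ENNReal.sub_div (fun _ _ => hN0),
      ENNReal.div_self hN0 hNtop]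
  rw [hK, errorProb_eq]
  refine tsub_le_tsub_left (ENNReal.div_le_div_right ?_ _) 1
  -- regroup the messages and the auxiliary variables
  have hsplit : ∑ m : (∀ s, Fin (N s)), ∑ z : (∀ s, Z s),
      G.genCommon (common.restrict m) {common.restrict z} *
        ((∏ i, G.genPriv i (common.restrict z) ((priv i).restrict m) {(priv i).restrict z}) *
          G.success V m z) = ∑ m₀, ∑ z₀, G.genCommon m₀ {z₀} * A m₀ z₀ := by
    have h1 : ∀ m : (∀ s, Fin (N s)), ∑ z : (∀ s, Z s),
      G.genCommon (common.restrict m) {common.restrict z} *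
        ((∏ i, G.genPriv i (common.restrict z) ((priv i).restrict m) {(priv i).restrict z}) *
          G.success V m z) = ∑ z₀, ∑ z : (∀ i, Tuple Z (priv i)),
            G.genCommon (common.restrict m) {z₀} *
              ((∏ i, G.genPriv i z₀ ((priv i).restrict m) {z i}) *
                G.success V m ((splitEquiv Z).symm (z₀, z))) := by
      intro m
      rw [← sum_split (Z := Z) fun z₀ z => G.genCommon (common.restrict m) {z₀} *
              ((∏ i, G.genPriv i z₀ ((priv i).restrict m) {z i}) *
                G.success V m ((splitEquiv Z).symm (z₀, z)))]
      refine Finset.sum_congr rfl fun z _ => ?_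
      rw [show (splitEquiv Z).symm (common.restrict z, fun i => (priv i).restrict z) = z from
        (splitEquiv Z).symm_apply_apply z]
    simp only [h1]
    have h2 := sum_split (Z := fun s => Fin (N s)) fun m₀ m => ∑ z₀, ∑ z : (∀ i, Tuple Z (priv i)),
            G.genCommon m₀ {z₀} * ((∏ i, G.genPriv i z₀ (m i) {z i}) *
                G.success V ((splitEquiv fun s => Fin (N s)).symm (m₀, m))
                  ((splitEquiv Z).symm (z₀, z)))
    have e : ∀ m : (∀ s, Fin (N s)), (splitEquiv fun s => Fin (N s)).symm
      (common.restrict m, fun i => (priv i).restrict m) = m := fun m =>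
        (splitEquiv fun s => Fin (N s)).symm_apply_apply m
    simp only [e] at h2
    rw [h2]
    refine Finset.sum_congr rfl fun m₀ _ => ?_
    rw [Finset.sum_comm]
    refine Finset.sum_congr rfl fun z₀ _ => ?_
    simp only [A, Finset.mul_sum]
  rw [hsplit]
  -- The average is at most the value at `τ m₀`, which the code attains up to the gain from default
  -- outputs. If some private bin is null, the contribution of that message to `A` is zero.
  have hstep : ∀ m₀, ∑ z₀, G.genCommon m₀ {z₀} * A m₀ z₀ ≤
      ∑ m, σ ((splitEquiv fun s => Fin (N s)).symm (m₀, m)) := by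
    intro m₀
    by_cases hb : G.src.base (G.msgBin common m₀) = 0
    · simp [genCommon, cond_eq_zero_of_meas_eq_zero hb]
    refine (hτ2 m₀).trans (Finset.sum_le_sum fun m _ => ?_)
    set M := (splitEquiv fun s => Fin (N s)).symm (m₀, m) with hM
    have eM := (splitEquiv fun s => Fin (N s)).apply_symm_apply (m₀, m)
    have eM0 : common.restrict M = m₀ := congrArg Prod.fst eM
    have eMi : ∀ i, (priv i).restrict M = m i := fun i => congrFun (congrArg Prod.snd eM) i
    by_cases hs : ∀ i, G.src.side i (τ m₀) (G.msgBin (priv i) (m i)) ≠ 0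
    · have henc : (fun i => K.enc i ((avail i).restrict M)) = fun i =>
          (G.genPriv i (τ m₀) (m i)).bind fun z => G.src.input i (τ m₀, z) := by
        funext i
        have : ok i ((avail i).restrict M) := by
          have := hs i
          rw [← eM0, ← eMi i] at this
          exact this
        change (if _ then _ else _) = _
        rw [if_pos this, ← eM0, ← eMi i]
        rfl
      have hdec : ∀ (j : Fin 2) (y : Y j), G.genDec V j y {w | ∀ s : decoded j, G.g s (w s) = M s}
          ≤ K.dec j y {(decoded j).restrict M} := by
        intro j y
        by_cases h : G.posterior V j y (G.bin (decoded j)) = 0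
        · simp [genDec, cond_eq_zero_of_meas_eq_zero h]
        · change _ ≤ (if _ then _ else _ : Measure _) _
          rw [if_neg h, Measure.map_apply (measurable_of_finite _) (measurableSet_singleton _)]
          refine le_of_eq (congrArg _ ?_)
          ext w
          simp [funext_iff, Finset.restrict]
      simp only [σ]
      rw [henc, pi_bind_fintype (fun i => G.genPriv i (τ m₀) (m i))
        (fun i z => G.src.input i (τ m₀, z)), lintegral_finsetSum_measure]
      refine Finset.sum_le_sum fun z _ => ?_
      rw [lintegral_smul_measure, smul_eq_mul]
      refine mul_le_mul_right ?_ _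
      have e2 := (splitEquiv Z).apply_symm_apply (τ m₀, z)
      have e3 : common.restrict ((splitEquiv Z).symm (τ m₀, z)) = τ m₀ := congrArg Prod.fst e2
      have e4 : ∀ i, (priv i).restrict ((splitEquiv Z).symm (τ m₀, z)) = z i :=
        fun i => congrFun (congrArg Prod.snd e2) i
      rw [success, ← G.lintegral_lintegral_inputs V _ (G.measurable_success_integrand V M)]
      simp only [e3, e4]
      exact lintegral_mono fun x => lintegral_mono fun y =>
        Finset.prod_le_prod' fun j _ => hdec j (y j)
    · push Not at hs
      obtain ⟨i, hi⟩ := hs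
      have : ∀ z : (∀ i, Tuple Z (priv i)), ∏ i, G.genPriv i (τ m₀) (m i) {z i} = 0 := by
        intro z
        refine Finset.prod_eq_zero (Finset.mem_univ i) ?_
        simp [genPriv, cond_eq_zero_of_meas_eq_zero hi]
      simp [this]
  refine (Finset.sum_le_sum fun m₀ _ => hstep m₀).trans (le_of_eq ?_)
  rw [← Fintype.sum_prod_type' (f := fun m₀ m => σ ((splitEquiv fun s => Fin (N s)).symm (m₀, m)))]
  exact (splitEquiv fun s => Fin (N s)).symm.sum_comp σ

end CRNG

/-! ### Bounding the error probability by decoding errors and non-uniformity of the messages -/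

namespace CRNG

variable {Z : Msg → Type} [∀ s, Fintype (Z s)] [∀ s, MeasurableSpace (Z s)]
  {X Y : Fin 2 → Type*} [∀ i, MeasurableSpace (X i)] [∀ j, MeasurableSpace (Y j)] {N : Msg → ℕ}
  [∀ s, Nonempty (Z s)] [∀ s, MeasurableSingletonClass (Z s)]

/-- The values of the functions `g s`. -/
def label (G : CRNG Z X N) (T : Finset Msg) (z : Tuple Z T) : Tuple (fun s => Fin (N s)) T :=
  fun s => G.g s (z s)

/-- The ratio of the uniform law to the law `μ` of the messages, capped at `1`. -/
def ratio (G : CRNG Z X N) (T : Finset Msg) (μ : Measure (Tuple Z T))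
    (m : Tuple (fun s => Fin (N s)) T) : ℝ :=
  min 1 ((∏ s ∈ T, (N s : ℝ)) * μ.real (G.msgBin T m))⁻¹

lemma ratio_nonneg (G : CRNG Z X N) (T : Finset Msg) (μ : Measure (Tuple Z T))
    (m : Tuple (fun s => Fin (N s)) T) : 0 ≤ G.ratio T μ m :=
  le_min zero_le_one (by positivity)

lemma ratio_le_one (G : CRNG Z X N) (T : Finset Msg) (μ : Measure (Tuple Z T))
    (m : Tuple (fun s => Fin (N s)) T) : G.ratio T μ m ≤ 1 := min_le_left _ _

/-- Grouping `z` by its label weights each shortfall by the mass `a` of the bin, and `a * (1 - min 1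
(1 / (n * a)))` is the positive part of `a - 1 / n`. Thanks to the cap, bins that are too light cost
nothing. -/
lemma sum_one_sub_ratio_le (G : CRNG Z X N) (hN : ∀ s, 0 < N s) (T : Finset Msg)
    (μ : Measure (Tuple Z T)) [IsProbabilityMeasure μ] {b : Tuple Z T → ℝ}
    (hb : ∀ z, μ.real {z} * b z ≤ μ.real {z} * (open Classical in
      if z ∈ G.msgBin T (G.label T z) then 1 - G.ratio T μ (G.label T z) else 0)) :
    ∑ z, μ.real {z} * b z ≤
      ∑ m, max (μ.real (G.msgBin T m) - 1 / ∏ s ∈ T, (N s : ℝ)) 0 := by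
  classical
  have hNT : (0 : ℝ) < ∏ s ∈ T, (N s : ℝ) := Finset.prod_pos fun s _ => by exact_mod_cast hN s
  calc ∑ z, μ.real {z} * b z
      ≤ ∑ z, μ.real {z} * (if z ∈ G.msgBin T (G.label T z) then
          1 - G.ratio T μ (G.label T z) else 0) := Finset.sum_le_sum fun z _ => by convert hb z
    _ = ∑ z, ∑ m, (if z ∈ G.msgBin T m then μ.real {z} else 0) * (1 - G.ratio T μ m) := by
        refine Finset.sum_congr rfl fun z _ => ?_
        rw [Finset.sum_eq_single (G.label T z)]
        · split_ifs <;> simp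
        · intro m _ hm
          rw [if_neg, zero_mul]
          intro h
          exact hm (funext fun s => (h s).2.symm)
        · simp
    _ = ∑ m, μ.real (G.msgBin T m) * (1 - G.ratio T μ m) := by
        rw [Finset.sum_comm]
        refine Finset.sum_congr rfl fun m _ => ?_
        rw [← Finset.sum_mul, ← Finset.sum_filter, sum_measureReal_singleton]
        congr 2
        ext z; simp
    _ ≤ _ := by
        refine Finset.sum_le_sum fun m _ => ?_
        set a := μ.real (G.msgBin T m)
        have ha : 0 ≤ a := measureReal_nonneg
        rw [ratio]
        rcases min_choice (1 : ℝ) ((∏ s ∈ T, (N s : ℝ)) * a)⁻¹ with h | h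
        · rw [h]; simp
        · rw [h]
          rcases ha.eq_or_lt with h0 | h0
          · rw [← h0]; simp
          · refine le_trans (le_of_eq ?_) (le_max_left _ _)
            field_simp

variable [∀ s, StandardBorelSpace (Z s)]

lemma success_le_one (G : CRNG Z X N) (V : Kernel (∀ i, X i) (∀ j, Y j)) [IsMarkovKernel V]
    (m : ∀ s, Fin (N s)) (z : ∀ s, Z s) : G.success V m z ≤ 1 := by
  calc G.success V m z ≤ ∫⁻ _, 1 ∂(G.src.out V z) := by
        refine lintegral_mono fun y => Finset.prod_le_one' fun j _ => ?_
        rw [genDec_apply]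
        refine (mul_le_mul_right (measure_mono Set.inter_subset_left) _).trans ?_
        exact ENNReal.inv_mul_le_one _
    _ = 1 := by simp

/-- The probability that the posterior given the output for `z` assigns to `z`. -/
def hit (G : CRNG Z X N) (V : Kernel (∀ i, X i) (∀ j, Y j)) [IsMarkovKernel V] (j : Fin 2)
    (z : ∀ s, Z s) : ℝ≥0∞ :=
  ∫⁻ y, G.posterior V j (y j) {(decoded j).restrict z} ∂(G.src.out V z)

lemma hit_le_one (G : CRNG Z X N) (V : Kernel (∀ i, X i) (∀ j, Y j)) [IsMarkovKernel V]
    (j : Fin 2) (z : ∀ s, Z s) : G.hit V j z ≤ 1 := by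
  calc G.hit V j z ≤ ∫⁻ _, 1 ∂(G.src.out V z) := lintegral_mono fun y => prob_le_one
    _ = 1 := by simp

/-- Conditioning the posterior on a bin that contains the true sequence can only raise its mass.
Then `a + b ≤ a * b + 1` on the unit interval acts as a union bound over the two decoders. -/
lemma sum_hit_le (G : CRNG Z X N) (V : Kernel (∀ i, X i) (∀ j, Y j)) [IsMarkovKernel V]
    (z : ∀ s, Z s) (hz : ∀ s, G.f s (z s) = G.c s) :
    G.hit V 0 z + G.hit V 1 z ≤ G.success V (fun s => G.g s (z s)) z + 1 := by
  have hone : (1 : ℝ≥0∞) = ∫⁻ _, 1 ∂(G.src.out V z) := by simp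
  have hm : ∀ j, Measurable fun y : (∀ j, Y j) =>
      G.posterior V j (y j) {(decoded j).restrict z} := fun j =>
    ((G.posterior V j).measurable_coe (measurableSet_singleton _)).comp (measurable_pi_apply j)
  conv_rhs => rw [hone]
  rw [hit, hit, success, ← lintegral_add_left (hm 0), ← lintegral_add_right _ measurable_const]
  refine lintegral_mono fun y => ?_
  have hle : ∀ j, G.posterior V j (y j) {(decoded j).restrict z} ≤
      G.genDec V j (y j) {w | ∀ s : decoded j, G.g s (w s) = G.g s (z s)} := by
    intro j
    rw [genDec_apply]
    have hsub : {(decoded j).restrict z} ⊆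
        G.bin (decoded j) ∩ {w | ∀ s : decoded j, G.g s (w s) = G.g s (z s)} := by
      rintro _ rfl
      exact ⟨fun s => hz s, fun s => rfl⟩
    calc G.posterior V j (y j) {(decoded j).restrict z}
        ≤ G.posterior V j (y j)
          (G.bin (decoded j) ∩ {w | ∀ s : decoded j, G.g s (w s) = G.g s (z s)}) :=
          measure_mono hsub
      _ = 1 * _ := (one_mul _).symm
      _ ≤ _ := by
          gcongr
          exact ENNReal.one_le_inv.2 prob_le_one
  rw [Fin.prod_univ_two]
  refine le_trans ?_ (add_le_add_left (mul_le_mul' (hle 0) (hle 1)) 1)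
  have h0 : G.posterior V 0 (y 0) {(decoded 0).restrict z} ≤ 1 := prob_le_one
  have h1 : G.posterior V 1 (y 1) {(decoded 1).restrict z} ≤ 1 := prob_le_one
  generalize G.posterior V 0 (y 0) {(decoded 0).restrict z} = a at h0 ⊢
  generalize G.posterior V 1 (y 1) {(decoded 1).restrict z} = b at h1 ⊢
  lift a to NNReal using ne_top_of_le_ne_top ENNReal.one_ne_top h0
  lift b to NNReal using ne_top_of_le_ne_top ENNReal.one_ne_top h1
  norm_cast at h0 h1 ⊢
  have h0' : (a : ℝ) ≤ 1 := by exact_mod_cast h0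
  have h1' : (b : ℝ) ≤ 1 := by exact_mod_cast h1
  have : (a : ℝ) + b ≤ a * b + 1 := by nlinarith
  rw [ENNReal.coe_le_coe, ← NNReal.coe_le_coe]
  push_cast
  exact this

/-- A disjoint family `E` is a deterministic decoder; this is `two_mul_sum_le_lintegral_condDistrib`
for `Z_{D_j}` and `Y_j`, written as a sum over `z`. -/
lemma two_mul_le_sum_hit (G : CRNG Z X N) (V : Kernel (∀ i, X i) (∀ j, Y j)) [IsMarkovKernel V]
    (j : Fin 2) {E : Tuple Z (decoded j) → Set (Y j)} (hE : ∀ a, MeasurableSet (E a))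
    (hdisj : Pairwise fun a a' => Disjoint (E a) (E a')) :
    2 * ∑ z, G.src.prob z * (G.src.out V z).real {y | y j ∈ E ((decoded j).restrict z)}
      ≤ ∑ z, G.src.prob z * (G.hit V j z).toReal + 1 := by
  have hA : Measurable fun ω : (∀ s, Z s) × (∀ j, Y j) => (decoded j).restrict ω.1 :=
    (measurable_of_finite fun z : (∀ s, Z s) => (decoded j).restrict z).comp measurable_fst
  have hB : Measurable fun ω : (∀ s, Z s) × (∀ j, Y j) => ω.2 j :=
    (measurable_pi_apply j).comp measurable_snd
  have h := two_mul_sum_le_lintegral_condDistrib (G.src.joint V) hA hB hE hdisj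
  have hS : MeasurableSet {ω : (∀ s, Z s) × (∀ j, Y j) | ω.2 j ∈ E ((decoded j).restrict ω.1)} := by
    have : {ω : (∀ s, Z s) × (∀ j, Y j) | ω.2 j ∈ E ((decoded j).restrict ω.1)} =
        ⋃ a, {ω | (decoded j).restrict ω.1 = a} ∩ {ω | ω.2 j ∈ E a} := by
      ext ω; simp
    rw [this]
    exact MeasurableSet.iUnion fun a =>
      (hA (measurableSet_singleton a)).inter (hB (hE a))
  have hm : Measurable fun ω : (∀ s, Z s) × (∀ j, Y j) =>
      G.posterior V j (ω.2 j) {(decoded j).restrict ω.1} := by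
    refine measurable_from_prod_countable_right fun z => ?_
    change Measurable fun y : (∀ j, Y j) => G.posterior V j (y j) {(decoded j).restrict z}
    exact ((G.posterior V j).measurable_coe (measurableSet_singleton _)).comp
      (measurable_pi_apply j)
  have h2 : ∫⁻ ω, G.posterior V j (ω.2 j) {(decoded j).restrict ω.1} ∂(G.src.joint V)
      = ∑ z, G.src.weight z * G.hit V j z := G.src.lintegral_joint V hm
  change 2 * _ ≤ ∫⁻ ω, G.posterior V j (ω.2 j) {(decoded j).restrict ω.1} ∂(G.src.joint V) + 1 at h
  rw [h2] at h
  have hfin : ∀ z ∈ Finset.univ, G.src.weight z * G.hit V j z ≠ ∞ := fun z _ =>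
    ENNReal.mul_ne_top (G.src.weight_ne_top z)
      (ne_top_of_le_ne_top ENNReal.one_ne_top (G.hit_le_one V j z))
  have h3 := ENNReal.toReal_mono (ENNReal.add_ne_top.2
    ⟨ENNReal.sum_ne_top.2 hfin, ENNReal.one_ne_top⟩) h
  rw [ENNReal.toReal_add (ENNReal.sum_ne_top.2 hfin) ENNReal.one_ne_top, ENNReal.toReal_mul,
    ENNReal.toReal_sum hfin] at h3
  simp only [ENNReal.toReal_mul, ENNReal.toReal_ofNat, ENNReal.toReal_one] at h3
  rw [← measureReal_def, G.src.joint_real_apply V hS] at h3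
  exact h3

/-- The error probability is at most twice the error probabilities of any decoders plus the
deviations of the laws of the messages from the uniform law. -/
theorem errorProb_le (G : CRNG Z X N) (V : Kernel (∀ i, X i) (∀ j, Y j)) [IsMarkovKernel V]
    (hN : ∀ s, 0 < N s) (hbin : ∀ z, G.src.prob z ≠ 0 → ∀ s, G.f s (z s) = G.c s)
    {E : ∀ j, Tuple Z (decoded j) → Set (Y j)} (hE : ∀ j a, MeasurableSet (E j a))
    (hdisj : ∀ j, Pairwise fun a a' => Disjoint (E j a) (E j a')) :
    G.errorProb V ≤ ENNReal.ofReal (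
      ∑ j, 2 * (1 - ∑ z, G.src.prob z *
        (G.src.out V z).real {y | y j ∈ E j ((decoded j).restrict z)}) +
      ∑ m, max (G.src.base.real (G.msgBin common m) - 1 / ∏ s ∈ common, (N s : ℝ)) 0 +
      ∑ i, ∑ z₀, G.src.base.real {z₀} *
        ∑ m, max ((G.src.side i z₀).real (G.msgBin (priv i) m) - 1 / ∏ s ∈ priv i, (N s : ℝ)) 0) := by
  classical
  have hNpos : ∀ T : Finset Msg, (0 : ℝ) < ∏ s ∈ T, (N s : ℝ) := fun T =>
    Finset.prod_pos fun s _ => by exact_mod_cast hN s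
  have hN0 : ∏ s, (N s : ℝ≥0∞) ≠ 0 :=
    Finset.prod_ne_zero_iff.2 fun s _ => by exact_mod_cast (hN s).ne'
  let u₀ : (∀ s, Z s) → ℝ := fun z =>
    G.ratio common G.src.base (G.label common (common.restrict z))
  let u : Fin 2 → (∀ s, Z s) → ℝ := fun i z =>
    G.ratio (priv i) (G.src.side i (common.restrict z)) (G.label (priv i) ((priv i).restrict z))
  let κ : (∀ s, Z s) → ℝ := fun z => (G.success V (fun s => G.g s (z s)) z).toReal
  have hκ0 : ∀ z, 0 ≤ κ z := fun z => ENNReal.toReal_nonneg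
  have hκ1 : ∀ z, κ z ≤ 1 := fun z => by
    have := ENNReal.toReal_mono ENNReal.one_ne_top (G.success_le_one V (fun s => G.g s (z s)) z)
    simpa using this
  let F : (∀ s, Fin (N s)) → (∀ s, Z s) → ℝ≥0∞ := fun m z =>
    G.genCommon (common.restrict m) {common.restrict z} *
        ((∏ i, G.genPriv i (common.restrict z) ((priv i).restrict m) {(priv i).restrict z}) *
          G.success V m z)
  have hFtop : ∀ m z, F m z / ∏ s, (N s : ℝ≥0∞) ≠ ∞ := by
    intro m z
    refine ENNReal.div_ne_top (ENNReal.mul_ne_top (measure_ne_top _ _) (ENNReal.mul_ne_top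
      (ENNReal.prod_ne_top fun i _ => measure_ne_top _ _) ?_)) hN0
    exact ne_top_of_le_ne_top ENNReal.one_ne_top (G.success_le_one V m z)
  -- For the message family read off from `z` itself, the three normalizations of the generators
  -- together with the uniform weight of the messages are the uncapped ratios; capping them gives a
  -- lower bound.
  have hterm : ∀ z, G.src.prob z * (κ z * (u₀ z * (u 0 z * u 1 z))) ≤
      (F (fun s => G.g s (z s)) z / ∏ s, (N s : ℝ≥0∞)).toReal := by
    intro z
    by_cases hz : G.src.prob z = 0
    · rw [hz, zero_mul]; exact ENNReal.toReal_nonneg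
    have hf := hbin z hz
    have h0 : (G.genCommon (common.restrict fun s => G.g s (z s)) {common.restrict z}).toReal
        = (G.src.base.real (G.msgBin common (G.label common (common.restrict z))))⁻¹ *
          G.src.base.real {common.restrict z} := by
      rw [genCommon, cond_apply (Set.toFinite _).measurableSet, ENNReal.toReal_mul,
        ENNReal.toReal_inv, Set.inter_eq_right.2]
      · rfl
      · rintro _ rfl s
        exact ⟨hf s, rfl⟩
    have hi : ∀ i, (G.genPriv i (common.restrict z) ((priv i).restrict fun s => G.g s (z s))
        {(priv i).restrict z}).toReal
        = ((G.src.side i (common.restrict z)).real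
            (G.msgBin (priv i) (G.label (priv i) ((priv i).restrict z))))⁻¹ *
          (G.src.side i (common.restrict z)).real {(priv i).restrict z} := by
      intro i
      rw [genPriv, cond_apply (Set.toFinite _).measurableSet, ENNReal.toReal_mul,
        ENNReal.toReal_inv, Set.inter_eq_right.2]
      · rfl
      · rintro _ rfl s
        exact ⟨hf s, rfl⟩
    have hNprod : (∏ s, (N s : ℝ≥0∞)).toReal = (∏ s ∈ common, (N s : ℝ)) *
        ((∏ s ∈ priv 0, (N s : ℝ)) * ∏ s ∈ priv 1, (N s : ℝ)) := by
      rw [ENNReal.toReal_prod]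
      simp only [ENNReal.toReal_natCast]
      rw [prod_split, Fin.prod_univ_two]
    have hF : (F (fun s => G.g s (z s)) z / ∏ s, (N s : ℝ≥0∞)).toReal
        = G.src.prob z * (κ z *
          (((∏ s ∈ common, (N s : ℝ)) *
            G.src.base.real (G.msgBin common (G.label common (common.restrict z))))⁻¹ *
          (((∏ s ∈ priv 0, (N s : ℝ)) * (G.src.side 0 (common.restrict z)).real
            (G.msgBin (priv 0) (G.label (priv 0) ((priv 0).restrict z))))⁻¹ *
           ((∏ s ∈ priv 1, (N s : ℝ)) * (G.src.side 1 (common.restrict z)).real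
            (G.msgBin (priv 1) (G.label (priv 1) ((priv 1).restrict z))))⁻¹))) := by
      simp only [F, ENNReal.toReal_div, ENNReal.toReal_mul, h0, ENNReal.toReal_prod, hi,
        Fin.prod_univ_two, G.src.prob_eq z, κ]
      rw [← ENNReal.toReal_prod, hNprod]
      simp only [mul_inv, div_eq_mul_inv]
      ring
    rw [hF]
    refine mul_le_mul_of_nonneg_left (mul_le_mul_of_nonneg_left ?_ (hκ0 z)) (G.src.prob_nonneg z)
    have r0 := G.ratio_nonneg (priv 0) (G.src.side 0 (common.restrict z))
      (G.label (priv 0) ((priv 0).restrict z))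
    have r1 := G.ratio_nonneg (priv 1) (G.src.side 1 (common.restrict z))
      (G.label (priv 1) ((priv 1).restrict z))
    refine mul_le_mul (min_le_right _ _) (mul_le_mul (min_le_right _ _) (min_le_right _ _) r1 ?_)
      (mul_nonneg r0 r1) ?_
    · exact inv_nonneg.2 (mul_nonneg (hNpos _).le measureReal_nonneg)
    · exact inv_nonneg.2 (mul_nonneg (hNpos _).le measureReal_nonneg)
  -- For each `z` only the message family with `m s = g s (z s)` is kept.
  have hlower : ENNReal.ofReal (∑ z, G.src.prob z * (κ z * (u₀ z * (u 0 z * u 1 z)))) ≤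
      (∑ m, ∑ z, F m z) / ∏ s, (N s : ℝ≥0∞) := by
    have hnn : ∀ z ∈ Finset.univ, 0 ≤ G.src.prob z * (κ z * (u₀ z * (u 0 z * u 1 z))) := by
      intro z _
      exact mul_nonneg (G.src.prob_nonneg z) (mul_nonneg (hκ0 z) (mul_nonneg (G.ratio_nonneg _ _ _)
        (mul_nonneg (G.ratio_nonneg _ _ _) (G.ratio_nonneg _ _ _))))
    rw [ENNReal.ofReal_sum_of_nonneg hnn, Finset.sum_comm, div_eq_mul_inv, Finset.sum_mul]
    refine Finset.sum_le_sum fun z _ => ?_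
    rw [← div_eq_mul_inv]
    refine ((ENNReal.ofReal_le_ofReal (hterm z)).trans (ENNReal.ofReal_toReal (hFtop _ z)).le).trans
      (ENNReal.div_le_div_right ?_ _)
    exact Finset.single_le_sum (f := fun m => F m z) (fun _ _ => zero_le)
      (Finset.mem_univ (fun s => G.g s (z s)))
  rw [errorProb_eq]
  refine (tsub_le_tsub_left hlower 1).trans ?_
  rw [← ENNReal.ofReal_one, ← ENNReal.ofReal_sub _ (Finset.sum_nonneg fun z _ => mul_nonneg
    (G.src.prob_nonneg z) (mul_nonneg (hκ0 z) (mul_nonneg (G.ratio_nonneg _ _ _)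
        (mul_nonneg (G.ratio_nonneg _ _ _) (G.ratio_nonneg _ _ _)))))]
  refine ENNReal.ofReal_le_ofReal ?_
  -- the three kinds of errors
  have hdec : ∀ j, 1 - ∑ z, G.src.prob z * (G.hit V j z).toReal ≤ 2 * (1 - ∑ z, G.src.prob z *
        (G.src.out V z).real {y | y j ∈ E j ((decoded j).restrict z)}) := by
    intro j
    have := G.two_mul_le_sum_hit V j (hE j) (hdisj j)
    linarith
  have hcommon : ∑ z, G.src.prob z * (1 - u₀ z) ≤
      ∑ m, max (G.src.base.real (G.msgBin common m) - 1 / ∏ s ∈ common, (N s : ℝ)) 0 := by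
    let b : Tuple Z common → ℝ := fun z₀ => if z₀ ∈ G.msgBin common (G.label common z₀) then
          1 - G.ratio common G.src.base (G.label common z₀) else 0
    have e1 : ∑ z, G.src.prob z * (1 - u₀ z) = ∑ z, G.src.prob z *
        b (common.restrict z) := by
      refine Finset.sum_congr rfl fun z _ => ?_
      by_cases hz : G.src.prob z = 0
      · rw [hz, zero_mul, zero_mul]
      · have : common.restrict z ∈ G.msgBin common (G.label common (common.restrict z)) :=
          fun s => ⟨hbin z hz s, rfl⟩
        simp only [b, this, if_true, u₀]
    rw [e1, G.src.sum_prob_base b]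
    exact G.sum_one_sub_ratio_le hN common G.src.base fun z => le_of_eq (by congr)
  have hpriv : ∀ i, ∑ z, G.src.prob z * (1 - u i z) ≤ ∑ z₀, G.src.base.real {z₀} *
        ∑ m, max ((G.src.side i z₀).real (G.msgBin (priv i) m) -
          1 / ∏ s ∈ priv i, (N s : ℝ)) 0 := by
    intro i
    let b : Tuple Z common → Tuple Z (priv i) → ℝ := fun z₀ zi =>
      if zi ∈ G.msgBin (priv i) (G.label (priv i) zi) then
        1 - G.ratio (priv i) (G.src.side i z₀) (G.label (priv i) zi) else 0
    have e1 : ∑ z, G.src.prob z * (1 - u i z) = ∑ z, G.src.prob z *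
        b (common.restrict z) ((priv i).restrict z) := by
      refine Finset.sum_congr rfl fun z _ => ?_
      by_cases hz : G.src.prob z = 0
      · rw [hz, zero_mul, zero_mul]
      · have : (priv i).restrict z ∈ G.msgBin (priv i) (G.label (priv i) ((priv i).restrict z)) :=
          fun s => ⟨hbin z hz s, rfl⟩
        simp only [b, this, if_true, u]
    rw [e1, G.src.sum_prob_side i b]
    refine Finset.sum_le_sum fun z₀ _ => mul_le_mul_of_nonneg_left ?_ measureReal_nonneg
    exact G.sum_one_sub_ratio_le hN (priv i) (G.src.side i z₀) fun z => le_of_eq (by congr)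
  -- On the unit interval `x - (1 - y) ≤ x * y`; used three times, it makes the product of `κ` and
  -- the ratios at least `κ` minus the three shortfalls.
  have hpoint : ∀ z, G.src.prob z * ((G.hit V 0 z).toReal + (G.hit V 1 z).toReal - 1
      - (1 - u₀ z) - (1 - u 0 z) - (1 - u 1 z)) ≤
        G.src.prob z * (κ z * (u₀ z * (u 0 z * u 1 z))) := by
    intro z
    by_cases hz : G.src.prob z = 0
    · rw [hz, zero_mul, zero_mul]
    refine mul_le_mul_of_nonneg_left ?_ (G.src.prob_nonneg z)
    have hs := G.sum_hit_le V z (hbin z hz)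
    have hs' : (G.hit V 0 z).toReal + (G.hit V 1 z).toReal ≤ κ z + 1 := by
      have t0 := ne_top_of_le_ne_top ENNReal.one_ne_top (G.hit_le_one V 0 z)
      have t1 := ne_top_of_le_ne_top ENNReal.one_ne_top (G.hit_le_one V 1 z)
      have t2 := ne_top_of_le_ne_top ENNReal.one_ne_top
        (G.success_le_one V (fun s => G.g s (z s)) z)
      have := ENNReal.toReal_mono (ENNReal.add_ne_top.2 ⟨t2, ENNReal.one_ne_top⟩) hs
      rwa [ENNReal.toReal_add t0 t1, ENNReal.toReal_add t2 ENNReal.one_ne_top,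
        ENNReal.toReal_one] at this
    have a0 : 0 ≤ u₀ z := G.ratio_nonneg _ _ _
    have a1 : u₀ z ≤ 1 := G.ratio_le_one _ _ _
    have b0 : ∀ i, 0 ≤ u i z := fun i => G.ratio_nonneg _ _ _
    have b1 : ∀ i, u i z ≤ 1 := fun i => G.ratio_le_one _ _ _
    have key : ∀ x y : ℝ, 0 ≤ x → x ≤ 1 → 0 ≤ y → y ≤ 1 → x - (1 - y) ≤ x * y := by
      intro x y _ hx1 _ hy1
      nlinarith [mul_nonneg (sub_nonneg.2 hx1) (sub_nonneg.2 hy1)]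
    have k1 := key (u 0 z) (u 1 z) (b0 0) (b1 0) (b0 1) (b1 1)
    have p1 : 0 ≤ u 0 z * u 1 z := mul_nonneg (b0 0) (b0 1)
    have p1' : u 0 z * u 1 z ≤ 1 := mul_le_one₀ (b1 0) (b0 1) (b1 1)
    have k2 := key (u₀ z) (u 0 z * u 1 z) a0 a1 p1 p1'
    have k3 := key (κ z) (u₀ z * (u 0 z * u 1 z)) (hκ0 z) (hκ1 z) (mul_nonneg a0 p1)
      (mul_le_one₀ a1 p1 p1')
    linarith
  have hsum := Finset.sum_le_sum fun z (_ : z ∈ Finset.univ) => hpoint z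
  have hprob := G.src.sum_prob
  have hexp : ∑ z, G.src.prob z * ((G.hit V 0 z).toReal + (G.hit V 1 z).toReal - 1
      - (1 - u₀ z) - (1 - u 0 z) - (1 - u 1 z)) =
      ∑ z, G.src.prob z * (G.hit V 0 z).toReal + ∑ z, G.src.prob z * (G.hit V 1 z).toReal - ∑ z, G.src.prob z
      - ∑ z, G.src.prob z * (1 - u₀ z) - ∑ z, G.src.prob z * (1 - u 0 z)
      - ∑ z, G.src.prob z * (1 - u 1 z) := by
    simp only [← Finset.sum_add_distrib, ← Finset.sum_sub_distrib]
    refine Finset.sum_congr rfl fun z _ => ?_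
    ring
  rw [hexp] at hsum
  have d0 := hdec 0
  have d1 := hdec 1
  have q0 := hpriv 0
  have q1 := hpriv 1
  rw [Fin.sum_univ_two, Fin.sum_univ_two]
  linarith

end CRNG

/-! ### Conditioning a source on the values of functions of its components -/

lemma sum_real_singleton_mul_ite {α : Type*} [Fintype α] [MeasurableSpace α]
    [MeasurableSingletonClass α] (μ : Measure α) [IsFiniteMeasure μ] (p : α → Prop)
    [DecidablePred p] :
    ∑ a, μ.real {a} * (if p a then 1 else 0) = μ.real {a | p a} := by
  simp only [mul_ite, mul_one, mul_zero]
  rw [← Finset.sum_filter, sum_measureReal_singleton]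
  congr 1
  ext a; simp

section CondSource

variable {Z : Msg → Type} [∀ s, Fintype (Z s)] [∀ s, MeasurableSpace (Z s)]
  [∀ s, MeasurableSingletonClass (Z s)]
  {X Y : Fin 2 → Type*} [∀ i, MeasurableSpace (X i)] [∀ j, MeasurableSpace (Y j)]
  {L N : Msg → ℕ}

/-- `{z_T : f_s(z_s) = c_s for all s ∈ T}`. -/
def fiber (f : ∀ s, Z s → Fin (L s)) (c : ∀ s, Fin (L s)) (T : Finset Msg) : Set (Tuple Z T) :=
  {z | ∀ s : T, f s (z s) = c s}

/-- The probability of `f(Z) = c` and `Z_{S₀} = z₀`. -/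
def Source.fiberWeight (P : Source Z X) (f : ∀ s, Z s → Fin (L s)) (c : ∀ s, Fin (L s))
    (z₀ : Tuple Z common) : ℝ := open Classical in
  P.base.real {z₀} * (if z₀ ∈ fiber f c common then 1 else 0) *
    ∏ i, (P.side i z₀).real (fiber f c (priv i))

/-- The probability of `f(Z) = c`. -/
def Source.fiberProb (P : Source Z X) (f : ∀ s, Z s → Fin (L s)) (c : ∀ s, Fin (L s)) : ℝ :=
  ∑ z₀, P.fiberWeight f c z₀

lemma Source.fiberWeight_nonneg (P : Source Z X) (f : ∀ s, Z s → Fin (L s))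
    (c : ∀ s, Fin (L s)) (z₀ : Tuple Z common) : 0 ≤ P.fiberWeight f c z₀ := by
  unfold Source.fiberWeight
  refine mul_nonneg (mul_nonneg measureReal_nonneg ?_)
    (Finset.prod_nonneg fun i _ => measureReal_nonneg)
  split_ifs <;> norm_num

lemma Source.fiberProb_nonneg (P : Source Z X) (f : ∀ s, Z s → Fin (L s))
    (c : ∀ s, Fin (L s)) : 0 ≤ P.fiberProb f c :=
  Finset.sum_nonneg fun z₀ _ => P.fiberWeight_nonneg f c z₀

/-- The source conditioned on `f(Z) = c`. -/
def Source.condOn (P : Source Z X) (f : ∀ s, Z s → Fin (L s)) (c : ∀ s, Fin (L s))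
    (h : 0 < P.fiberProb f c) : Source Z X where
  -- The weight of `z₀` includes the probabilities of both private fibers, as Bayes' rule demands;
  -- it is not just the base law conditioned on its own fiber.
  base := ∑ z₀, ENNReal.ofReal (P.fiberWeight f c z₀ / P.fiberProb f c) • Measure.dirac z₀
  side i :=
    -- A null private fiber makes the new base weight of `z₀` zero, so any probability law may serve
    -- there.
    { toFun := fun z₀ => open Classical in if P.side i z₀ (fiber f c (priv i)) = 0 then P.side i z₀
        else cond (P.side i z₀) (fiber f c (priv i))
      measurable' := measurable_of_finite _ }
  input := P.input
  base_prob := by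
    refine ⟨?_⟩
    simp only [Measure.coe_finsetSum, Finset.sum_apply, Measure.smul_apply, measure_univ,
      smul_eq_mul, mul_one]
    rw [← ENNReal.ofReal_sum_of_nonneg fun z₀ _ => div_nonneg (P.fiberWeight_nonneg f c z₀) h.le,
      ← Finset.sum_div, ENNReal.ofReal_eq_one]
    exact div_self h.ne'
  side_markov i := by
    refine ⟨fun z₀ => ?_⟩
    change IsProbabilityMeasure (if _ then _ else _)
    split_ifs with h0
    · infer_instance
    · exact cond_isProbabilityMeasure h0
  input_markov := P.input_markov

lemma Source.condOn_base (P : Source Z X) (f : ∀ s, Z s → Fin (L s)) (c : ∀ s, Fin (L s))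
    (h : 0 < P.fiberProb f c) (z₀ : Tuple Z common) :
    (P.condOn f c h).base.real {z₀} = P.fiberWeight f c z₀ / P.fiberProb f c := by
  rw [measureReal_def, Source.condOn]
  simp only [Measure.coe_finsetSum, Finset.sum_apply, Measure.smul_apply, smul_eq_mul]
  rw [Finset.sum_eq_single z₀]
  · simp [div_nonneg (P.fiberWeight_nonneg f c z₀) h.le]
  · intro z _ hz
    simp [hz]
  · simp

lemma Source.condOn_side (P : Source Z X) (f : ∀ s, Z s → Fin (L s)) (c : ∀ s, Fin (L s))
    (h : 0 < P.fiberProb f c) (i : Fin 2) (z₀ : Tuple Z common)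
    (h0 : (P.side i z₀).real (fiber f c (priv i)) ≠ 0) (S : Set (Tuple Z (priv i))) :
    ((P.condOn f c h).side i z₀).real S =
      (P.side i z₀).real (fiber f c (priv i) ∩ S) / (P.side i z₀).real (fiber f c (priv i)) := by
  have h1 : P.side i z₀ (fiber f c (priv i)) ≠ 0 := fun h' => h0 (by simp [measureReal_def, h'])
  have h2 : (P.condOn f c h).side i z₀ = cond (P.side i z₀) (fiber f c (priv i)) := by
    change (if _ then _ else _) = _
    rw [if_neg h1]
  rw [h2, measureReal_def, cond_apply (Set.toFinite _).measurableSet, ENNReal.toReal_mul,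
    ENNReal.toReal_inv, measureReal_def, measureReal_def]
  field_simp

/-- The event `f(Z) = c` is a product over the components, so conditioning on it keeps the private
parts conditionally independent: the fiber probabilities put into the base cancel the denominators
of the sides. -/
lemma Source.condOn_prob (P : Source Z X) (f : ∀ s, Z s → Fin (L s)) (c : ∀ s, Fin (L s))
    (h : 0 < P.fiberProb f c) (z : ∀ s, Z s) :
    P.fiberProb f c * (P.condOn f c h).prob z =
      P.prob z * (if ∀ s, f s (z s) = c s then 1 else 0) := by
  classical
  rw [Source.prob_eq, P.condOn_base, P.prob_eq z]
  have hiff : (∀ s, f s (z s) = c s) ↔ common.restrict z ∈ fiber f c common ∧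
      ∀ i, (priv i).restrict z ∈ fiber f c (priv i) := by
    constructor
    · exact fun hz => ⟨fun s => hz s, fun i s => hz s⟩
    · rintro ⟨h1, h2⟩ s
      rcases mem_parts s with hs | ⟨i, hs⟩
      · exact h1 ⟨s, hs⟩
      · exact h2 i ⟨s, hs⟩
  rw [← mul_assoc, mul_div_cancel₀ _ h.ne', Source.fiberWeight]
  by_cases h0 : common.restrict z ∈ fiber f c common
  swap
  · rw [if_neg h0, if_neg (fun h' => h0 (hiff.1 h').1)]
    ring
  by_cases hi : ∀ i, (P.side i (common.restrict z)).real (fiber f c (priv i)) ≠ 0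
  · rw [if_pos h0, mul_one, mul_assoc, ← Finset.prod_mul_distrib]
    have e : ∀ i, (P.side i (common.restrict z)).real (fiber f c (priv i)) *
        ((P.condOn f c h).side i (common.restrict z)).real {(priv i).restrict z}
        = (P.side i (common.restrict z)).real {(priv i).restrict z} *
          (if (priv i).restrict z ∈ fiber f c (priv i) then 1 else 0) := by
      intro i
      rw [P.condOn_side f c h i _ (hi i), mul_div_cancel₀ _ (hi i)]
      split_ifs with hm
      · rw [Set.inter_eq_right.2 (Set.singleton_subset_iff.2 hm), mul_one]
      · rw [Set.inter_singleton_eq_empty.2 hm]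
        simp
    simp only [e, Finset.prod_mul_distrib, Finset.prod_ite_zero, Finset.prod_const_one]
    simp only [hiff, h0, true_and, Finset.mem_univ, true_imp_iff]
    ring
  · push Not at hi
    obtain ⟨i, hi⟩ := hi
    have e1 : ∏ i, (P.side i (common.restrict z)).real (fiber f c (priv i)) = 0 :=
      Finset.prod_eq_zero (Finset.mem_univ i) hi
    rw [e1, mul_zero, zero_mul]
    -- With a null private fiber, either `z` lies in it and has mass zero, or its hash is not `c`.
    by_cases hm : (priv i).restrict z ∈ fiber f c (priv i)
    · have e2 : (P.side i (common.restrict z)).real {(priv i).restrict z} = 0 :=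
        le_antisymm (hi ▸ measureReal_mono (Set.singleton_subset_iff.2 hm)) measureReal_nonneg
      have e3 : ∏ i, (P.side i (common.restrict z)).real {(priv i).restrict z} = 0 :=
        Finset.prod_eq_zero (Finset.mem_univ i) e2
      rw [e3]; ring
    · rw [if_neg (fun h' => hm ((hiff.1 h').2 i)), mul_zero]

lemma Source.sum_prob_fiber (P : Source Z X) (f : ∀ s, Z s → Fin (L s)) (c : ∀ s, Fin (L s)) :
    P.fiberProb f c = ∑ z, P.prob z * (if ∀ s, f s (z s) = c s then 1 else 0) := by
  classical
  have h := P.sum_prob_split (fun z₀ => if z₀ ∈ fiber f c common then 1 else 0)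
    (fun i _ z => if z ∈ fiber f c (priv i) then 1 else 0)
  have e : ∀ i z₀, ∑ z, (P.side i z₀).real {z} * (if z ∈ fiber f c (priv i) then 1 else 0)
      = (P.side i z₀).real (fiber f c (priv i)) := fun i z₀ =>
    sum_real_singleton_mul_ite _ (fun z => z ∈ fiber f c (priv i))
  simp only [e] at h
  have e2 : P.fiberProb f c = ∑ z₀, P.base.real {z₀} *
      (if z₀ ∈ fiber f c common then 1 else 0) *
        ∏ i, (P.side i z₀).real (fiber f c (priv i)) := by
    refine Finset.sum_congr rfl fun z₀ _ => ?_
    rw [Source.fiberWeight]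
  rw [e2, ← h]
  refine Finset.sum_congr rfl fun z _ => ?_
  congr 1
  by_cases hz : ∀ s, f s (z s) = c s
  · rw [if_pos hz, if_pos (show common.restrict z ∈ fiber f c common from fun s => hz s),
      Finset.prod_eq_one, mul_one]
    intro i _
    rw [if_pos (show (priv i).restrict z ∈ fiber f c (priv i) from fun s => hz s)]
  · rw [if_neg hz]
    by_cases h0 : common.restrict z ∈ fiber f c common
    · have hex : ∃ i, (priv i).restrict z ∉ fiber f c (priv i) := by
        by_contra hcon
        push Not at hcon
        refine hz fun s => ?_
        rcases mem_parts s with hs | ⟨i, hs⟩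
        · exact h0 ⟨s, hs⟩
        · exact hcon i ⟨s, hs⟩
      obtain ⟨i, hi⟩ := hex
      rw [Finset.prod_eq_zero (Finset.mem_univ i) (if_neg hi), mul_zero]
    · rw [if_neg h0, zero_mul]

lemma sum_ite_forall_eq (u : ∀ s, Fin (L s)) :
    ∑ c : (∀ s, Fin (L s)), (if ∀ s, u s = c s then (1 : ℝ) else 0) = 1 := by
  have : ∀ c : (∀ s, Fin (L s)), (∀ s, u s = c s) ↔ u = c := fun c => funext_iff.symm
  simp_rw [this]
  rw [Finset.sum_ite_eq, if_pos (Finset.mem_univ _)]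

lemma Source.sum_fiberProb (P : Source Z X) (f : ∀ s, Z s → Fin (L s)) :
    ∑ c, P.fiberProb f c = 1 := by
  simp only [P.sum_prob_fiber]
  rw [Finset.sum_comm]
  simp only [← Finset.mul_sum, sum_ite_forall_eq, mul_one]
  exact P.sum_prob

/-! ### The code with given hash functions -/

/-- The law of `Z`, restricted to `Z_{S₀} = z₀`. -/
def Source.slice (P : Source Z X) (z₀ : Tuple Z common) (z : ∀ s, Z s) : ℝ := open Classical in
  P.prob z * (if common.restrict z = z₀ then 1 else 0)

/-- Once the common part is fixed and the other encoder is summed out, only `side i z₀` is left;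
this turns its conditional uniformity into a hashing problem for an unnormalized law. -/
lemma Source.hashDev_slice (P : Source Z X) (i : Fin 2) (z₀ : Tuple Z common)
    (f : ∀ s, Z s → Fin (L s)) (g : ∀ s, Z s → Fin (N s)) (c : ∀ s, Fin (L s))
    (m : Tuple (fun s => Fin (N s)) (priv i)) :
    hashDev L N (priv i) (priv i) (P.slice z₀) f g ((priv i).restrict c) m
      = P.base.real {z₀} * ((P.side i z₀).real
          (fiber f c (priv i) ∩ {z | ∀ s : priv i, g s (z s) = m s}) -
          (P.side i z₀).real (fiber f c (priv i)) / ∏ s ∈ priv i, (N s : ℝ)) := by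
  classical
  set n := ∏ s ∈ priv i, (N s : ℝ)
  let b : Tuple Z common → Tuple Z (priv i) → ℝ := fun z₀' z =>
    (if z₀' = z₀ then 1 else 0) * ((if z ∈ fiber f c (priv i) ∩
      {z | ∀ s : priv i, g s (z s) = m s} then 1 else 0) -
      (if z ∈ fiber f c (priv i) then 1 else 0) / n)
  have h := P.sum_prob_side i b
  have e1 : hashDev L N (priv i) (priv i) (P.slice z₀) f g ((priv i).restrict c) m
      = ∑ z, P.prob z * b (common.restrict z) ((priv i).restrict z) := by
    rw [hashDev]
    refine Finset.sum_congr rfl fun z _ => ?_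
    rw [Source.slice, mul_assoc]
    congr 1
    simp only [b]
    congr 1
    by_cases h1 : ∀ s : priv i, f s (z s) = c s
    · have h1' : (priv i).restrict z ∈ fiber f c (priv i) := h1
      have h1'' : ∀ s : priv i, f s (z s) = (priv i).restrict c s := h1
      rw [if_pos h1'', if_pos h1', one_mul]
      congr 1
      refine if_congr ?_ rfl rfl
      exact ⟨fun h2 => ⟨h1', h2⟩, fun h2 => h2.2⟩
    · have h1' : (priv i).restrict z ∉ fiber f c (priv i) := h1
      have h1'' : ¬ ∀ s : priv i, f s (z s) = (priv i).restrict c s := h1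
      have h3 : (priv i).restrict z ∉ fiber f c (priv i) ∩
          {z | ∀ s : priv i, g s (z s) = m s} := fun h2 => h1' h2.1
      rw [if_neg h1'', zero_mul, if_neg h3, if_neg h1']
      simp
  rw [e1, h, Finset.sum_eq_single z₀]
  · congr 1
    simp only [b, if_true, one_mul, mul_sub, Finset.sum_sub_distrib, ← mul_div_assoc,
      ← Finset.sum_div]
    rw [sum_real_singleton_mul_ite, sum_real_singleton_mul_ite]
    rfl
  · intro z _ hz
    simp [b, hz]
  · simp

variable [∀ s, Nonempty (Z s)] [∀ s, StandardBorelSpace (Z s)]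

/-- The outputs for which `z` is the only candidate among the sequences with the same hash. -/
def uniqueRegion {j : Fin 2} (B : Tuple Z (decoded j) → Set (Y j)) (f : ∀ s, Z s → Fin (L s))
    (z : Tuple Z (decoded j)) : Set (Y j) :=
  {y | y ∈ B z ∧ ∀ z', z' ≠ z → (∀ s : decoded j, f s (z s) = f s (z' s)) → y ∉ B z'}

lemma measurableSet_uniqueRegion {j : Fin 2} {B : Tuple Z (decoded j) → Set (Y j)}
    (hB : ∀ z, MeasurableSet (B z)) (f : ∀ s, Z s → Fin (L s)) (z : Tuple Z (decoded j)) :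
    MeasurableSet (uniqueRegion B f z) := by
  have : uniqueRegion B f z = B z ∩ ⋂ z', ⋂ (_ : z' ≠ z),
      ⋂ (_ : ∀ s : decoded j, f s (z s) = f s (z' s)), (B z')ᶜ := by
    ext y; simp [uniqueRegion]
  rw [this]
  exact (hB z).inter (MeasurableSet.iInter fun z' => MeasurableSet.iInter fun _ =>
    MeasurableSet.iInter fun _ => (hB z').compl)

/-- The probability that `f(Z) = c` and some decoder is wrong. -/
def Source.decDev (P : Source Z X) (V : Kernel (∀ i, X i) (∀ j, Y j))
    (B : ∀ j, Tuple Z (decoded j) → Set (Y j)) (f : ∀ s, Z s → Fin (L s)) (c : ∀ s, Fin (L s)) :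
    ℝ :=
  ∑ j, 2 * ∑ z, P.prob z * (if ∀ s, f s (z s) = c s then 1 else 0) *
    (P.out V z).real {y | y j ∉ uniqueRegion (B j) f ((decoded j).restrict z)}

/-- The deviation from the uniform law of the common messages, on the event `f(Z) = c`. -/
def Source.commonDev (P : Source Z X) (f : ∀ s, Z s → Fin (L s)) (g : ∀ s, Z s → Fin (N s))
    (c : ∀ s, Fin (L s)) : ℝ := open Classical in
  ∑ m, max (hashDev L N Finset.univ common P.prob f g (Finset.univ.restrict c) m) 0

/-- Given `Z_{S₀} = z₀`, the deviation from the uniform law of the messages of encoder `i'` on the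
event `f(Z_{S_i'}) = c` if `i' = i`, the probability of this event otherwise. -/
def Source.devFactor (P : Source Z X) (f : ∀ s, Z s → Fin (L s)) (g : ∀ s, Z s → Fin (N s))
    (i : Fin 2) (z₀ : Tuple Z common) (i' : Fin 2) (c : Tuple (fun s => Fin (L s)) (priv i')) : ℝ :=
  if i' = i then ∑ m, max (hashDev L N (priv i') (priv i') (P.slice z₀) f g c m) 0
  else (P.side i' z₀).real {z | ∀ s : priv i', f s (z s) = c s}

lemma Source.devFactor_self (P : Source Z X) (f : ∀ s, Z s → Fin (L s))
    (g : ∀ s, Z s → Fin (N s)) (i : Fin 2) (z₀ : Tuple Z common)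
    (c : Tuple (fun s => Fin (L s)) (priv i)) : P.devFactor f g i z₀ i c =
      ∑ m, max (hashDev L N (priv i) (priv i) (P.slice z₀) f g c m) 0 := if_pos rfl

lemma Source.devFactor_ne (P : Source Z X) (f : ∀ s, Z s → Fin (L s))
    (g : ∀ s, Z s → Fin (N s)) {i i' : Fin 2} (h : i' ≠ i) (z₀ : Tuple Z common)
    (c : Tuple (fun s => Fin (L s)) (priv i')) : P.devFactor f g i z₀ i' c =
      (P.side i' z₀).real {z | ∀ s : priv i', f s (z s) = c s} := if_neg h

lemma Source.devFactor_nonneg (P : Source Z X) (f : ∀ s, Z s → Fin (L s))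
    (g : ∀ s, Z s → Fin (N s)) (i : Fin 2) (z₀ : Tuple Z common) (i' : Fin 2)
    (c : Tuple (fun s => Fin (L s)) (priv i')) : 0 ≤ P.devFactor f g i z₀ i' c := by
  unfold Source.devFactor
  split_ifs
  · exact Finset.sum_nonneg fun m _ => le_max_right _ _
  · exact measureReal_nonneg

lemma Source.sum_devFactor_ne (P : Source Z X) (f : ∀ s, Z s → Fin (L s))
    (g : ∀ s, Z s → Fin (N s)) {i i' : Fin 2} (h : i' ≠ i) (z₀ : Tuple Z common) :
    ∑ c, P.devFactor f g i z₀ i' c = 1 := by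
  classical
  have : ∀ c : Tuple (fun s => Fin (L s)) (priv i'), P.devFactor f g i z₀ i' c =
      ∑ z, (P.side i' z₀).real {z} * (if (fun s : priv i' => f s (z s)) = c then 1 else 0) := by
    intro c
    rw [P.devFactor_ne f g h, sum_real_singleton_mul_ite]
    congr 1
    ext z
    exact funext_iff.symm
  simp only [this]
  rw [Finset.sum_comm]
  simp only [← Finset.mul_sum, Finset.sum_ite_eq, Finset.mem_univ, if_true, mul_one]
  exact sum_real_singleton _

/-- The deviation from the uniform law of the messages of encoder `i`, on the event `f(Z) = c`. -/
def Source.privDev (P : Source Z X) (f : ∀ s, Z s → Fin (L s)) (g : ∀ s, Z s → Fin (N s))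
    (i : Fin 2) (c : ∀ s, Fin (L s)) : ℝ :=
  ∑ z₀, (if ∀ s : common, f s (z₀ s) = c s then 1 else 0) *
    ∏ i', P.devFactor f g i z₀ i' ((priv i').restrict c)

lemma Source.privDev_term_nonneg (P : Source Z X) (f : ∀ s, Z s → Fin (L s))
    (g : ∀ s, Z s → Fin (N s)) (i : Fin 2) (c : ∀ s, Fin (L s)) (z₀ : Tuple Z common) :
    0 ≤ (if ∀ s : common, f s (z₀ s) = c s then 1 else 0) *
      ∏ i', P.devFactor f g i z₀ i' ((priv i').restrict c) :=
  mul_nonneg (by split_ifs <;> norm_num) (Finset.prod_nonneg fun i' _ => P.devFactor_nonneg ..)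

lemma Source.sum_decDev (P : Source Z X) (V : Kernel (∀ i, X i) (∀ j, Y j)) [IsMarkovKernel V]
    (B : ∀ j, Tuple Z (decoded j) → Set (Y j)) (f : ∀ s, Z s → Fin (L s)) :
    ∑ c, P.decDev V B f c = ∑ j, 2 * ∑ z, P.prob z *
        (P.out V z).real {y | y j ∉ uniqueRegion (B j) f ((decoded j).restrict z)} := by
  classical
  simp only [Source.decDev]
  rw [Finset.sum_comm]
  refine Finset.sum_congr rfl fun j _ => ?_
  rw [← Finset.mul_sum, Finset.sum_comm]
  congr 1
  refine Finset.sum_congr rfl fun z _ => ?_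
  rw [← Finset.sum_mul, ← Finset.mul_sum, sum_ite_forall_eq, mul_one]

lemma Source.sum_commonDev (P : Source Z X) (f : ∀ s, Z s → Fin (L s)) (g : ∀ s, Z s → Fin (N s)) :
    ∑ c, P.commonDev f g c =
      ∑ c, ∑ m, max (hashDev L N Finset.univ common P.prob f g c m) 0 := by
  classical
  let e : (∀ s, Fin (L s)) ≃ (∀ s : (Finset.univ : Finset Msg), Fin (L s)) :=
    { toFun := fun c => Finset.univ.restrict c
      invFun := fun c s => c ⟨s, Finset.mem_univ s⟩
      left_inv := fun c => rfl
      right_inv := fun c => rfl }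
  exact e.sum_comp (fun c => ∑ m, max (hashDev L N Finset.univ common P.prob f g c m) 0)

/-- A hash value splits into its common and private parts. The common indicator and the factor of
the other encoder both sum to one, which leaves the encoder's own deviation. -/
lemma Source.sum_privDev (P : Source Z X) (f : ∀ s, Z s → Fin (L s)) (g : ∀ s, Z s → Fin (N s))
    (i : Fin 2) : ∑ c, P.privDev f g i c =
      ∑ z₀, ∑ c, ∑ m, max (hashDev L N (priv i) (priv i) (P.slice z₀) f g c m) 0 := by
  simp only [Source.privDev]
  rw [Finset.sum_comm]
  refine Finset.sum_congr rfl fun z₀ _ => ?_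
  have h := sum_split_prod (Z := fun s => Fin (L s)) (M := ℝ)
    (fun c₀ => if ∀ s : common, f s (z₀ s) = c₀ s then 1 else 0)
    (fun i' _ c => P.devFactor f g i z₀ i' c)
  have e0 : ∑ c₀ : Tuple (fun s => Fin (L s)) common,
      (if ∀ s : common, f s (z₀ s) = c₀ s then (1 : ℝ) else 0) = 1 := by
    have : ∀ c₀ : Tuple (fun s => Fin (L s)) common, (∀ s : common, f s (z₀ s) = c₀ s) ↔
      (fun s : common => f s (z₀ s)) = c₀ := fun c₀ => funext_iff.symm
    simp_rw [this]
    rw [Finset.sum_ite_eq, if_pos (Finset.mem_univ _)]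
  have e1 : ∏ i', ∑ c, P.devFactor f g i z₀ i' c =
      ∑ c, ∑ m, max (hashDev L N (priv i) (priv i) (P.slice z₀) f g c m) 0 := by
    rw [Finset.prod_eq_single i (fun i' _ hi => P.sum_devFactor_ne f g hi z₀)
      (fun hi => absurd (Finset.mem_univ i) hi)]
    simp only [P.devFactor_self]
  rw [e1, ← Finset.sum_mul, e0, one_mul] at h
  exact h

/-- The code has as its source `P` conditioned on `f(Z) = c`, so its support lies in the bin and
`CRNG.errorProb_le` applies. Multiplying by `fiberProb` turns every error term into a deviation
under `P`. -/
lemma Source.exists_errorProb_le (P : Source Z X) (V : Kernel (∀ i, X i) (∀ j, Y j)) [IsMarkovKernel V]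
    (hN : ∀ s, 0 < N s) {B : ∀ j, Tuple Z (decoded j) → Set (Y j)}
    (hB : ∀ j z, MeasurableSet (B j z)) (f : ∀ s, Z s → Fin (L s)) (g : ∀ s, Z s → Fin (N s))
    (c : ∀ s, Fin (L s)) (h : 0 < P.fiberProb f c) :
    ∃ G : CRNG Z X N,
      G.errorProb V ≤ ENNReal.ofReal ((P.decDev V B f c + P.commonDev f g c + ∑ i, P.privDev f g i c) / P.fiberProb f c) := by
  classical
  set p := P.fiberProb f c with hp
  let G : CRNG Z X N := ⟨P.condOn f c h, L, f, g, c⟩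
  have hprob : ∀ z, p * G.src.prob z = P.prob z * (if ∀ s, f s (z s) = c s then 1 else 0) :=
    P.condOn_prob f c h
  refine ⟨G, ?_⟩
  have hbin : ∀ z, G.src.prob z ≠ 0 → ∀ s, G.f s (z s) = G.c s := by
    intro z hz
    by_contra hc
    have := hprob z
    rw [if_neg hc, mul_zero] at this
    exact hz ((mul_eq_zero.1 this).resolve_left h.ne')
  -- Uniqueness refers to sequences with the same hash, so the regions are disjoint once all other
  -- hash values are excluded.
  let E : ∀ j, Tuple Z (decoded j) → Set (Y j) := fun j z =>
    if ∀ s : decoded j, f s (z s) = c s then uniqueRegion (B j) f z else ∅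
  have hE : ∀ j a, MeasurableSet (E j a) := by
    intro j a
    simp only [E]
    split_ifs
    · exact measurableSet_uniqueRegion (hB j) f a
    · exact MeasurableSet.empty
  have hdisj : ∀ j, Pairwise fun a a' => Disjoint (E j a) (E j a') := by
    intro j a a' haa
    refine Set.disjoint_left.2 fun y hy hy' => ?_
    simp only [E] at hy hy'
    split_ifs at hy hy' with h1 h2
    · exact hy.2 a' haa.symm (fun s => (h1 s).trans (h2 s).symm) hy'.1
    all_goals simp_all
  refine (G.errorProb_le V hN hbin hE hdisj).trans (ENNReal.ofReal_le_ofReal ?_)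
  rw [le_div_iff₀ h, mul_comm, mul_add, mul_add]
  have t1 : p * ∑ j, 2 * (1 - ∑ z, G.src.prob z *
      (G.src.out V z).real {y | y j ∈ E j ((decoded j).restrict z)}) ≤ P.decDev V B f c := by
    rw [Finset.mul_sum]
    refine le_of_eq (Finset.sum_congr rfl fun j _ => ?_)
    rw [mul_left_comm]
    congr 1
    conv_lhs => rw [← G.src.sum_prob, ← Finset.sum_sub_distrib, Finset.mul_sum]
    refine Finset.sum_congr rfl fun z _ => ?_
    rw [← mul_one_sub, ← mul_assoc, hprob z]
    by_cases hz : ∀ s, f s (z s) = c s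
    · congr 1
      have : E j ((decoded j).restrict z) = uniqueRegion (B j) f ((decoded j).restrict z) :=
        if_pos (show ∀ s : decoded j, f s ((decoded j).restrict z s) = c s from fun s => hz s)
      rw [this]
      have hms : MeasurableSet {y : (∀ j, Y j) |
          y j ∈ uniqueRegion (B j) f ((decoded j).restrict z)} :=
        measurable_pi_apply j (measurableSet_uniqueRegion (hB j) f _)
      have := probReal_compl_eq_one_sub (μ := P.out V z) hms
      exact this.symm
    · rw [if_neg hz]; ring
  have t2 : p * ∑ m, max (G.src.base.real (G.msgBin common m) -
      1 / ∏ s ∈ common, (N s : ℝ)) 0 ≤ P.commonDev f g c := by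
    rw [Finset.mul_sum]
    refine le_of_eq (Finset.sum_congr rfl fun m _ => ?_)
    rw [mul_max_of_nonneg _ _ h.le, mul_zero]
    congr 1
    have e1 : G.src.base.real (G.msgBin common m) = ∑ z, G.src.prob z *
        (if common.restrict z ∈ G.msgBin common m then 1 else 0) := by
      rw [G.src.sum_prob_base (fun z₀ => if z₀ ∈ G.msgBin common m then 1 else 0),
        sum_real_singleton_mul_ite]
      rfl
    have e2 : ∑ z, G.src.prob z * (1 / ∏ s ∈ common, (N s : ℝ)) = 1 / ∏ s ∈ common, (N s : ℝ) := by
      rw [← Finset.sum_mul, G.src.sum_prob, one_mul]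
    rw [← e2, e1, ← Finset.sum_sub_distrib, Finset.mul_sum, hashDev]
    refine Finset.sum_congr rfl fun z _ => ?_
    rw [← mul_sub, ← mul_assoc, hprob z, mul_assoc]
    congr 1
    by_cases hz : ∀ s, f s (z s) = c s
    · have hz' : ∀ s : (Finset.univ : Finset Msg), f s (z s) = Finset.univ.restrict c s :=
        fun s => hz s
      rw [if_pos hz, if_pos hz']
      congr 2
      refine if_congr ?_ rfl rfl
      exact ⟨fun h s => (h s).2, fun h s => ⟨hz s, h s⟩⟩
    · have hz' : ¬ ∀ s : (Finset.univ : Finset Msg), f s (z s) = Finset.univ.restrict c s :=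
        fun h' => hz fun s => h' ⟨s, Finset.mem_univ s⟩
      rw [if_neg hz, if_neg hz', zero_mul, zero_mul]
  have t3 : p * ∑ i, ∑ z₀, G.src.base.real {z₀} *
      ∑ m, max ((G.src.side i z₀).real (G.msgBin (priv i) m) -
        1 / ∏ s ∈ priv i, (N s : ℝ)) 0 ≤ ∑ i, P.privDev f g i c := by
    rw [Finset.mul_sum]
    refine Finset.sum_le_sum fun i _ => ?_
    rw [Finset.mul_sum]
    refine Finset.sum_le_sum fun z₀ _ => ?_
    have eb : p * G.src.base.real {z₀} = P.fiberWeight f c z₀ := by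
      rw [show G.src.base.real {z₀} = _ from P.condOn_base f c h z₀, mul_div_cancel₀ _ h.ne']
    rw [← mul_assoc, eb]
    -- A common sequence of positive weight has private fibers of positive probability, so there the
    -- side law is genuinely conditioned.
    by_cases hw : P.fiberWeight f c z₀ = 0
    · rw [hw, zero_mul]; exact P.privDev_term_nonneg f g i c z₀
    rw [Source.fiberWeight] at hw ⊢
    have hside : (P.side i z₀).real (fiber f c (priv i)) ≠ 0 := by
      intro h0
      exact hw (by rw [Finset.prod_eq_zero (Finset.mem_univ i) h0, mul_zero])
    have hsidepos : 0 < (P.side i z₀).real (fiber f c (priv i)) :=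
      lt_of_le_of_ne measureReal_nonneg hside.symm
    refine le_of_eq ?_
    rw [← Finset.mul_prod_erase _ _ (Finset.mem_univ i),
      ← Finset.mul_prod_erase _ _ (Finset.mem_univ i), P.devFactor_self]
    have e1 : ∏ i' ∈ Finset.univ.erase i, P.devFactor f g i z₀ i' ((priv i').restrict c) =
        ∏ i' ∈ Finset.univ.erase i, (P.side i' z₀).real (fiber f c (priv i')) :=
      Finset.prod_congr rfl fun i' hi' => P.devFactor_ne f g (Finset.ne_of_mem_erase hi') z₀ _
    have e3 : (if z₀ ∈ fiber f c common then (1 : ℝ) else 0) =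
        if ∀ s : common, f s (z₀ s) = c s then 1 else 0 := by
      by_cases hz : ∀ s : common, f s (z₀ s) = c s
      · rw [if_pos (show z₀ ∈ fiber f c common from hz), if_pos hz]
      · rw [if_neg (show z₀ ∉ fiber f c common from hz), if_neg hz]
    rw [e1, ← e3]
    have e2 : ∑ m, max (hashDev L N (priv i) (priv i) (P.slice z₀) f g
        ((priv i).restrict c) m) 0 = P.base.real {z₀} *
          ((P.side i z₀).real (fiber f c (priv i)) *
          ∑ m, max ((G.src.side i z₀).real (G.msgBin (priv i) m) -
            1 / ∏ s ∈ priv i, (N s : ℝ)) 0) := by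
      rw [Finset.mul_sum, Finset.mul_sum]
      refine Finset.sum_congr rfl fun m _ => ?_
      rw [mul_max_of_nonneg _ _ hsidepos.le, mul_max_of_nonneg _ _ measureReal_nonneg,
        P.hashDev_slice, mul_zero, mul_zero,
        show (G.src.side i z₀).real (G.msgBin (priv i) m) = _ from
          P.condOn_side f c h i z₀ hside _]
      congr 1
      congr 1
      rw [mul_sub, mul_div_cancel₀ _ hside, mul_one_div]
      congr 2
      ext z
      constructor
      · exact fun h' => ⟨h'.1, fun s => ⟨h'.1 s, h'.2 s⟩⟩
      · exact fun h' => ⟨h'.1, fun s => (h'.2 s).2⟩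
    rw [e2]
    ring
  linarith

/-- The probabilities of the hash values sum to one, so some value of positive probability has at
most its share of the total deviation. The value is thus averaged under its own law, and
near-uniformity of `f(Z)` is never needed. -/
lemma Source.exists_value (P : Source Z X) (V : Kernel (∀ i, X i) (∀ j, Y j)) [IsMarkovKernel V]
    (hN : ∀ s, 0 < N s) {B : ∀ j, Tuple Z (decoded j) → Set (Y j)}
    (hB : ∀ j z, MeasurableSet (B j z)) (f : ∀ s, Z s → Fin (L s)) (g : ∀ s, Z s → Fin (N s)) :
    ∃ G : CRNG Z X N, G.errorProb V ≤ ENNReal.ofReal (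
      ∑ j, 2 * ∑ z, P.prob z *
        (P.out V z).real {y | y j ∉ uniqueRegion (B j) f ((decoded j).restrict z)} +
      ∑ c, ∑ m, max (hashDev L N Finset.univ common P.prob f g c m) 0 +
      ∑ i, ∑ z₀, ∑ c, ∑ m, max (hashDev L N (priv i) (priv i) (P.slice z₀) f g c m) 0) := by
  classical
  -- a good value
  have hd0 : ∀ c, 0 ≤ P.decDev V B f c + P.commonDev f g c + ∑ i, P.privDev f g i c := by
    intro c
    refine add_nonneg (add_nonneg ?_ ?_) ?_
    · refine Finset.sum_nonneg fun j _ => mul_nonneg zero_le_two (Finset.sum_nonneg fun z _ => ?_)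
      refine mul_nonneg (mul_nonneg (P.prob_nonneg z) ?_) measureReal_nonneg
      split_ifs <;> norm_num
    · exact Finset.sum_nonneg fun m _ => le_max_right _ _
    · exact Finset.sum_nonneg fun i _ => Finset.sum_nonneg fun z₀ _ =>
        P.privDev_term_nonneg f g i c z₀
  rw [← P.sum_decDev V B f, ← P.sum_commonDev f g]
  simp only [← P.sum_privDev f g]
  rw [Finset.sum_comm (s := Finset.univ (α := Fin 2)), ← Finset.sum_add_distrib,
    ← Finset.sum_add_distrib]
  set total := ∑ c, (P.decDev V B f c + P.commonDev f g c + ∑ i, P.privDev f g i c) with htotal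
  obtain ⟨c, hc, hle⟩ : ∃ c, 0 < P.fiberProb f c ∧
      P.decDev V B f c + P.commonDev f g c + ∑ i, P.privDev f g i c ≤ total * P.fiberProb f c := by
    by_contra hcon
    push Not at hcon
    have hex : ∃ c, 0 < P.fiberProb f c := by
      by_contra h'
      push Not at h'
      have := P.sum_fiberProb f
      have h2 : ∑ c, P.fiberProb f c ≤ 0 := Finset.sum_nonpos fun c _ => h' c
      linarith
    obtain ⟨c₁, hc₁⟩ := hex
    have hlt : ∑ c, total * P.fiberProb f c < total := by
      conv_rhs => rw [htotal]
      refine Finset.sum_lt_sum (fun c _ => ?_) ⟨c₁, Finset.mem_univ _, hcon c₁ hc₁⟩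
      rcases (P.fiberProb_nonneg f c).eq_or_lt with h0 | h0
      · rw [← h0, mul_zero]; exact hd0 c
      · exact (hcon c h0).le
    rw [← Finset.mul_sum, P.sum_fiberProb, mul_one] at hlt
    exact lt_irrefl _ hlt
  obtain ⟨G, hG⟩ := P.exists_errorProb_le V hN hB f g c hc
  refine ⟨G, hG.trans (ENNReal.ofReal_le_ofReal ?_)⟩
  rwa [div_le_iff₀ hc]

end CondSource

lemma card_decoded (j : Fin 2) : (decoded j).card = 6 := by
  revert j
  decide

/-! ### A code for one block -/

section OneShot

open scoped BigOperators

lemma exists_le_expect {α : Type*} [Fintype α] [Nonempty α] (F : α → ℝ) :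
    ∃ a, F a ≤ 𝔼 a, F a := by
  obtain ⟨a, _, ha⟩ := Finset.exists_le_of_expect_le Finset.univ_nonempty (le_refl (𝔼 a, F a))
  exact ⟨a, ha⟩

lemma expect_collision_tuple {Z : Msg → Type*} [∀ s, Fintype (Z s)] [∀ s, DecidableEq (Z s)]
    [∀ s, Nonempty (Z s)] (K : Msg → ℕ) [∀ s, NeZero (K s)] (F : Finset Msg) (z z' : Tuple Z F) :
    𝔼 f : (∀ s, Z s → Fin (K s)),
        (if ∀ s : F, f s (z s) = f s (z' s) then (1 : ℝ) else 0)
      = ∏ s : F with z s ≠ z' s, 1 / (K s : ℝ) := by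
  let e : Tuple Z F → ∀ s, Z s := fun z s => if h : s ∈ F then z ⟨s, h⟩ else Classical.arbitrary _
  have he : ∀ z (s : F), e z s = z s := fun z s => by simp [e]
  have h := expect_collision K F (e z) (e z')
  have h1 : ∀ f : (∀ s, Z s → Fin (K s)), (∀ s ∈ F, f s (e z s) = f s (e z' s)) ↔
      ∀ s : F, f s (z s) = f s (z' s) := by
    intro f
    constructor
    · intro h s
      have := h s s.2
      rwa [he, he] at this
    · intro h s hs
      have := h ⟨s, hs⟩
      rw [← he z, ← he z'] at this
      exact this
  simp only [h1] at h
  rw [h, Finset.prod_filter, Finset.prod_filter,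
    ← Finset.prod_coe_sort F (fun s => if e z s ≠ e z' s then 1 / (K s : ℝ) else 1)]
  simp only [he]

/-- Exchange of sum and integral: a bound on the number of candidates, valid for every output,
bounds their total probability. -/
lemma sum_measureReal_le_of_card_le {α β : Type*} [MeasurableSpace α] (μ : Measure α)
    [IsProbabilityMeasure μ] (S : Finset β) (A : β → Set α) (hA : ∀ b, MeasurableSet (A b)) {M : ℝ}
    (h : ∀ y, open Classical in ((S.filter fun b => y ∈ A b).card : ℝ) ≤ M) :
    ∑ b ∈ S, μ.real (A b) ≤ M := by
  classical
  have h1 : ∑ b ∈ S, μ.real (A b) = ∫ y, ∑ b ∈ S, (A b).indicator (fun _ => (1 : ℝ)) y ∂μ := by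
    rw [integral_finsetSum]
    · refine Finset.sum_congr rfl fun b _ => ?_
      rw [integral_indicator_const _ (hA b)]
      simp
    · exact fun b _ => (integrable_const 1).indicator (hA b)
  have h2 : ∀ y, ∑ b ∈ S, (A b).indicator (fun _ => (1 : ℝ)) y ≤ M := by
    intro y
    refine le_trans (le_of_eq ?_) (h y)
    simp only [Set.indicator_apply]
    rw [← Finset.sum_filter]
    simp
  rw [h1]
  calc _ ≤ ∫ _, M ∂μ := integral_mono (integrable_finsetSum _ fun b _ =>
        (integrable_const 1).indicator (hA b)) (integrable_const M) h2
    _ = M := by simp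

/-- Only the positive part matters, so outside `𝒯` the subtracted term can be dropped, and each
atypical `z` is then counted for a single pair `(c, m)`. This permits truncation to typical
sequences before second moments are taken. -/
lemma sum_max_hashDev_le {ι : Type*} [Fintype ι] [DecidableEq ι] {Z : ι → Type*}
    [∀ s, Fintype (Z s)] (L N : ι → ℕ) (F A : Finset ι) (p : (∀ s, Z s) → ℝ) (hp : ∀ z, 0 ≤ p z)
    (𝒯 : Set (∀ s, Z s)) [DecidablePred (· ∈ 𝒯)] (f : ∀ s, Z s → Fin (L s))
    (g : ∀ s, Z s → Fin (N s)) :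
    ∑ c, ∑ m, max (hashDev L N F A p f g c m) 0 ≤
      ∑ c, ∑ m, |hashDev L N F A (fun z => if z ∈ 𝒯 then p z else 0) f g c m| +
        ∑ z, if z ∈ 𝒯 then 0 else p z := by
  have hpt : ∀ c m, max (hashDev L N F A p f g c m) 0 ≤
      |hashDev L N F A (fun z => if z ∈ 𝒯 then p z else 0) f g c m| +
      ∑ z, (if z ∈ 𝒯 then 0 else p z) * ((if ∀ s : F, f s (z s) = c s then 1 else 0) *
        (if ∀ s : A, g s (z s) = m s then 1 else 0)) := by
    intro c m
    have hnn : 0 ≤ ∑ z, (if z ∈ 𝒯 then 0 else p z) *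
        ((if ∀ s : F, f s (z s) = c s then 1 else 0) *
        (if ∀ s : A, g s (z s) = m s then 1 else 0)) := by
      refine Finset.sum_nonneg fun z _ => ?_
      have := hp z
      split_ifs <;> simp [this]
    refine max_le ?_ (add_nonneg (abs_nonneg _) hnn)
    refine le_trans ?_ (add_le_add_left (le_abs_self _) _)
    rw [hashDev, hashDev, ← Finset.sum_add_distrib]
    refine Finset.sum_le_sum fun z _ => ?_
    have hn : (0 : ℝ) ≤ 1 / ∏ s ∈ A, (N s : ℝ) := by positivity
    by_cases hz : z ∈ 𝒯
    · simp [hz]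
    · simp only [hz, if_false, zero_mul, zero_add]
      refine mul_le_mul_of_nonneg_left (mul_le_mul_of_nonneg_left (by linarith) ?_) (hp z)
      split_ifs <;> norm_num
  refine (Finset.sum_le_sum fun c _ => Finset.sum_le_sum fun m _ => hpt c m).trans ?_
  simp only [Finset.sum_add_distrib]
  refine add_le_add_right (le_of_eq ?_) _
  simp_rw [Finset.sum_comm (s := (Finset.univ : Finset (∀ s : A, Fin (N s))))
    (t := (Finset.univ : Finset (∀ s, Z s)))]
  rw [Finset.sum_comm]
  refine Finset.sum_congr rfl fun z _ => ?_
  simp only [← Finset.mul_sum, ← Finset.sum_mul]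
  have e1 : ∀ (K : ι → ℕ) (T : Finset ι) (u : ∀ s : T, Fin (K s)),
      ∑ m : (∀ s : T, Fin (K s)), (if ∀ s, u s = m s then (1 : ℝ) else 0) = 1 := by
    intro K T u
    have : ∀ m : (∀ s : T, Fin (K s)), (∀ s, u s = m s) ↔ u = m := fun m => funext_iff.symm
    simp_rw [this]
    rw [Finset.sum_ite_eq, if_pos (Finset.mem_univ _)]
  rw [e1 L F (fun s => f s (z s)), e1 N A (fun s => g s (z s))]
  ring

variable {Z : Msg → Type} [∀ s, Fintype (Z s)] [∀ s, MeasurableSpace (Z s)]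
  [∀ s, MeasurableSingletonClass (Z s)]
  {X Y : Fin 2 → Type*} [∀ i, MeasurableSpace (X i)] [∀ j, MeasurableSpace (Y j)]
  {L N : Msg → ℕ}

/-- Bounds on the point masses of the marginal laws of the source on the set `𝒯`. -/
structure Source.MassBound (P : Source Z X) (𝒯 : Set (∀ s, Z s)) (α₀ : Finset Msg → ℝ)
    (α : Fin 2 → Finset Msg → ℝ) : Prop where
  base : ∀ T ⊆ common, ∀ z ∈ 𝒯,
    P.base.real {z₀ | ∀ s : common, s.1 ∈ T → z₀ s = z s} ≤ α₀ T
  side : ∀ i, ∀ T ⊆ priv i, ∀ z ∈ 𝒯,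
    (P.side i (common.restrict z)).real {w | ∀ s : priv i, s.1 ∈ T → w s = z s} ≤ α i T

-- Agreement on `T` factors into agreement on its common and private parts. Each factor is bounded
-- by comparison with a typical family having the same entries on `T`.
open Classical in
lemma Source.MassBound.sum_prob_le {P : Source Z X} {𝒯 : Set (∀ s, Z s)} {α₀ : Finset Msg → ℝ}
    {α : Fin 2 → Finset Msg → ℝ} (h : P.MassBound 𝒯 α₀ α) (h₀ : ∀ T, 0 ≤ α₀ T)
    (h₁ : ∀ i T, 0 ≤ α i T) (T : Finset Msg) (z : ∀ s, Z s) :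
    ∑ z' with ∀ s ∈ T, z' s = z s, (if z' ∈ 𝒯 then P.prob z' else 0) ≤
      α₀ (T ∩ common) * ∏ i, α i (T ∩ priv i) := by
  -- The bound on a side law is available only at the common part of a point of `𝒯`; membership in
  -- `C` supplies such a point.
  let C : Set (Tuple Z common) :=
    {z₀ | ∃ z' ∈ 𝒯, common.restrict z' = z₀ ∧ ∀ s ∈ T, z' s = z s}
  have h2 := P.sum_prob_split (fun z₀ => if z₀ ∈ C then 1 else 0)
    (fun i _ w => if ∀ s : priv i, s.1 ∈ T ∩ priv i → w s = z s then 1 else 0)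
  calc ∑ z' with ∀ s ∈ T, z' s = z s, (if z' ∈ 𝒯 then P.prob z' else 0)
      ≤ ∑ z', P.prob z' * ((if common.restrict z' ∈ C then 1 else 0) * ∏ i,
          if ∀ s : priv i, s.1 ∈ T ∩ priv i → (priv i).restrict z' s = z s then 1 else 0) := by
        rw [Finset.sum_filter]
        refine Finset.sum_le_sum fun z' _ => ?_
        by_cases ha : ∀ s ∈ T, z' s = z s
        · rw [if_pos ha]
          by_cases hT : z' ∈ 𝒯
          · have hC : common.restrict z' ∈ C := ⟨z', hT, rfl, ha⟩
            rw [if_pos hT, if_pos hC, Finset.prod_eq_one, one_mul, mul_one]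
            intro i _
            rw [if_pos]
            exact fun s hs => ha s (Finset.mem_inter.1 hs).1
          · rw [if_neg hT]
            refine mul_nonneg (P.prob_nonneg z') (mul_nonneg ?_ (Finset.prod_nonneg fun i _ => ?_))
            all_goals split_ifs <;> norm_num
        · rw [if_neg ha]
          refine mul_nonneg (P.prob_nonneg z') (mul_nonneg ?_ (Finset.prod_nonneg fun i _ => ?_))
          all_goals split_ifs <;> norm_num
    _ = _ := h2
    _ ≤ ∑ z₀, P.base.real {z₀} * (if z₀ ∈ C then 1 else 0) * ∏ i, α i (T ∩ priv i) := by
        refine Finset.sum_le_sum fun z₀ _ => ?_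
        by_cases hC : z₀ ∈ C
        · refine mul_le_mul_of_nonneg_left ?_ (mul_nonneg measureReal_nonneg
            (by rw [if_pos hC]; exact zero_le_one))
          refine Finset.prod_le_prod (fun i _ => ?_) fun i _ => ?_
          · refine Finset.sum_nonneg fun w _ => mul_nonneg measureReal_nonneg ?_
            split_ifs <;> norm_num
          · rw [sum_real_singleton_mul_ite]
            obtain ⟨z', hz', rfl, ha⟩ := hC
            refine le_trans (le_of_eq ?_) (h.side i (T ∩ priv i) Finset.inter_subset_right z' hz')
            congr 1
            ext w
            refine forall_congr' fun s => forall_congr' fun hs => ?_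
            rw [ha s (Finset.mem_inter.1 hs).1]
        · rw [if_neg hC]; simp
    _ = P.base.real C * ∏ i, α i (T ∩ priv i) := by
        rw [← Finset.sum_mul, sum_real_singleton_mul_ite]
        rfl
    _ ≤ _ := by
        refine mul_le_mul_of_nonneg_right ?_ (Finset.prod_nonneg fun i _ => h₁ i _)
        by_cases hC : C.Nonempty
        · obtain ⟨_, z', hz', rfl, ha⟩ := hC
          refine le_trans (measureReal_mono ?_)
            (h.base (T ∩ common) Finset.inter_subset_right z' hz')
          rintro _ ⟨z'', _, rfl, ha''⟩ s hs
          have hsT := (Finset.mem_inter.1 hs).1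
          exact (ha'' s hsT).trans (ha s hsT).symm
        · rw [Set.not_nonempty_iff_eq_empty.1 hC]
          simpa using h₀ _

lemma Source.sum_slice_mul (P : Source Z X) (i : Fin 2) (z₀ : Tuple Z common)
    (p : Tuple Z (priv i) → Prop) [DecidablePred p] :
    ∑ z, P.slice z₀ z * (if p ((priv i).restrict z) then 1 else 0) =
      P.base.real {z₀} * (P.side i z₀).real {w | p w} := by
  classical
  let b : Tuple Z common → Tuple Z (priv i) → ℝ := fun z₀' w =>
    (if z₀' = z₀ then 1 else 0) * (if p w then 1 else 0)
  have h := P.sum_prob_side i b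
  have e : ∀ z, P.slice z₀ z * (if p ((priv i).restrict z) then 1 else 0) =
      P.prob z * b (common.restrict z) ((priv i).restrict z) := by
    intro z
    rw [Source.slice, mul_assoc]
  simp only [e]
  rw [h, Finset.sum_eq_single z₀]
  · simp only [b, if_true, one_mul]
    rw [sum_real_singleton_mul_ite]
  · intro z _ hz
    simp [b, hz]
  · simp

lemma Source.sum_slice (P : Source Z X) (z₀ : Tuple Z common) :
    ∑ z, P.slice z₀ z = P.base.real {z₀} := by
  have h := P.sum_slice_mul 0 z₀ (fun _ => True)
  simpa using h

lemma Source.slice_nonneg (P : Source Z X) (z₀ : Tuple Z common) (z : ∀ s, Z s) :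
    0 ≤ P.slice z₀ z := by
  unfold Source.slice
  refine mul_nonneg (P.prob_nonneg z) ?_
  split_ifs <;> norm_num

-- Either the slice has no typical family agreeing with `z` on `T`, and the sum vanishes, or the
-- mass bound at one such family bounds them all.
open Classical in
lemma Source.MassBound.sum_slice_le {P : Source Z X} {𝒯 : Set (∀ s, Z s)} {α₀ : Finset Msg → ℝ}
    {α : Fin 2 → Finset Msg → ℝ} (h : P.MassBound 𝒯 α₀ α)
    (h₁ : ∀ i T, 0 ≤ α i T) (i : Fin 2) (z₀ : Tuple Z common) {T : Finset Msg} (hT : T ⊆ priv i)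
    (z : ∀ s, Z s) :
    ∑ z' with ∀ s ∈ T, z' s = z s, (if z' ∈ 𝒯 then P.slice z₀ z' else 0) ≤
      P.base.real {z₀} * α i T := by
  by_cases hex : ∃ z' ∈ 𝒯, common.restrict z' = z₀ ∧ ∀ s ∈ T, z' s = z s
  · obtain ⟨z₁, hz₁, rfl, ha⟩ := hex
    refine le_trans ?_ (mul_le_mul_of_nonneg_left (h.side i T hT z₁ hz₁) measureReal_nonneg)
    rw [← P.sum_slice_mul i _ (fun w => ∀ s : priv i, s.1 ∈ T → w s = z₁ s), Finset.sum_filter]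
    refine Finset.sum_le_sum fun z' _ => ?_
    have hnn := P.slice_nonneg (common.restrict z₁) z'
    by_cases hz' : ∀ s ∈ T, z' s = z s
    · have : ∀ s : priv i, s.1 ∈ T → (priv i).restrict z' s = z₁ s :=
        fun s hs => (hz' s hs).trans (ha s hs).symm
      rw [if_pos hz', if_pos this, mul_one]
      split_ifs
      · exact le_rfl
      · exact hnn
    · rw [if_neg hz']
      refine mul_nonneg hnn ?_
      split_ifs <;> norm_num
  · push Not at hex
    rw [Finset.sum_eq_zero]
    · exact mul_nonneg measureReal_nonneg (h₁ i T)
    · intro z' hz'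
      rw [Finset.mem_filter] at hz'
      split_ifs with h3
      · have : common.restrict z' ≠ z₀ := by
          intro h4
          obtain ⟨s, hs, hne⟩ := hex z' h3 h4
          exact hne (hz'.2 s hs)
        simp [Source.slice, this]
      · rfl

variable [∀ s, Nonempty (Z s)] [∀ s, StandardBorelSpace (Z s)]

open Classical in
/-- Random binning: the decoder confuses sequences with small probability. -/
lemma Source.expect_not_uniqueRegion_le (P : Source Z X) (V : Kernel (∀ i, X i) (∀ j, Y j))
    [IsMarkovKernel V] [∀ s, NeZero (L s)] (j : Fin 2) {B : Tuple Z (decoded j) → Set (Y j)}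
    (hB : ∀ z, MeasurableSet (B z)) {θ : ℝ} (hθ : 0 ≤ θ)
    (hcount : ∀ (y : Y j) (z : Tuple Z (decoded j)), ∀ T ⊆ decoded j, T.Nonempty →
      ((Finset.univ.filter fun z' : Tuple Z (decoded j) =>
        (∀ s, z' s ≠ z s ↔ s.1 ∈ T) ∧ y ∈ B z').card : ℝ) ≤ θ * ∏ s ∈ T, (L s : ℝ)) :
    𝔼 f : (∀ s, Z s → Fin (L s)), ∑ z, P.prob z *
        (P.out V z).real {y | y j ∉ uniqueRegion B f ((decoded j).restrict z)} ≤
      ∑ z, P.prob z * (P.out V z).real {y | y j ∉ B ((decoded j).restrict z)} + 2 ^ 6 * θ := by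
  have hmB : ∀ z', MeasurableSet {y : (∀ j, Y j) | y j ∈ B z'} := fun z' =>
    measurable_pi_apply j (hB z')
  have hLpos : ∀ s, (0 : ℝ) < L s := fun s => by
    exact_mod_cast Nat.pos_of_ne_zero (NeZero.ne (L s))
  have hpt : ∀ (f : ∀ s, Z s → Fin (L s)) (z : ∀ s, Z s),
      (P.out V z).real {y | y j ∉ uniqueRegion B f ((decoded j).restrict z)} ≤
      (P.out V z).real {y | y j ∉ B ((decoded j).restrict z)} +
      ∑ z' with z' ≠ (decoded j).restrict z,
        (if ∀ s : decoded j, f s ((decoded j).restrict z s) = f s (z' s) then 1 else 0) *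
          (P.out V z).real {y | y j ∈ B z'} := by
    intro f z
    set D : Finset (Tuple Z (decoded j)) := Finset.univ.filter fun z' =>
      z' ≠ (decoded j).restrict z ∧
        ∀ s : decoded j, f s ((decoded j).restrict z s) = f s (z' s) with hD
    have hsub : {y : (∀ j, Y j) | y j ∉ uniqueRegion B f ((decoded j).restrict z)} ⊆
        {y | y j ∉ B ((decoded j).restrict z)} ∪ ⋃ z' ∈ D, {y | y j ∈ B z'} := by
      intro y hy
      by_cases h : y j ∈ B ((decoded j).restrict z)
      · right
        by_contra hcon
        refine hy ⟨h, fun z' hz' hf hy' => hcon ?_⟩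
        exact Set.mem_biUnion (Finset.mem_filter.2 ⟨Finset.mem_univ _, hz', hf⟩) hy'
      · exact Or.inl h
    refine (measureReal_mono hsub).trans ((measureReal_union_le _ _).trans ?_)
    refine add_le_add_right ((measureReal_biUnion_finset_le D _).trans ?_) _
    rw [Finset.sum_filter, Finset.sum_filter]
    refine Finset.sum_le_sum fun z' _ => ?_
    by_cases h1 : z' ≠ (decoded j).restrict z
    · by_cases h2 : ∀ s : decoded j, f s ((decoded j).restrict z s) = f s (z' s)
      · rw [if_pos ⟨h1, h2⟩, if_pos h1, if_pos h2, one_mul]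
      · rw [if_neg (fun h => h2 h.2), if_pos h1, if_neg h2, zero_mul]
    · rw [if_neg (fun h => h1 h.1), if_neg h1]
  -- Competitors are sorted by the set `T` of components in which they differ from the true
  -- sequence. They collide with it with probability `∏ 1 / L s` over `T`, and at most `θ` times the
  -- inverse are candidates, so each of the `2 ^ 6` subsets contributes at most `θ`.
  have hz : ∀ z : (∀ s, Z s), ∑ z' with z' ≠ (decoded j).restrict z,
      (∏ s : decoded j with (decoded j).restrict z s ≠ z' s, 1 / (L s : ℝ)) *
        (P.out V z).real {y | y j ∈ B z'} ≤ 2 ^ 6 * θ := by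
    intro z
    set w := (decoded j).restrict z with hw
    let S : Finset Msg → Finset (Tuple Z (decoded j)) := fun T =>
      Finset.univ.filter fun z' => ∀ s, z' s ≠ w s ↔ s.1 ∈ T
    have hS : ∀ T ⊆ decoded j, T.Nonempty → ∑ z' ∈ S T, (P.out V z).real {y | y j ∈ B z'} ≤
        θ * ∏ s ∈ T, (L s : ℝ) := by
      intro T hT hne
      refine sum_measureReal_le_of_card_le _ _ _ (fun z' => hmB z') fun y => ?_
      refine le_trans (le_of_eq ?_) (hcount (y j) w T hT hne)
      simp only [S, Finset.filter_filter]
      rfl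
    have hterm : ∀ z' : Tuple Z (decoded j), z' ≠ w →
        (∏ s : decoded j with w s ≠ z' s, 1 / (L s : ℝ)) *
        (P.out V z).real {y | y j ∈ B z'} ≤
        ∑ T ∈ (decoded j).powerset, if T.Nonempty then (if z' ∈ S T then
          (∏ s ∈ T, 1 / (L s : ℝ)) * (P.out V z).real {y | y j ∈ B z'} else 0) else 0 := by
      intro z' hz'
      set T₀ : Finset Msg := (Finset.univ.filter fun s : decoded j => w s ≠ z' s).map
        (Function.Embedding.subtype _) with hT₀
      have hmem : ∀ s : decoded j, s.1 ∈ T₀ ↔ w s ≠ z' s := by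
        intro s
        simp [hT₀]
      have hsub : T₀ ⊆ decoded j := by
        intro s hs
        rw [hT₀, Finset.mem_map] at hs
        obtain ⟨a, _, rfl⟩ := hs
        exact a.2
      have hne : T₀.Nonempty := by
        obtain ⟨s, hs⟩ := Function.ne_iff.1 hz'
        exact ⟨s, (hmem s).2 hs.symm⟩
      have hprod : ∏ s : decoded j with w s ≠ z' s, 1 / (L s : ℝ) = ∏ s ∈ T₀, 1 / (L s : ℝ) := by
        rw [hT₀, Finset.prod_map]
        rfl
      have hzS : z' ∈ S T₀ := by
        simp only [S, Finset.mem_filter, Finset.mem_univ, true_and]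
        intro s
        rw [hmem]
        exact ne_comm
      have hnn : ∀ T ∈ (decoded j).powerset, (0 : ℝ) ≤ if T.Nonempty then (if z' ∈ S T then
          (∏ s ∈ T, 1 / (L s : ℝ)) * (P.out V z).real {y | y j ∈ B z'} else 0) else 0 := by
        intro T _
        have : 0 ≤ ∏ s ∈ T, 1 / (L s : ℝ) := Finset.prod_nonneg fun s _ => by positivity
        split_ifs
        · exact mul_nonneg this measureReal_nonneg
        · exact le_rfl
        · exact le_rfl
      refine le_trans (le_of_eq ?_) (Finset.single_le_sum hnn (Finset.mem_powerset.2 hsub))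
      rw [if_pos hne, if_pos hzS, hprod]
    calc _ ≤ ∑ z' with z' ≠ w, ∑ T ∈ (decoded j).powerset, (if T.Nonempty then (if z' ∈ S T then
          (∏ s ∈ T, 1 / (L s : ℝ)) * (P.out V z).real {y | y j ∈ B z'} else 0) else 0) :=
          Finset.sum_le_sum fun z' hz' => hterm z' (Finset.mem_filter.1 hz').2
      _ ≤ ∑ z', ∑ T ∈ (decoded j).powerset, (if T.Nonempty then (if z' ∈ S T then
          (∏ s ∈ T, 1 / (L s : ℝ)) * (P.out V z).real {y | y j ∈ B z'} else 0) else 0) := by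
          refine Finset.sum_le_sum_of_subset_of_nonneg (Finset.filter_subset _ _) fun z' _ _ => ?_
          refine Finset.sum_nonneg fun T _ => ?_
          have : 0 ≤ ∏ s ∈ T, 1 / (L s : ℝ) := Finset.prod_nonneg fun s _ => by positivity
          split_ifs
          · exact mul_nonneg this measureReal_nonneg
          · exact le_rfl
          · exact le_rfl
      _ ≤ ∑ T ∈ (decoded j).powerset, θ := by
          rw [Finset.sum_comm]
          refine Finset.sum_le_sum fun T hT => ?_
          by_cases hne : T.Nonempty
          · simp only [hne, if_true]
            rw [← Finset.sum_filter, ← Finset.mul_sum, Finset.filter_mem_eq_inter,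
              Finset.univ_inter, Finset.prod_div_distrib, Finset.prod_const_one]
            have hLT : 0 < ∏ s ∈ T, (L s : ℝ) := Finset.prod_pos fun s _ => hLpos s
            rw [one_div, inv_mul_le_iff₀ hLT, mul_comm]
            exact hS T (Finset.mem_powerset.1 hT) hne
          · simpa [hne] using hθ
      _ = 2 ^ 6 * θ := by
          rw [Finset.sum_const, Finset.card_powerset, nsmul_eq_mul, card_decoded]
          norm_num
  calc _ ≤ 𝔼 f : (∀ s, Z s → Fin (L s)), ∑ z, P.prob z *
      ((P.out V z).real {y | y j ∉ B ((decoded j).restrict z)} +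
      ∑ z' with z' ≠ (decoded j).restrict z,
        (if ∀ s : decoded j, f s ((decoded j).restrict z s) = f s (z' s) then 1 else 0) *
          (P.out V z).real {y | y j ∈ B z'}) :=
        Finset.expect_le_expect fun f _ => Finset.sum_le_sum fun z _ =>
          mul_le_mul_of_nonneg_left (hpt f z) (P.prob_nonneg z)
    _ = ∑ z, P.prob z * ((P.out V z).real {y | y j ∉ B ((decoded j).restrict z)} +
      ∑ z' with z' ≠ (decoded j).restrict z,
        (∏ s : decoded j with (decoded j).restrict z s ≠ z' s, 1 / (L s : ℝ)) *
          (P.out V z).real {y | y j ∈ B z'}) := by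
        rw [Finset.expect_sum_comm]
        refine Finset.sum_congr rfl fun z _ => ?_
        rw [← Finset.mul_expect, Finset.expect_add_distrib, Fintype.expect_const,
          Finset.expect_sum_comm]
        congr 2
        refine Finset.sum_congr rfl fun z' _ => ?_
        rw [← Finset.expect_mul, ← expect_collision_tuple]
    _ ≤ ∑ z, P.prob z * ((P.out V z).real {y | y j ∉ B ((decoded j).restrict z)} + 2 ^ 6 * θ) :=
        Finset.sum_le_sum fun z _ => mul_le_mul_of_nonneg_left
          (add_le_add_right (hz z) _) (P.prob_nonneg z)
    _ = _ := by
        simp only [mul_add, Finset.sum_add_distrib]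
        rw [← Finset.sum_mul, P.sum_prob, one_mul]

open Classical in
/-- Existence of a good code for one block. -/
theorem Source.exists_crng (P : Source Z X) (V : Kernel (∀ i, X i) (∀ j, Y j)) [IsMarkovKernel V]
    (hL : ∀ s, 0 < L s) (hN : ∀ s, 0 < N s) {ε θ Q t : ℝ} (hθ : 0 ≤ θ) (hQ : 0 ≤ Q) (ht : 0 < t)
    (hQt : 2 ^ 9 * Q ≤ t ^ 2) {𝒯 : Set (∀ s, Z s)}
    (h𝒯 : ∑ z, (if z ∈ 𝒯 then 0 else P.prob z) ≤ ε) {α₀ : Finset Msg → ℝ}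
    {α : Fin 2 → Finset Msg → ℝ} (h : P.MassBound 𝒯 α₀ α) (h₀ : ∀ T, 0 ≤ α₀ T)
    (h₁ : ∀ i T, 0 ≤ α i T)
    (hQ₀ : ∀ T, ∏ s ∈ T ∩ common, N s ≠ 1 → (∏ s ∈ T, (L s : ℝ)) *
      (∏ s ∈ T ∩ common, (N s : ℝ)) * (α₀ (T ∩ common) * ∏ i, α i (T ∩ priv i)) ≤ Q)
    (hQ₁ : ∀ i, ∀ T ⊆ priv i, ∏ s ∈ T, N s ≠ 1 → (∏ s ∈ T, (L s : ℝ)) *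
      (∏ s ∈ T, (N s : ℝ)) * α i T ≤ Q)
    {B : ∀ j, Tuple Z (decoded j) → Set (Y j)} (hB : ∀ j z, MeasurableSet (B j z))
    (hBε : ∀ j, ∑ z, P.prob z * (P.out V z).real {y | y j ∉ B j ((decoded j).restrict z)} ≤ ε)
    (hcount : ∀ j (y : Y j) (z : Tuple Z (decoded j)), ∀ T ⊆ decoded j, T.Nonempty →
      ∀ S : Finset (Tuple Z (decoded j)), (∀ z' ∈ S, (∀ s, s.1 ∉ T → z' s = z s) ∧ y ∈ B j z') →
        (S.card : ℝ) ≤ θ * ∏ s ∈ T, (L s : ℝ)) :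
    ∃ G : CRNG Z X N, G.errorProb V ≤ ENNReal.ofReal (7 * ε + 2 ^ 8 * θ + 3 * t) := by
  have hL' : ∀ s, NeZero (L s) := fun s => ⟨(hL s).ne'⟩
  have hN' : ∀ s, NeZero (N s) := fun s => ⟨(hN s).ne'⟩
  have hcardF : ∀ F : Finset Msg, (2 : ℝ) ^ F.card ≤ 2 ^ 9 := fun F =>
    pow_le_pow_right₀ one_le_two (by simpa using F.card_le_univ)
  -- the common messages
  have hcommon : 𝔼 f : (∀ s, Z s → Fin (L s)), 𝔼 g : (∀ s, Z s → Fin (N s)),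
      ∑ c, ∑ m, max (hashDev L N Finset.univ common P.prob f g c m) 0 ≤ t + ε := by
    have h1 := expect_sum_abs_hashDev_le L N Finset.univ common (Finset.subset_univ _)
      (fun z => if z ∈ 𝒯 then P.prob z else 0)
      (fun z => by have := P.prob_nonneg z; split_ifs <;> simp [this]) hQ ht
      (fun T _ hT z => (mul_le_mul_of_nonneg_left (h.sum_prob_le h₀ h₁ T z)
        (by positivity)).trans (hQ₀ T hT)) (by
          refine le_trans ?_ hQt
          have h2 : ∑ z, (if z ∈ 𝒯 then P.prob z else 0) ≤ 1 := by
            rw [← P.sum_prob]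
            refine Finset.sum_le_sum fun z _ => ?_
            have := P.prob_nonneg z
            split_ifs <;> simp [this]
          refine mul_le_mul (hcardF _) ?_ ?_ (by norm_num)
          · exact mul_le_of_le_one_left hQ h2
          · refine mul_nonneg (Finset.sum_nonneg fun z _ => ?_) hQ
            have := P.prob_nonneg z
            split_ifs <;> simp [this])
    calc _ ≤ 𝔼 f : (∀ s, Z s → Fin (L s)), 𝔼 g : (∀ s, Z s → Fin (N s)),
        (∑ c, ∑ m, |hashDev L N Finset.univ common (fun z => if z ∈ 𝒯 then P.prob z else 0)
          f g c m| + ε) := Finset.expect_le_expect fun f _ => Finset.expect_le_expect fun g _ =>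
            (sum_max_hashDev_le L N _ _ P.prob P.prob_nonneg 𝒯 f g).trans
              (add_le_add_right h𝒯 _)
      _ ≤ t + ε := by
          simp only [Finset.expect_add_distrib, Fintype.expect_const]
          exact add_le_add_left h1 ε
  -- the messages of encoder `i`
  have hpriv : ∀ i, 𝔼 f : (∀ s, Z s → Fin (L s)), 𝔼 g : (∀ s, Z s → Fin (N s)),
      ∑ z₀, ∑ c, ∑ m, max (hashDev L N (priv i) (priv i) (P.slice z₀) f g c m) 0 ≤ t + ε := by
    intro i
    have hz₀ : ∀ z₀, 𝔼 f : (∀ s, Z s → Fin (L s)), 𝔼 g : (∀ s, Z s → Fin (N s)),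
        ∑ c, ∑ m, |hashDev L N (priv i) (priv i) (fun z => if z ∈ 𝒯 then P.slice z₀ z else 0)
          f g c m| ≤ P.base.real {z₀} * t := by
      intro z₀
      have hnn : ∀ z, 0 ≤ if z ∈ 𝒯 then P.slice z₀ z else 0 := fun z => by
        have := P.slice_nonneg z₀ z
        split_ifs <;> simp [this]
      have hsum : ∑ z, (if z ∈ 𝒯 then P.slice z₀ z else 0) ≤ P.base.real {z₀} := by
        rw [← P.sum_slice]
        refine Finset.sum_le_sum fun z _ => ?_
        have := P.slice_nonneg z₀ z
        split_ifs <;> simp [this]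
      -- Both `Q` and `t` are scaled by the mass of the slice, so that the bounds add up to `t`.
      -- Slices of mass zero are set apart because the hashing bound needs a positive `t`.
      rcases (measureReal_nonneg (μ := P.base) (s := {z₀})).eq_or_lt with h0 | h0
      · have hzero : ∀ z, (if z ∈ 𝒯 then P.slice z₀ z else 0) = 0 := by
          rw [← h0] at hsum
          have := (Finset.sum_eq_zero_iff_of_nonneg fun z _ => hnn z).1
            (le_antisymm hsum (Finset.sum_nonneg fun z _ => hnn z))
          exact fun z => this z (Finset.mem_univ z)
        simp [hashDev, hzero, ← h0]
      · refine expect_sum_abs_hashDev_le L N (priv i) (priv i) subset_rfl _ hnn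
          (Q := P.base.real {z₀} * Q) (mul_nonneg h0.le hQ) (mul_pos h0 ht) ?_ ?_
        · intro T hT hTN z
          rw [Finset.inter_eq_left.2 hT] at hTN ⊢
          refine (mul_le_mul_of_nonneg_left (h.sum_slice_le h₁ i z₀ hT z)
            (by positivity)).trans ?_
          rw [mul_left_comm]
          exact mul_le_mul_of_nonneg_left (hQ₁ i T hT hTN) h0.le
        · rw [mul_pow]
          calc _ ≤ 2 ^ 9 * (P.base.real {z₀} * (P.base.real {z₀} * Q)) := by
                refine mul_le_mul (hcardF _) (mul_le_mul_of_nonneg_right hsum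
                  (mul_nonneg h0.le hQ)) (mul_nonneg (Finset.sum_nonneg fun z _ => hnn z)
                    (mul_nonneg h0.le hQ)) (by norm_num)
            _ = P.base.real {z₀} ^ 2 * (2 ^ 9 * Q) := by ring
            _ ≤ _ := mul_le_mul_of_nonneg_left hQt (by positivity)
    have htail : ∑ z₀, ∑ z, (if z ∈ 𝒯 then 0 else P.slice z₀ z) ≤ ε := by
      refine le_trans (le_of_eq ?_) h𝒯
      rw [Finset.sum_comm]
      refine Finset.sum_congr rfl fun z _ => ?_
      split_ifs
      · simp
      · simp [Source.slice]
    calc _ ≤ 𝔼 f : (∀ s, Z s → Fin (L s)), 𝔼 g : (∀ s, Z s → Fin (N s)),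
        (∑ z₀, ∑ c, ∑ m, |hashDev L N (priv i) (priv i)
          (fun z => if z ∈ 𝒯 then P.slice z₀ z else 0) f g c m| + ε) := by
          refine Finset.expect_le_expect fun f _ => Finset.expect_le_expect fun g _ => ?_
          refine le_trans (Finset.sum_le_sum fun z₀ _ => sum_max_hashDev_le L N _ _ (P.slice z₀)
            (P.slice_nonneg z₀) 𝒯 f g) ?_
          rw [Finset.sum_add_distrib]
          exact add_le_add_right htail _
      _ ≤ t + ε := by
          simp only [Finset.expect_add_distrib, Fintype.expect_const, Finset.expect_sum_comm]
          refine add_le_add_left ((Finset.sum_le_sum fun z₀ _ => ?_).trans (le_of_eq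
            (show ∑ z₀, P.base.real {z₀} * t = t by
              rw [← Finset.sum_mul, sum_real_singleton, one_mul]))) ε
          have := hz₀ z₀
          simpa only [Finset.expect_sum_comm] using this
  have hdec : ∀ j, 𝔼 f : (∀ s, Z s → Fin (L s)), ∑ z, P.prob z *
        (P.out V z).real {y | y j ∉ uniqueRegion (B j) f ((decoded j).restrict z)} ≤
        ε + 2 ^ 6 * θ := fun j =>
    (P.expect_not_uniqueRegion_le V j (hB j) hθ (fun y z T hT hne => hcount j y z T hT hne _ fun z' hz' =>
      have h := (Finset.mem_filter.1 hz').2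
      ⟨fun s hs => not_not.1 fun hne => hs ((h.1 s).1 hne), h.2⟩)).trans (add_le_add_left (hBε j) _)
  -- Two decoders, each with the factor two from posterior sampling, give `4 * ε + 2 ^ 8 * θ`; the
  -- common and the two private message laws give `t + ε` each.
  have htotal : 𝔼 f : (∀ s, Z s → Fin (L s)), 𝔼 g : (∀ s, Z s → Fin (N s)),
      (∑ j, 2 * ∑ z, P.prob z *
        (P.out V z).real {y | y j ∉ uniqueRegion (B j) f ((decoded j).restrict z)} +
      ∑ c, ∑ m, max (hashDev L N Finset.univ common P.prob f g c m) 0 +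
      ∑ i, ∑ z₀, ∑ c, ∑ m, max (hashDev L N (priv i) (priv i) (P.slice z₀) f g c m) 0)
      ≤ 7 * ε + 2 ^ 8 * θ + 3 * t := by
    simp only [Finset.expect_add_distrib, Fintype.expect_const, Fin.sum_univ_two,
      ← Finset.mul_expect]
    have d0 := hdec 0
    have d1 := hdec 1
    have p0 := hpriv 0
    have p1 := hpriv 1
    linarith
  obtain ⟨f, hf⟩ := exists_le_expect fun f : (∀ s, Z s → Fin (L s)) =>
    𝔼 g : (∀ s, Z s → Fin (N s)), (∑ j, 2 * ∑ z, P.prob z *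
        (P.out V z).real {y | y j ∉ uniqueRegion (B j) f ((decoded j).restrict z)} +
      ∑ c, ∑ m, max (hashDev L N Finset.univ common P.prob f g c m) 0 +
      ∑ i, ∑ z₀, ∑ c, ∑ m, max (hashDev L N (priv i) (priv i) (P.slice z₀) f g c m) 0)
  obtain ⟨g, hg⟩ := exists_le_expect fun g : (∀ s, Z s → Fin (N s)) => (∑ j, 2 * ∑ z, P.prob z *
        (P.out V z).real {y | y j ∉ uniqueRegion (B j) f ((decoded j).restrict z)} +
      ∑ c, ∑ m, max (hashDev L N Finset.univ common P.prob f g c m) 0 +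
      ∑ i, ∑ z₀, ∑ c, ∑ m, max (hashDev L N (priv i) (priv i) (P.slice z₀) f g c m) 0)
  obtain ⟨G, hG⟩ := P.exists_value V hN hB f g
  exact ⟨G, hG.trans (ENNReal.ofReal_le_ofReal (hg.trans (hf.trans htotal)))⟩

end OneShot

/-! ### Surprisal -/

section Surprisal

variable {Ω α β : Type*} [MeasurableSpace Ω] [Fintype α] [MeasurableSpace α]
  [MeasurableSingletonClass α] [MeasurableSpace β]

/-- The surprisal, in bits, of `a` given `b`. -/
def surprisal (κ : Kernel β α) (p : β × α) : ℝ := -Real.logb 2 ((κ p.1).real {p.2})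

lemma measurable_real_singleton (κ : Kernel β α) :
    Measurable fun p : β × α => (κ p.1).real {p.2} :=
  measurable_from_prod_countable_left fun a =>
    (κ.measurable_coe (MeasurableSet.singleton a)).ennreal_toReal

lemma measurable_surprisal (κ : Kernel β α) : Measurable (surprisal κ) :=
  ((Real.measurable_log.comp (measurable_real_singleton κ)).div_const _).neg

lemma surprisal_nonneg (κ : Kernel β α) [IsMarkovKernel κ] (p : β × α) : 0 ≤ surprisal κ p :=
  neg_nonneg.2 (Real.logb_nonpos one_lt_two measureReal_nonneg measureReal_le_one)

variable {μ : Measure Ω} {A : Ω → α} {B : Ω → β} {κ : Kernel β α}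

/-- Given `B`, the variable `A` has law `κ`. Any disintegration is allowed, not just `condDistrib`,
because the encoders use the explicit kernels of the source. -/
lemma lintegral_real_singleton [IsProbabilityMeasure μ] [IsMarkovKernel κ] (hA : Measurable A)
    (hB : Measurable B) (h : μ.map (fun ω => (B ω, A ω)) = μ.map B ⊗ₘ κ) {F : ℝ → ℝ≥0∞}
    (hF : Measurable F) :
    ∫⁻ ω, F ((κ (B ω)).real {A ω}) ∂μ = ∫⁻ b, ∑ a, F ((κ b).real {a}) * κ b {a} ∂(μ.map B) := by
  have : IsProbabilityMeasure (μ.map B) := Measure.isProbabilityMeasure_map hB.aemeasurable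
  have hm : Measurable fun p : β × α => F ((κ p.1).real {p.2}) :=
    hF.comp (measurable_real_singleton κ)
  rw [← lintegral_map (f := fun p : β × α => F ((κ p.1).real {p.2})) hm (hB.prodMk hA), h,
    Measure.lintegral_compProd hm]
  simp [lintegral_fintype]

/-- Values of conditional mass zero occur with probability zero; this keeps the conventional value
of the logarithm at zero out of all later products. -/
lemma ae_real_singleton_pos [IsProbabilityMeasure μ] [IsMarkovKernel κ] (hA : Measurable A)
    (hB : Measurable B) (h : μ.map (fun ω => (B ω, A ω)) = μ.map B ⊗ₘ κ) :
    ∀ᵐ ω ∂μ, 0 < (κ (B ω)).real {A ω} := by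
  have hm : Measurable fun x : ℝ => if x = 0 then (1 : ℝ≥0∞) else 0 :=
    Measurable.ite (measurableSet_singleton 0) measurable_const measurable_const
  have h0 := lintegral_real_singleton hA hB h hm
  have h1 : ∀ b a, (if (κ b).real {a} = 0 then (1 : ℝ≥0∞) else 0) * κ b {a} = 0 := by
    intro b a
    by_cases hb : (κ b).real {a} = 0
    · rw [measureReal_eq_zero_iff] at hb
      simp [hb]
    · simp [hb]
  simp only [h1, Finset.sum_const_zero, lintegral_zero] at h0
  have hm' : Measurable fun ω => if (κ (B ω)).real {A ω} = 0 then (1 : ℝ≥0∞) else 0 :=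
    hm.comp ((measurable_real_singleton κ).comp (hB.prodMk hA))
  rw [lintegral_eq_zero_iff hm'] at h0
  filter_upwards [h0] with ω hω
  refine lt_of_le_of_ne measureReal_nonneg fun h => ?_
  simp [h.symm] at hω

lemma integral_surprisal [IsProbabilityMeasure μ] [IsMarkovKernel κ] (hA : Measurable A)
    (hB : Measurable B) (h : μ.map (fun ω => (B ω, A ω)) = μ.map B ⊗ₘ κ) :
    ∫ ω, surprisal κ (B ω, A ω) ∂μ =
      ∫ b, ∑ a, Real.negMulLog ((κ b).real {a}) / Real.log 2 ∂(μ.map B) := by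
  have hl : 0 < Real.log 2 := Real.log_pos one_lt_two
  have hF : Measurable fun x : ℝ => ENNReal.ofReal (-Real.logb 2 x) :=
    (Real.measurable_log.div_const _).neg.ennreal_ofReal
  have hnn : ∀ b a, 0 ≤ Real.negMulLog ((κ b).real {a}) / Real.log 2 := fun b a =>
    div_nonneg (Real.negMulLog_nonneg measureReal_nonneg measureReal_le_one) hl.le
  rw [integral_eq_lintegral_of_nonneg_ae (Eventually.of_forall fun ω => surprisal_nonneg κ _)
      ((measurable_surprisal κ).comp (hB.prodMk hA)).aestronglyMeasurable,
    integral_eq_lintegral_of_nonneg_ae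
      (Eventually.of_forall fun b => Finset.sum_nonneg fun a _ => hnn b a)]
  · congr 1
    refine (lintegral_real_singleton hA hB h hF).trans (lintegral_congr fun b => ?_)
    rw [ENNReal.ofReal_sum_of_nonneg fun a _ => hnn b a]
    refine Finset.sum_congr rfl fun a _ => ?_
    rw [← ofReal_measureReal (μ := κ b) (s := {a}), ← ENNReal.ofReal_mul' measureReal_nonneg]
    congr 1
    rw [Real.negMulLog, Real.logb]
    ring
  · refine Measurable.aestronglyMeasurable (Finset.measurable_fun_sum _ fun a _ => ?_)
    exact (Real.continuous_negMulLog.measurable.comp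
      (κ.measurable_coe (MeasurableSet.singleton a)).ennreal_toReal).div_const _

/-- The square of `|log x| * √x < 2`. -/
lemma log_sq_mul_le {x : ℝ} (h0 : 0 ≤ x) (h1 : x ≤ 1) : Real.log x ^ 2 * x ≤ 4 := by
  rcases h0.eq_or_lt with rfl | h0
  · norm_num
  have h := Real.abs_log_mul_self_rpow_lt x (1 / 2) h0 h1 (by norm_num)
  rw [← Real.sqrt_eq_rpow] at h
  have h2 : (Real.log x * √x) ^ 2 ≤ 2 ^ 2 := by
    rw [← sq_abs]
    exact pow_le_pow_left₀ (abs_nonneg _) (h.le.trans (by norm_num)) 2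
  rw [mul_pow, Real.sq_sqrt h0.le] at h2
  linarith

/-- Given `B = b`, the second moment is a sum of terms `x * (log₂ x)²` over a finite alphabet, hence
bounded independently of `b`; so `B` may take values in any measurable space. -/
lemma memLp_surprisal [IsProbabilityMeasure μ] [IsMarkovKernel κ] (hA : Measurable A)
    (hB : Measurable B) (h : μ.map (fun ω => (B ω, A ω)) = μ.map B ⊗ₘ κ) :
    MemLp (fun ω => surprisal κ (B ω, A ω)) 2 μ := by
  have : IsProbabilityMeasure (μ.map B) := Measure.isProbabilityMeasure_map hB.aemeasurable
  have hm : Measurable fun ω => surprisal κ (B ω, A ω) :=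
    (measurable_surprisal κ).comp (hB.prodMk hA)
  rw [memLp_two_iff_integrable_sq hm.aestronglyMeasurable]
  refine ⟨(hm.pow_const 2).aestronglyMeasurable, ?_⟩
  rw [hasFiniteIntegral_iff_ofReal (Eventually.of_forall fun ω => sq_nonneg _)]
  have hF : Measurable fun x : ℝ => ENNReal.ofReal ((-Real.logb 2 x) ^ 2) :=
    ((Real.measurable_log.div_const _).neg.pow_const 2).ennreal_ofReal
  refine lt_of_eq_of_lt (lintegral_real_singleton hA hB h hF) ?_
  refine lt_of_le_of_lt (lintegral_mono (g := fun _ =>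
    ∑ _a : α, ENNReal.ofReal (4 / Real.log 2 ^ 2)) fun b => ?_) ?_
  · refine Finset.sum_le_sum fun a _ => ?_
    rw [← ofReal_measureReal (μ := κ b) (s := {a}), ← ENNReal.ofReal_mul' measureReal_nonneg]
    refine ENNReal.ofReal_le_ofReal ?_
    have := log_sq_mul_le (measureReal_nonneg (μ := κ b) (s := {a})) measureReal_le_one
    rw [neg_sq, Real.logb, div_pow, div_mul_eq_mul_div]
    gcongr
  · rw [lintegral_const, measure_univ, mul_one]
    exact ENNReal.sum_lt_top.2 fun _ _ => ENNReal.ofReal_lt_top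

/-- Conditional laws are almost everywhere unique, so the entropy can be computed from any
disintegration. -/
lemma condEntropy_eq_integral_surprisal [Nonempty α] [StandardBorelSpace α]
    [IsProbabilityMeasure μ] [IsMarkovKernel κ] (hA : Measurable A)
    (hB : Measurable B) (h : μ.map (fun ω => (B ω, A ω)) = μ.map B ⊗ₘ κ) :
    condEntropy μ A B = ∫ ω, surprisal κ (B ω, A ω) ∂μ := by
  rw [integral_surprisal hA hB h, condEntropy]
  refine integral_congr_ae ?_
  filter_upwards [condDistrib_ae_eq_of_measure_eq_compProd B hA.aemeasurable h] with b hb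
  simp only [hb]

/-- Unconditional entropy is treated as entropy given a trivial variable. -/
lemma map_prodMk_unit_eq [IsProbabilityMeasure μ] (hA : Measurable A) :
    μ.map (fun ω => ((), A ω)) = μ.map (fun _ => ()) ⊗ₘ Kernel.const Unit (μ.map A) := by
  rw [Measure.map_const, measure_univ, one_smul, Measure.dirac_unit_compProd_const,
    Measure.map_map measurable_prodMk_left hA]
  rfl

lemma entropy_eq_integral_surprisal [IsProbabilityMeasure μ] (hA : Measurable A) :
    entropy μ A = ∫ ω, surprisal (Kernel.const Unit (μ.map A)) ((), A ω) ∂μ := by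
  have : IsProbabilityMeasure (μ.map A) := Measure.isProbabilityMeasure_map hA.aemeasurable
  rw [integral_surprisal hA measurable_const (map_prodMk_unit_eq hA)]
  simp [entropy]

end Surprisal

/-! ### Deviations of sums of independent variables -/

/-- Chebyshev's inequality, since variances of independent terms add. The terms need not be
identically distributed, which is what time sharing requires. -/
lemma pi_deviation_le {n : ℕ} {Ω : Type*} [MeasurableSpace Ω] (μ : Fin n → Measure Ω)
    [∀ t, IsProbabilityMeasure (μ t)] (F : Fin n → Ω → ℝ) (hF : ∀ t, MemLp (F t) 2 (μ t))
    {v : ℝ} (hv : ∀ t, Var[F t; μ t] ≤ v) (hn : 0 < n) {γ : ℝ} (hγ : 0 < γ) :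
    (Measure.pi μ).real {ω | n * γ ≤ |∑ t, F t (ω t) - ∑ t, ∫ x, F t x ∂(μ t)|} ≤
      v / (n * γ ^ 2) := by
  have hm : ∀ t, MemLp (fun ω : Fin n → Ω => F t (ω t)) 2 (Measure.pi μ) := fun t =>
    (hF t).comp_measurePreserving (measurePreserving_eval μ t)
  have hs : MemLp (∑ t, fun ω : Fin n → Ω => F t (ω t)) 2 (Measure.pi μ) :=
    memLp_finsetSum' _ fun t _ => hm t
  have hn' : (0 : ℝ) < n := by exact_mod_cast hn
  have h := meas_ge_le_variance_div_sq hs (mul_pos hn' hγ)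
  have hE : ∫ ω, (∑ t, fun ω : Fin n → Ω => F t (ω t)) ω ∂(Measure.pi μ) =
      ∑ t, ∫ x, F t x ∂(μ t) := by
    simp only [Finset.sum_apply]
    rw [integral_finsetSum _ fun t _ => (hm t).integrable one_le_two]
    exact Finset.sum_congr rfl fun t _ => integral_comp_eval (hF t).aestronglyMeasurable
  rw [hE, variance_sum_pi hF] at h
  simp only [Finset.sum_apply] at h
  refine (ENNReal.toReal_mono ENNReal.ofReal_ne_top h).trans ?_
  have hvs : ∑ t, Var[F t; μ t] ≤ n * v := by
    refine (Finset.sum_le_sum fun t _ => hv t).trans ?_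
    simp
  rw [ENNReal.toReal_ofReal (div_nonneg (Finset.sum_nonneg fun t _ => variance_nonneg _ _)
    (sq_nonneg _)), div_le_div_iff₀ (by positivity) (by positivity)]
  nlinarith [mul_le_mul_of_nonneg_right hvs (show 0 ≤ n * γ ^ 2 by positivity)]

/-! ### Products of measures -/

section Products

/-- Both sides are the product measure over index pairs. The inputs of a block are grouped by
encoder, while the memoryless channel acts on them grouped by time. -/
lemma pi_map_swap {ι κ : Type*} [Fintype ι] [Fintype κ] {X : ι → Type*}
    [∀ i, MeasurableSpace (X i)] (μ : ∀ i, κ → Measure (X i)) [∀ i t, IsProbabilityMeasure (μ i t)] :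
    (Measure.pi fun i => Measure.pi fun t => μ i t).map (fun x t i => x i t) =
      Measure.pi fun t => Measure.pi fun i => μ i t := by
  have h1 : (Measure.pi fun i => Measure.pi fun t => μ i t).map
      (fun x (p : ι × κ) => x p.1 p.2) = Measure.pi fun p : ι × κ => μ p.1 p.2 := by
    refine (Measure.pi_eq fun S hS => ?_).symm
    rw [Measure.map_apply (by fun_prop) (MeasurableSet.univ_pi hS)]
    have : (fun (x : ∀ i, κ → X i) (p : ι × κ) => x p.1 p.2) ⁻¹' (Set.univ.pi S) =
        Set.univ.pi fun i => Set.univ.pi fun t => S (i, t) := by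
      ext x
      simp [Set.mem_pi]
    rw [this]
    simp only [Measure.pi_pi, Fintype.prod_prod_type]
  have h2 : (Measure.pi fun t => Measure.pi fun i => μ i t).map
      (fun x (p : ι × κ) => x p.2 p.1) = Measure.pi fun p : ι × κ => μ p.1 p.2 := by
    refine (Measure.pi_eq fun S hS => ?_).symm
    rw [Measure.map_apply (by fun_prop) (MeasurableSet.univ_pi hS)]
    have : (fun (x : κ → ∀ i, X i) (p : ι × κ) => x p.2 p.1) ⁻¹' (Set.univ.pi S) =
        Set.univ.pi fun t => Set.univ.pi fun i => S (i, t) := by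
      ext x
      simp only [Set.mem_preimage, Set.mem_pi, Set.mem_univ, true_implies, Prod.forall]
      exact forall_comm
    rw [this]
    simp only [Measure.pi_pi, Fintype.prod_prod_type_right]
  have h3 := congrArg (Measure.map fun (x : ∀ p : ι × κ, X p.1) t i => x (i, t)) (h1.trans h2.symm)
  rw [Measure.map_map (by fun_prop) (by fun_prop), Measure.map_map (by fun_prop) (by fun_prop)]
    at h3
  refine h3.trans ?_
  exact Measure.map_id

lemma lintegral_pi_prod {κ : Type*} [Fintype κ] {X : κ → Type*} [∀ t, MeasurableSpace (X t)]
    (μ : ∀ t, Measure (X t)) [∀ t, IsProbabilityMeasure (μ t)] {F : ∀ t, X t → ℝ≥0∞}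
    (hF : ∀ t, Measurable (F t)) :
    ∫⁻ x, ∏ t, F t (x t) ∂(Measure.pi μ) = ∏ t, ∫⁻ x, F t x ∂(μ t) := by
  have h := iIndepFun_pi (μ := μ) (X := F) fun t => (hF t).aemeasurable
  refine (lintegral_prod_eq_prod_lintegral_of_indepFun Finset.univ (fun t (ω : ∀ t, X t) => F t (ω t)) h
    fun t => (hF t).comp (measurable_pi_apply t)).trans ?_
  exact Finset.prod_congr rfl fun t _ =>
    (measurePreserving_eval μ t).lintegral_comp (hF t)

lemma measurable_pi_measure {κ : Type*} [Fintype κ] {X Y : κ → Type*}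
    [∀ t, MeasurableSpace (X t)] [∀ t, MeasurableSpace (Y t)] (W : ∀ t, Kernel (X t) (Y t))
    [∀ t, IsMarkovKernel (W t)] :
    Measurable fun x : (∀ t, X t) => Measure.pi fun t => W t (x t) := by
  refine Measurable.measure_of_isPiSystem_of_isProbabilityMeasure
    (S := Set.pi Set.univ '' Set.pi Set.univ fun _ => {s | MeasurableSet s})
    generateFrom_pi.symm isPiSystem_pi ?_
  rintro _ ⟨s, hs, rfl⟩
  simp only [Measure.pi_pi]
  refine Finset.measurable_prod _ fun t _ => ?_
  exact (Kernel.measurable_coe (W t) (hs t (Set.mem_univ t))).comp (by fun_prop)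

lemma pi_bind_pi {κ : Type*} [Fintype κ] {X Y : κ → Type*}
    [∀ t, MeasurableSpace (X t)] [∀ t, MeasurableSpace (Y t)] (μ : ∀ t, Measure (X t))
    [∀ t, IsProbabilityMeasure (μ t)] (W : ∀ t, Kernel (X t) (Y t)) [∀ t, IsMarkovKernel (W t)] :
    (Measure.pi μ).bind (fun x => Measure.pi fun t => W t (x t)) =
      Measure.pi fun t => W t ∘ₘ μ t := by
  refine (Measure.pi_eq fun S hS => ?_).symm
  rw [Measure.bind_apply (MeasurableSet.univ_pi hS) (measurable_pi_measure W).aemeasurable]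
  simp only [Measure.pi_pi]
  rw [lintegral_pi_prod μ fun t => (W t).measurable_coe (hS t)]
  exact Finset.prod_congr rfl fun t _ =>
    (Measure.bind_apply (hS t) (W t).measurable.aemeasurable).symm

end Products

/-! ### Blocks of independent letters -/

section Block

variable {Z : Msg → Type} [∀ s, Fintype (Z s)] [∀ s, MeasurableSpace (Z s)]
  [∀ s, MeasurableSingletonClass (Z s)]
  {X Y : Fin 2 → Type*} [∀ i, MeasurableSpace (X i)] [∀ j, MeasurableSpace (Y j)] {n : ℕ}

/-- The law of a tuple of sequences with independent letters. -/
def seqLaw {T : Finset Msg} (μ : Fin n → Measure (Tuple Z T)) :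
    Measure (Tuple (fun s => Fin n → Z s) T) :=
  (Measure.pi μ).map fun u s t => u t s

instance {T : Finset Msg} (μ : Fin n → Measure (Tuple Z T)) [∀ t, IsProbabilityMeasure (μ t)] :
    IsProbabilityMeasure (seqLaw μ) :=
  Measure.isProbabilityMeasure_map (by fun_prop : Measurable _).aemeasurable

/-- The predicate `p` selects the components to be compared, so this covers point masses as well as
masses of marginal laws. -/
lemma seqLaw_match {T : Finset Msg} (μ : Fin n → Measure (Tuple Z T))
    [∀ t, IsProbabilityMeasure (μ t)] (p : Msg → Prop) (w : Tuple (fun s => Fin n → Z s) T) :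
    seqLaw μ {z | ∀ s : T, p s → z s = w s} = ∏ t, μ t {z | ∀ s : T, p s → z s = w s t} := by
  rw [seqLaw, Measure.map_apply (by fun_prop) (Set.toFinite _).measurableSet, ← Measure.pi_pi]
  congr 1
  ext u
  simp only [Set.mem_preimage, Set.mem_ofPred_eq, Set.mem_pi, Set.mem_univ, true_implies,
    funext_iff]
  exact ⟨fun h t s hs => h s hs t, fun h s hs t => h t s hs⟩

lemma seqLaw_singleton {T : Finset Msg} (μ : Fin n → Measure (Tuple Z T))
    [∀ t, IsProbabilityMeasure (μ t)] (w : Tuple (fun s => Fin n → Z s) T) :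
    seqLaw μ {w} = ∏ t, μ t {fun s => w s t} := by
  have h := seqLaw_match μ (fun _ => True) w
  have h1 : {z : Tuple (fun s => Fin n → Z s) T | ∀ s : T, True → z s = w s} = {w} := by
    ext z
    simp [funext_iff]
  have h2 : ∀ t, {z : Tuple Z T | ∀ s : T, True → z s = w s t} = {fun s => w s t} := by
    intro t
    ext z
    simp [funext_iff]
  simpa only [h1, h2] using h

/-- The source that emits independent letters, the `t`-th one with the law `P t`. -/
def Source.block (P : Fin n → Source Z X) :
    Source (fun s => Fin n → Z s) (fun i => Fin n → X i) where
  base := seqLaw fun t => (P t).base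
  side i := ⟨fun z₀ => seqLaw fun t => (P t).side i fun s => z₀ s t, measurable_of_finite _⟩
  input i := ⟨fun z => Measure.pi fun t => (P t).input i (fun s => z.1 s t, fun s => z.2 s t),
    measurable_of_finite _⟩
  base_prob := inferInstance
  side_markov _ := ⟨fun _ => inferInstanceAs (IsProbabilityMeasure (seqLaw _))⟩
  input_markov _ := ⟨fun _ => inferInstanceAs (IsProbabilityMeasure (Measure.pi _))⟩

lemma Source.block_base_match (P : Fin n → Source Z X) (p : Msg → Prop)
    (w : Tuple (fun s => Fin n → Z s) common) :
    (Source.block P).base.real {z | ∀ s : common, p s → z s = w s} =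
      ∏ t, (P t).base.real {z | ∀ s : common, p s → z s = w s t} := by
  simp only [measureReal_def, ← ENNReal.toReal_prod]
  exact congrArg _ (seqLaw_match _ p w)

lemma Source.block_side_match (P : Fin n → Source Z X) (i : Fin 2) (p : Msg → Prop)
    (z₀ : Tuple (fun s => Fin n → Z s) common) (w : Tuple (fun s => Fin n → Z s) (priv i)) :
    ((Source.block P).side i z₀).real {z | ∀ s : priv i, p s → z s = w s} =
      ∏ t, ((P t).side i fun s => z₀ s t).real {z | ∀ s : priv i, p s → z s = w s t} := by
  simp only [measureReal_def, ← ENNReal.toReal_prod]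
  exact congrArg _ (seqLaw_match _ p w)

lemma Source.block_weight (P : Fin n → Source Z X) (z : ∀ s, Fin n → Z s) :
    (Source.block P).weight z = ∏ t, (P t).weight fun s => z s t := by
  have h1 : (Source.block P).base {common.restrict z} =
    ∏ t, (P t).base {common.restrict fun s => z s t} := seqLaw_singleton _ _
  have h2 : ∀ i, (Source.block P).side i (common.restrict z) {(priv i).restrict z} =
    ∏ t, (P t).side i (common.restrict fun s => z s t) {(priv i).restrict fun s => z s t} :=
    fun i => seqLaw_singleton _ _
  simp only [Source.weight, h1, h2, Finset.prod_mul_distrib]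
  rw [Finset.prod_comm]

/-- Transposes a sequence of letters. -/
def letters (ω : Fin n → (∀ s, Z s) × (∀ j, Y j)) :
    (∀ s, Fin n → Z s) × (∀ j, Fin n → Y j) :=
  (fun s t => (ω t).1 s, fun j t => (ω t).2 j)

lemma measurable_letters :
    Measurable (letters : (Fin n → (∀ s, Z s) × (∀ j, Y j)) → _) := by
  unfold letters
  fun_prop

/-- After transposition the inputs are independent over time, and a product of channels maps product
laws to product laws. -/
lemma Source.block_out (W : Kernel (∀ i, X i) (∀ j, Y j)) [IsMarkovKernel W]
    (P : Fin n → Source Z X) (z : ∀ s, Fin n → Z s) :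
    (Source.block P).out (memoryless W n) z =
      (Measure.pi fun t => (P t).out W fun s => z s t).map fun y j t => y t j := by
  have hin : (Source.block P).inputs z = Measure.pi fun i => Measure.pi fun t =>
    (P t).input i (common.restrict fun s => z s t, (priv i).restrict fun s => z s t) := rfl
  have h1 := pi_map_swap fun (i : Fin 2) (t : Fin n) =>
    (P t).input i (common.restrict fun s => z s t, (priv i).restrict fun s => z s t)
  have h2 := pi_bind_pi (fun t => (P t).inputs fun s => z s t) (fun _ : Fin n => W)
  ext S hS
  have hm : Measurable fun y : Fin n → ∀ j, Y j => fun j t => y t j := by fun_prop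
  have hpi := measurable_pi_measure fun _ : Fin n => W
  rw [Measure.map_apply hm hS]
  unfold Source.out
  rw [← h2, Measure.bind_apply (hm hS) hpi.aemeasurable,
    Measure.bind_apply hS (Kernel.aemeasurable _), hin]
  have h3 : ∀ x, memoryless W n x S = (Measure.pi fun t => W fun i => x i t)
      ((fun y j t => y t j) ⁻¹' S) := fun x => Measure.map_apply hm hS
  simp only [h3]
  unfold Source.inputs
  rw [← h1]
  exact (lintegral_map (f := fun a : Fin n → ∀ i, X i => (Measure.pi fun t => W (a t)) ((fun y j t => y t j) ⁻¹' S))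
    ((Measure.measurable_coe (hm hS)).comp hpi)
    (g := fun (x : ∀ i, Fin n → X i) t i => x i t) (by fun_prop)).symm

/-- Through this identity every typicality event for a block becomes an event about independent
letters. -/
lemma Source.block_joint (W : Kernel (∀ i, X i) (∀ j, Y j)) [IsMarkovKernel W]
    (P : Fin n → Source Z X) :
    (Source.block P).joint (memoryless W n) =
      (Measure.pi fun t => (P t).joint W).map letters := by
  have hpi : (Measure.pi fun t => (P t).joint W) = ∑ z : Fin n → ∀ s, Z s,
      (∏ t, (P t).weight (z t)) •
        (Measure.pi fun t => (P t).out W (z t)).map fun y t => (z t, y t) := by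
    refine Measure.pi_eq fun S hS => ?_
    simp only [Measure.coe_finsetSum, Finset.sum_apply, Measure.smul_apply, smul_eq_mul]
    simp only [fun t => (P t).joint_apply W (hS t)]
    rw [Finset.prod_univ_sum, Fintype.piFinset_univ]
    refine Finset.sum_congr rfl fun z _ => ?_
    rw [Finset.prod_mul_distrib, Measure.map_apply (by fun_prop) (MeasurableSet.univ_pi hS),
      ← Measure.pi_pi]
    rfl
  ext S hS
  rw [Source.joint_apply _ _ hS, Measure.map_apply measurable_letters hS, hpi]
  simp only [Measure.coe_finsetSum, Finset.sum_apply, Measure.smul_apply, smul_eq_mul]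
  rw [← (Equiv.piComm fun (_ : Fin n) s => Z s).sum_comp]
  refine Finset.sum_congr rfl fun z _ => ?_
  rw [Source.block_weight, Source.block_out,
    Measure.map_apply (by fun_prop) (measurable_letters hS)]
  refine congrArg _ (Measure.map_apply (by fun_prop) ?_)
  exact measurable_prodMk_left hS

end Block

/-! ### Concentration of products of densities -/

section Information

/-- The surprisal `-log₂ d` of the density `d` has finite second moment and mean `h`. -/
structure HasMeanSurprisal {Ω : Type*} [MeasurableSpace Ω] (μ : Measure Ω) (d : Ω → ℝ) (h : ℝ) :
    Prop where
  pos : ∀ᵐ ω ∂μ, 0 < d ω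
  memLp : MemLp (fun ω => -Real.logb 2 (d ω)) 2 μ
  integral_eq : ∫ ω, -Real.logb 2 (d ω) ∂μ = h

lemma hasMeanSurprisal_kernel {Ω α β : Type*} [MeasurableSpace Ω] [Fintype α] [MeasurableSpace α]
    [MeasurableSingletonClass α] [MeasurableSpace β] [Nonempty α] [StandardBorelSpace α]
    {μ : Measure Ω} {A : Ω → α} {B : Ω → β} {κ : Kernel β α}
    [IsProbabilityMeasure μ] [IsMarkovKernel κ] (hA : Measurable A)
    (hB : Measurable B) (h : μ.map (fun ω => (B ω, A ω)) = μ.map B ⊗ₘ κ) :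
    HasMeanSurprisal μ (fun ω => (κ (B ω)).real {A ω}) (condEntropy μ A B) where
  pos := ae_real_singleton_pos hA hB h
  memLp := memLp_surprisal hA hB h
  integral_eq := (condEntropy_eq_integral_surprisal hA hB h).symm

lemma hasMeanSurprisal_law {Ω α : Type*} [MeasurableSpace Ω] [Fintype α] [MeasurableSpace α]
    [MeasurableSingletonClass α] {μ : Measure Ω} {A : Ω → α} [IsProbabilityMeasure μ]
    (hA : Measurable A) :
    HasMeanSurprisal μ (fun ω => (μ.map A).real {A ω}) (entropy μ A) := by
  have : IsProbabilityMeasure (μ.map A) := Measure.isProbabilityMeasure_map hA.aemeasurable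
  have h := map_prodMk_unit_eq (μ := μ) hA
  refine ⟨ae_real_singleton_pos (κ := Kernel.const Unit (μ.map A)) hA measurable_const h, ?_, ?_⟩
  · exact memLp_surprisal (κ := Kernel.const Unit (μ.map A)) hA measurable_const h
  · rw [entropy_eq_integral_surprisal hA]
    rfl

variable {n : ℕ} {Ω : Type*} [MeasurableSpace Ω] {μ : Fin n → Measure Ω}
  [∀ t, IsProbabilityMeasure (μ t)] {d : Fin n → Ω → ℝ} {h : Fin n → ℝ} {v : ℝ}

/-- Almost surely all densities are positive, so the logarithm of the product is the sum of the
logarithms; the event needs to be controlled only there. -/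
lemma pi_prod_deviation_le (hd : ∀ t, HasMeanSurprisal (μ t) (d t) (h t))
    (hv : ∀ t, Var[fun ω => -Real.logb 2 (d t ω); μ t] ≤ v) (hn : 0 < n) {γ : ℝ} (hγ : 0 < γ)
    {E : Set (Fin n → Ω)} (hE : ∀ ω ∈ E, (∀ t, 0 < d t (ω t)) →
      n * γ ≤ |Real.logb 2 (∏ t, d t (ω t)) + ∑ t, h t|) :
    (Measure.pi μ).real E ≤ v / (n * γ ^ 2) := by
  refine le_trans ?_ (pi_deviation_le μ (fun t ω => -Real.logb 2 (d t ω))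
    (fun t => (hd t).memLp) hv hn hγ)
  have hpos : ∀ᵐ ω ∂(Measure.pi μ), ∀ t, 0 < d t (ω t) :=
    ae_all_iff.2 fun t => (measurePreserving_eval μ t).quasiMeasurePreserving.ae (hd t).pos
  refine ENNReal.toReal_mono (measure_ne_top _ _) (measure_mono_ae ?_)
  filter_upwards [hpos] with ω hω hωE
  have h1 := hE ω hωE hω
  rw [Real.logb_prod _ _ fun t _ => (hω t).ne'] at h1
  change n * γ ≤ |∑ t, -Real.logb 2 (d t (ω t)) - ∑ t, ∫ x, -Real.logb 2 (d t x) ∂(μ t)|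
  rw [Finset.sum_congr rfl fun t _ => (hd t).integral_eq, Finset.sum_neg_distrib, abs_sub_comm,
    sub_neg_eq_add, add_comm]
  exact h1

lemma pi_prod_gt_le (hd : ∀ t, HasMeanSurprisal (μ t) (d t) (h t))
    (hv : ∀ t, Var[fun ω => -Real.logb 2 (d t ω); μ t] ≤ v) (hn : 0 < n) {γ : ℝ} (hγ : 0 < γ)
    {a : ℝ} (ha : a ≤ ∑ t, h t) :
    (Measure.pi μ).real {ω | 2 ^ (n * γ - a) < ∏ t, d t (ω t)} ≤ v / (n * γ ^ 2) := by
  refine pi_prod_deviation_le hd hv hn hγ fun ω hω hpos => le_trans ?_ (le_abs_self _)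
  have h1 := Real.logb_le_logb_of_le one_lt_two (Real.rpow_pos_of_pos two_pos _) hω.le
  rw [Real.logb_rpow two_pos (by norm_num)] at h1
  linarith

lemma pi_prod_lt_le (hd : ∀ t, HasMeanSurprisal (μ t) (d t) (h t))
    (hv : ∀ t, Var[fun ω => -Real.logb 2 (d t ω); μ t] ≤ v) (hn : 0 < n) {γ : ℝ} (hγ : 0 < γ)
    {a : ℝ} (ha : ∑ t, h t ≤ a) :
    (Measure.pi μ).real {ω | ∏ t, d t (ω t) < 2 ^ (-(n * γ) - a)} ≤ v / (n * γ ^ 2) := by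
  refine pi_prod_deviation_le hd hv hn hγ fun ω hω hpos => le_trans ?_ (neg_le_abs _)
  have h1 := Real.logb_le_logb_of_le one_lt_two (Finset.prod_pos fun t _ => hpos t)
    (le_of_lt hω)
  rw [Real.logb_rpow two_pos (by norm_num)] at h1
  linarith

end Information

/-! ### The densities of a single letter -/

section Letter

variable {Z : Msg → Type} [∀ s, Fintype (Z s)] [∀ s, MeasurableSpace (Z s)]
  [∀ s, MeasurableSingletonClass (Z s)]
  {X Y : Fin 2 → Type*} [∀ i, MeasurableSpace (X i)] [∀ j, MeasurableSpace (Y j)]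

lemma measurable_of_fst {α : Type*} [MeasurableSpace α] (f : (∀ s, Z s) → α) :
    Measurable fun ω : (∀ s, Z s) × (∀ j, Y j) => f ω.1 :=
  (measurable_of_finite f).comp measurable_fst

lemma Source.map_common (P : Source Z X) (V : Kernel (∀ i, X i) (∀ j, Y j)) [IsMarkovKernel V] :
    (P.joint V).map (fun ω => common.restrict ω.1) = P.base := by
  have hm := measurable_of_fst (Y := Y) (common.restrict : (∀ s, Z s) → _)
  have : IsProbabilityMeasure ((P.joint V).map fun ω => common.restrict ω.1) :=
    Measure.isProbabilityMeasure_map hm.aemeasurable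
  classical
  refine Measure.ext_of_singleton fun z₀ => ?_
  rw [← measureReal_eq_measureReal_iff, map_measureReal_apply hm (MeasurableSet.singleton _),
    P.joint_real_apply V (hm (MeasurableSet.singleton _))]
  have h := P.sum_prob_base fun z => if z = z₀ then 1 else 0
  simp only [mul_ite, mul_one, mul_zero, Finset.sum_ite_eq', Finset.mem_univ, if_true] at h
  rw [← h]
  refine Finset.sum_congr rfl fun z _ => ?_
  by_cases hz : common.restrict z = z₀ <;> simp [hz]

lemma Source.map_common_priv (P : Source Z X) (V : Kernel (∀ i, X i) (∀ j, Y j))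
    [IsMarkovKernel V] (i : Fin 2) :
    (P.joint V).map (fun ω => (common.restrict ω.1, (priv i).restrict ω.1)) =
      P.base ⊗ₘ P.side i := by
  have hm := measurable_of_fst (Y := Y) fun z : (∀ s, Z s) =>
    (common.restrict z, (priv i).restrict z)
  have : IsProbabilityMeasure ((P.joint V).map fun ω =>
    (common.restrict ω.1, (priv i).restrict ω.1)) := Measure.isProbabilityMeasure_map hm.aemeasurable
  classical
  refine Measure.ext_of_singleton fun ⟨z₀, w⟩ => ?_
  rw [← Set.singleton_prod_singleton, Measure.compProd_apply_prod (MeasurableSet.singleton _)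
    (MeasurableSet.singleton _), lintegral_singleton, Set.singleton_prod_singleton,
    ← ENNReal.toReal_eq_toReal_iff' (measure_ne_top _ _)
      (ENNReal.mul_ne_top (measure_ne_top _ _) (measure_ne_top _ _)), ← measureReal_def,
    map_measureReal_apply hm (MeasurableSet.singleton _),
    P.joint_real_apply V (hm (MeasurableSet.singleton _)), ENNReal.toReal_mul]
  have h := P.sum_prob_side i fun z z' => if (z, z') = (z₀, w) then 1 else 0
  have h1 : ∀ z₁, P.base.real {z₁} * ∑ z, (P.side i z₁).real {z} *
      (if (z₁, z) = (z₀, w) then 1 else 0) =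
      if z₁ = z₀ then P.base.real {z₁} * (P.side i z₁).real {w} else 0 := by
    intro z₁
    by_cases hz : z₁ = z₀ <;> simp [hz]
  simp only [h1, Finset.sum_ite_eq', Finset.mem_univ, if_true] at h
  rw [mul_comm]
  refine Eq.trans ?_ h
  refine Finset.sum_congr rfl fun z _ => ?_
  by_cases hz : (common.restrict z, (priv i).restrict z) = (z₀, w)
  · simp [hz]
  · rw [if_neg hz, mul_zero]
    simp [hz]

/-- The probability under `P` that `Z_T` agrees with `z`. -/
def Source.baseMass (P : Source Z X) (T : Finset Msg) (z : ∀ s, Z s) : ℝ :=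
  P.base.real {z₀ | ∀ s : common, s.1 ∈ T → z₀ s = z s}

/-- The conditional probability under `P`, given the common part of `z`, that `Z_T` agrees
with `z`. -/
def Source.sideMass (P : Source Z X) (i : Fin 2) (T : Finset Msg) (z : ∀ s, Z s) : ℝ :=
  (P.side i (common.restrict z)).real {w | ∀ s : priv i, s.1 ∈ T → w s = z s}

/-- The mass of all common parts agreeing on `T` is a point mass of the marginal law of `Z_T`, whose
mean surprisal is its entropy. -/
lemma Source.hasMeanSurprisal_baseMass (P : Source Z X) (V : Kernel (∀ i, X i) (∀ j, Y j))
    [IsMarkovKernel V] {T : Finset Msg} (hT : T ⊆ common) :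
    HasMeanSurprisal (P.joint V) (fun ω => P.baseMass T ω.1)
      (entropy (P.joint V) fun ω => T.restrict ω.1) := by
  have hm := measurable_of_fst (Y := Y) (T.restrict : (∀ s, Z s) → _)
  have hc := measurable_of_fst (Y := Y) (common.restrict : (∀ s, Z s) → _)
  have h : (P.joint V).map (fun ω => T.restrict ω.1) = P.base.map (Finset.restrict₂ hT) := by
    rw [← P.map_common V, Measure.map_map (measurable_of_finite _) hc]
    rfl
  have h1 := hasMeanSurprisal_law (μ := P.joint V) hm
  rw [h] at h1
  convert h1 using 2 with ω
  rw [map_measureReal_apply (measurable_of_finite _) (MeasurableSet.singleton _)]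
  refine congrArg _ (Set.ext fun z => ?_)
  simp only [Set.mem_ofPred_eq, Set.mem_preimage, Set.mem_singleton_iff, funext_iff]
  exact ⟨fun h s => h ⟨s.1, hT s.2⟩ s.2, fun h s hs => h ⟨s.1, hs⟩⟩

variable [∀ s, Nonempty (Z s)] [∀ s, StandardBorelSpace (Z s)]

lemma Source.hasMeanSurprisal_sideMass (P : Source Z X) (V : Kernel (∀ i, X i) (∀ j, Y j))
    [IsMarkovKernel V] (i : Fin 2) {T : Finset Msg} (hT : T ⊆ priv i) :
    HasMeanSurprisal (P.joint V) (fun ω => P.sideMass i T ω.1)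
      (condEntropy (P.joint V) (fun ω => T.restrict ω.1) fun ω => common.restrict ω.1) := by
  have hm := measurable_of_fst (Y := Y) (T.restrict : (∀ s, Z s) → _)
  have hc := measurable_of_fst (Y := Y) (common.restrict : (∀ s, Z s) → _)
  have hcp := measurable_of_fst (Y := Y) fun z : (∀ s, Z s) =>
    (common.restrict z, (priv i).restrict z)
  have hr : Measurable (Finset.restrict₂ (π := Z) hT) := measurable_of_finite _
  have : IsMarkovKernel ((P.side i).map (Finset.restrict₂ (π := Z) hT)) := Kernel.IsMarkovKernel.map _ hr
  have h1 := hasMeanSurprisal_kernel (μ := P.joint V) (κ := (P.side i).map (Finset.restrict₂ hT))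
    hm hc (by
      rw [P.map_common V, Measure.compProd_map hr, ← P.map_common_priv V i,
        Measure.map_map (by fun_prop) hcp]
      rfl)
  convert h1 using 2 with ω
  rw [Kernel.map_apply _ hr, map_measureReal_apply hr (MeasurableSet.singleton _)]
  refine congrArg _ (Set.ext fun z => ?_)
  simp only [Set.mem_ofPred_eq, Set.mem_preimage, Set.mem_singleton_iff, funext_iff]
  exact ⟨fun h s => h ⟨s.1, hT s.2⟩ s.2, fun h s hs => h ⟨s.1, hs⟩⟩

/-- The conditional law of `Z_T` given `Y_j` and `Z_{D_j \ T}`. -/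
def Source.decKernel (P : Source Z X) (V : Kernel (∀ i, X i) (∀ j, Y j)) [IsMarkovKernel V]
    (j : Fin 2) (T : Finset Msg) : Kernel (Y j × Tuple Z (decoded j \ T)) (Tuple Z T) :=
  condDistrib (fun ω => T.restrict ω.1) (fun ω => (ω.2 j, (decoded j \ T).restrict ω.1))
    (P.joint V)

instance (P : Source Z X) (V : Kernel (∀ i, X i) (∀ j, Y j)) [IsMarkovKernel V]
    (j : Fin 2) (T : Finset Msg) : IsMarkovKernel (P.decKernel V j T) := by
  unfold Source.decKernel
  infer_instance

lemma Source.hasMeanSurprisal_decKernel (P : Source Z X) (V : Kernel (∀ i, X i) (∀ j, Y j))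
    [IsMarkovKernel V] (j : Fin 2) (T : Finset Msg) :
    HasMeanSurprisal (P.joint V) (fun ω => (P.decKernel V j T
        (ω.2 j, (decoded j \ T).restrict ω.1)).real {T.restrict ω.1})
      (condEntropy (P.joint V) (fun ω => T.restrict ω.1)
        fun ω => (ω.2 j, (decoded j \ T).restrict ω.1)) := by
  have hm := measurable_of_fst (Y := Y) (T.restrict : (∀ s, Z s) → _)
  have hd := measurable_of_fst (Y := Y) ((decoded j \ T).restrict : (∀ s, Z s) → _)
  have hy : Measurable fun ω : (∀ s, Z s) × (∀ j, Y j) => ω.2 j := by fun_prop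
  exact hasMeanSurprisal_kernel hm (hy.prodMk hd)
    (compProd_map_condDistrib hm.aemeasurable).symm

end Letter

/-! ### Typicality of blocks and the number of candidates at a decoder -/

section BlockCode

variable {Z : Msg → Type} [∀ s, Fintype (Z s)] [∀ s, MeasurableSpace (Z s)]
  [∀ s, MeasurableSingletonClass (Z s)] [∀ s, Nonempty (Z s)] [∀ s, StandardBorelSpace (Z s)]
  {X Y : Fin 2 → Type*} [∀ i, MeasurableSpace (X i)] [∀ j, MeasurableSpace (Y j)] {n : ℕ}

/-- There are only finitely many laws, message sets and terminals, so one bound serves every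
position of every block, uniformly in the length. -/
lemma exists_variance_le {ι : Type*} [Finite ι] (P : ι → Source Z X)
    (W : Kernel (∀ i, X i) (∀ j, Y j)) [IsMarkovKernel W] : ∃ v, 0 ≤ v ∧ ∀ a T,
      Var[fun ω => -Real.logb 2 ((P a).baseMass T ω.1); (P a).joint W] ≤ v ∧
      (∀ i, Var[fun ω => -Real.logb 2 ((P a).sideMass i T ω.1); (P a).joint W] ≤ v) ∧
      ∀ j, Var[fun ω => -Real.logb 2 (((P a).decKernel W j T
        (ω.2 j, (decoded j \ T).restrict ω.1)).real {T.restrict ω.1}); (P a).joint W] ≤ v := by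
  have key : ∀ {κ : Type _} [Finite κ] (f : κ → ℝ), ∃ v, ∀ k, f k ≤ v := fun f => by
    obtain ⟨v, hv⟩ := (Set.finite_range f).bddAbove
    exact ⟨v, fun k => hv ⟨k, rfl⟩⟩
  obtain ⟨v₁, h₁⟩ := key fun k : ι × Finset Msg =>
    Var[fun ω => -Real.logb 2 ((P k.1).baseMass k.2 ω.1); (P k.1).joint W]
  obtain ⟨v₂, h₂⟩ := key fun k : ι × Finset Msg × Fin 2 =>
    Var[fun ω => -Real.logb 2 ((P k.1).sideMass k.2.2 k.2.1 ω.1); (P k.1).joint W]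
  obtain ⟨v₃, h₃⟩ := key fun k : ι × Finset Msg × Fin 2 =>
    Var[fun ω => -Real.logb 2 (((P k.1).decKernel W k.2.2 k.2.1
        (ω.2 k.2.2, (decoded k.2.2 \ k.2.1).restrict ω.1)).real {k.2.1.restrict ω.1});
        (P k.1).joint W]
  refine ⟨max 0 (max v₁ (max v₂ v₃)), le_max_left _ _, fun a T => ⟨?_, fun i => ?_, fun j => ?_⟩⟩
  · exact (h₁ (a, T)).trans ((le_max_left _ _).trans (le_max_right _ _))
  · exact (h₂ (a, T, i)).trans
      ((le_max_left _ _).trans ((le_max_right _ _).trans (le_max_right _ _)))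
  · exact (h₃ (a, T, j)).trans
      ((le_max_right _ _).trans ((le_max_right _ _).trans (le_max_right _ _)))

lemma Source.block_joint_real (W : Kernel (∀ i, X i) (∀ j, Y j)) [IsMarkovKernel W]
    (P : Fin n → Source Z X) {S : Set ((∀ s, Fin n → Z s) × (∀ j, Fin n → Y j))}
    (hS : MeasurableSet S) :
    ((Source.block P).joint (memoryless W n)).real S =
      (Measure.pi fun t => (P t).joint W).real {ω | letters ω ∈ S} := by
  rw [Source.block_joint, map_measureReal_apply measurable_letters hS]
  rfl

open Classical in
lemma Source.sum_prob_notMem (P : Source Z X) (V : Kernel (∀ i, X i) (∀ j, Y j))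
    [IsMarkovKernel V] (𝒯 : Set (∀ s, Z s)) :
    ∑ z, (if z ∈ 𝒯 then 0 else P.prob z) = (P.joint V).real {ω | ω.1 ∉ 𝒯} := by
  have hS : MeasurableSet {ω : (∀ s, Z s) × (∀ j, Y j) | ω.1 ∉ 𝒯} :=
    measurable_fst (Set.toFinite 𝒯).measurableSet.compl
  rw [P.joint_real_apply V hS]
  refine Finset.sum_congr rfl fun z _ => ?_
  by_cases hz : z ∈ 𝒯 <;> simp [hz]

/-- The conditional probability of `z_T`, for a block of letters and given all of `y` and the
remaining part of `z`. -/
def blockDec (P : Fin n → Source Z X) (W : Kernel (∀ i, X i) (∀ j, Y j)) [IsMarkovKernel W]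
    (j : Fin 2) {T : Finset Msg} (hT : T ⊆ decoded j)
    (z : Tuple (fun s => Fin n → Z s) (decoded j)) (y : Fin n → Y j) : ℝ :=
  ∏ t, ((P t).decKernel W j T (y t, fun s : ↥(decoded j \ T) => z ⟨s, (Finset.mem_sdiff.1 s.2).1⟩ t)).real
    {fun s : T => z ⟨s, hT s.2⟩ t}

lemma measurable_blockDec (P : Fin n → Source Z X) (W : Kernel (∀ i, X i) (∀ j, Y j))
    [IsMarkovKernel W] (j : Fin 2) {T : Finset Msg} (hT : T ⊆ decoded j)
    (z : Tuple (fun s => Fin n → Z s) (decoded j)) : Measurable (blockDec P W j hT z) := by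
  refine Finset.measurable_prod _ fun t _ => ?_
  refine Measurable.ennreal_toReal ?_
  exact (Kernel.measurable_coe ((P t).decKernel W j T) (MeasurableSet.singleton _)).comp
    (by fun_prop)

/-- With `y` and the components off `T` fixed, the conditional masses of all choices on `T` sum to
one, so at most `1 / c` of them can be `c` or more. -/
lemma card_mul_le_of_le_blockDec (P : Fin n → Source Z X) (W : Kernel (∀ i, X i) (∀ j, Y j))
    [IsMarkovKernel W] (j : Fin 2) {T : Finset Msg} (hT : T ⊆ decoded j)
    (z : Tuple (fun s => Fin n → Z s) (decoded j)) (y : Fin n → Y j) (c : ℝ)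
    (S : Finset (Tuple (fun s => Fin n → Z s) (decoded j)))
    (hS : ∀ z' ∈ S, (∀ s, s.1 ∉ T → z' s = z s) ∧ c ≤ blockDec P W j hT z' y) :
    (S.card : ℝ) * c ≤ 1 := by
  classical
  let F : (Fin n → Tuple Z T) → ℝ := fun u => ∏ t, ((P t).decKernel W j T
    (y t, fun s : ↥(decoded j \ T) => z ⟨s, (Finset.mem_sdiff.1 s.2).1⟩ t)).real {u t}
  let e : Tuple (fun s => Fin n → Z s) (decoded j) → (Fin n → Tuple Z T) :=
    fun z' t s => z' ⟨s, hT s.2⟩ t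
  have hoff : ∀ z' ∈ S, ∀ s, s.1 ∉ T → z' s = z s := fun z' hz' => (hS z' hz').1
  have hinj : Set.InjOn e S := by
    intro z₁ h₁ z₂ h₂ h
    funext s
    by_cases hs : s.1 ∈ T
    · funext t
      exact congrFun (congrFun h t) ⟨s.1, hs⟩
    · rw [hoff z₁ h₁ s hs, hoff z₂ h₂ s hs]
  have hF : ∀ u, 0 ≤ F u := fun u => Finset.prod_nonneg fun t _ => measureReal_nonneg
  have hle : ∀ z' ∈ S, c ≤ F (e z') := by
    intro z' hz'
    refine (hS z' hz').2.trans (le_of_eq ?_)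
    refine Finset.prod_congr rfl fun t _ => ?_
    have : (fun s : ↥(decoded j \ T) => z' ⟨s, (Finset.mem_sdiff.1 s.2).1⟩ t) =
        fun s : ↥(decoded j \ T) => z ⟨s, (Finset.mem_sdiff.1 s.2).1⟩ t := by
      funext s
      rw [hoff z' hz' ⟨s, _⟩ (Finset.mem_sdiff.1 s.2).2]
    rw [this]
  calc (S.card : ℝ) * c = ∑ z' ∈ S, c := by rw [Finset.sum_const, nsmul_eq_mul]
    _ ≤ ∑ z' ∈ S, F (e z') := Finset.sum_le_sum hle
    _ = ∑ u ∈ S.image e, F u := (Finset.sum_image hinj).symm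
    _ ≤ ∑ u, F u := Finset.sum_le_sum_of_subset_of_nonneg (Finset.subset_univ _)
        fun u _ _ => hF u
    _ = 1 := by
        have h := Finset.prod_univ_sum (fun _ : Fin n => (Finset.univ : Finset (Tuple Z T)))
          fun t u => ((P t).decKernel W j T
            (y t, fun s : ↥(decoded j \ T) => z ⟨s, (Finset.mem_sdiff.1 s.2).1⟩ t)).real {u}
        rw [Fintype.piFinset_univ] at h
        rw [← h]
        exact Finset.prod_eq_one fun t _ => sum_real_singleton _

lemma measureReal_biUnion_le_card_mul {Ω κ : Type*} [MeasurableSpace Ω] (μ : Measure Ω)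
    [IsFiniteMeasure μ] (S : Finset κ) (E : κ → Set Ω) {e : ℝ} (h : ∀ k ∈ S, μ.real (E k) ≤ e) :
    μ.real (⋃ k ∈ S, E k) ≤ S.card * e :=
  (measureReal_biUnion_finset_le S E).trans
    ((Finset.sum_le_sum h).trans_eq (by rw [Finset.sum_const, nsmul_eq_mul]))

/-- Most blocks have typical conditional probabilities at the decoders. -/
lemma block_dec_typical (P : Fin n → Source Z X) (W : Kernel (∀ i, X i) (∀ j, Y j))
    [IsMarkovKernel W] (j : Fin 2) (hn : 0 < n) {δ v : ℝ} (hδ : 0 < δ)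
    {ρ : Msg → ℝ} (hρ : ∀ T ⊆ decoded j, ∑ t, condEntropy ((P t).joint W)
      (fun ω => T.restrict ω.1) (fun ω => (ω.2 j, (decoded j \ T).restrict ω.1)) ≤ ∑ s ∈ T, ρ s)
    (hv : ∀ t T, Var[fun ω => -Real.logb 2 (((P t).decKernel W j T
        (ω.2 j, (decoded j \ T).restrict ω.1)).real {T.restrict ω.1}); (P t).joint W] ≤ v) :
    ∑ z, (Source.block P).prob z * ((Source.block P).out (memoryless W n) z).real
      {y | y j ∉ {y | ∀ T, ∀ hT : T ⊆ decoded j, 2 ^ (-(n * δ) - ∑ s ∈ T, ρ s) ≤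
        blockDec P W j hT ((decoded j).restrict z) y}} ≤ 64 * (v / (n * δ ^ 2)) := by
  set G : Tuple (fun s => Fin n → Z s) (decoded j) → Set (Fin n → Y j) := fun z =>
    {y | ∀ T, ∀ hT : T ⊆ decoded j, (2 : ℝ) ^ (-(n * δ) - ∑ s ∈ T, ρ s) ≤
        blockDec P W j hT z y} with hG
  have hGm : ∀ z, MeasurableSet (G z) := fun z => by
    simp only [hG, Set.ofPred_forall]
    exact MeasurableSet.iInter fun T => MeasurableSet.iInter fun hT =>
      measurableSet_le measurable_const (measurable_blockDec P W j hT z)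
  have hS : MeasurableSet {ω : (∀ s, Fin n → Z s) × (∀ j, Fin n → Y j) |
      ω.2 j ∉ G ((decoded j).restrict ω.1)} := by
    have : {ω : (∀ s, Fin n → Z s) × (∀ j, Fin n → Y j) | ω.2 j ∉ G ((decoded j).restrict ω.1)} =
        ⋃ z, {z} ×ˢ {y | y j ∉ G ((decoded j).restrict z)} := by
      ext ω
      simp
    rw [this]
    refine MeasurableSet.iUnion fun z => (MeasurableSet.singleton z).prod ?_
    have hj : Measurable fun y : (∀ j, Fin n → Y j) => y j := measurable_pi_apply j
    exact hj (hGm ((decoded j).restrict z)).compl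
  have h1 := (Source.block P).joint_real_apply (memoryless W n) hS
  rw [Source.block_joint_real W P hS] at h1
  refine h1.symm.le.trans ?_
  have hsub : {ω : Fin n → (∀ s, Z s) × (∀ j, Y j) | letters ω ∈
      {ω : (∀ s, Fin n → Z s) × (∀ j, Fin n → Y j) | ω.2 j ∉ G ((decoded j).restrict ω.1)}} ⊆
      ⋃ T ∈ (decoded j).powerset, {ω | ∏ t, ((P t).decKernel W j T
        ((ω t).2 j, (decoded j \ T).restrict (ω t).1)).real {T.restrict (ω t).1} <
          2 ^ (-(n * δ) - ∑ s ∈ T, ρ s)} := by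
    intro ω hω
    simp only [hG, Set.mem_ofPred_eq, not_forall, not_le] at hω
    obtain ⟨T, hT, h⟩ := hω
    refine Set.mem_biUnion (Finset.mem_coe.2 (Finset.mem_powerset.2 hT)) ?_
    rw [Set.mem_ofPred_eq]
    exact h
  refine (measureReal_mono hsub (measure_ne_top _ _)).trans ?_
  refine (measureReal_biUnion_le_card_mul _ _ _ fun T hT => pi_prod_lt_le
    (fun t => (P t).hasMeanSurprisal_decKernel W j T) (fun t => hv t T) hn hδ
    (hρ T (Finset.mem_powerset.1 hT))).trans_eq ?_
  -- One event for each of the `2 ^ 6 = 64` subsets of the decoded messages.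
  rw [Finset.card_powerset, card_decoded]
  norm_num

/-- Most blocks have typical probabilities at the encoders. -/
lemma block_enc_typical (P : Fin n → Source Z X) (W : Kernel (∀ i, X i) (∀ j, Y j))
    [IsMarkovKernel W] (hn : 0 < n) {δ v : ℝ} (hδ : 0 < δ) {ρ : Msg → ℝ}
    (h₀ : ∀ T ⊆ common, ∑ s ∈ T, ρ s ≤ ∑ t, entropy ((P t).joint W) fun ω => T.restrict ω.1)
    (h₁ : ∀ i, ∀ T ⊆ priv i, ∑ s ∈ T, ρ s ≤ ∑ t, condEntropy ((P t).joint W)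
      (fun ω => T.restrict ω.1) (fun ω => common.restrict ω.1))
    (hv₀ : ∀ t T, Var[fun ω => -Real.logb 2 ((P t).baseMass T ω.1); (P t).joint W] ≤ v)
    (hv₁ : ∀ t T i, Var[fun ω => -Real.logb 2 ((P t).sideMass i T ω.1); (P t).joint W] ≤ v) :
    ((Source.block P).joint (memoryless W n)).real {ω | ω.1 ∉ {z : ∀ s, Fin n → Z s |
      (∀ T ⊆ common, (Source.block P).baseMass T z ≤ 2 ^ (n * δ - ∑ s ∈ T, ρ s)) ∧
      ∀ i, ∀ T ⊆ priv i, (Source.block P).sideMass i T z ≤ 2 ^ (n * δ - ∑ s ∈ T, ρ s)}} ≤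
      24 * (v / (n * δ ^ 2)) := by
  have hb : ∀ T (z : ∀ s, Fin n → Z s), (Source.block P).baseMass T z =
      ∏ t, (P t).baseMass T fun s => z s t :=
    fun T z => Source.block_base_match P (· ∈ T) (common.restrict z)
  have hs : ∀ i T (z : ∀ s, Fin n → Z s), (Source.block P).sideMass i T z =
      ∏ t, (P t).sideMass i T fun s => z s t :=
    fun i T z => Source.block_side_match P i (· ∈ T) (common.restrict z) ((priv i).restrict z)
  set 𝒯 := {z : ∀ s, Fin n → Z s |
      (∀ T ⊆ common, (Source.block P).baseMass T z ≤ 2 ^ (n * δ - ∑ s ∈ T, ρ s)) ∧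
      ∀ i, ∀ T ⊆ priv i, (Source.block P).sideMass i T z ≤ 2 ^ (n * δ - ∑ s ∈ T, ρ s)} with h𝒯
  have hS : MeasurableSet {ω : (∀ s, Fin n → Z s) × (∀ j, Fin n → Y j) | ω.1 ∉ 𝒯} :=
    measurable_fst (Set.toFinite 𝒯).measurableSet.compl
  rw [Source.block_joint_real W P hS]
  have hsub : {ω : Fin n → (∀ s, Z s) × (∀ j, Y j) | letters ω ∈
      {ω : (∀ s, Fin n → Z s) × (∀ j, Fin n → Y j) | ω.1 ∉ 𝒯}} ⊆
      (⋃ T ∈ common.powerset, {ω | 2 ^ (n * δ - ∑ s ∈ T, ρ s) <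
        ∏ t, (P t).baseMass T (ω t).1}) ∪
      ⋃ i ∈ (Finset.univ : Finset (Fin 2)), ⋃ T ∈ (priv i).powerset,
        {ω | 2 ^ (n * δ - ∑ s ∈ T, ρ s) < ∏ t, (P t).sideMass i T (ω t).1} := by
    intro ω hω
    simp only [h𝒯, hb, hs, Set.mem_ofPred_eq, not_and_or, not_forall, not_le] at hω
    rcases hω with ⟨T, hT, h⟩ | ⟨i, T, hT, h⟩
    · refine Or.inl (Set.mem_biUnion (Finset.mem_coe.2 (Finset.mem_powerset.2 hT)) ?_)
      rw [Set.mem_ofPred_eq]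
      exact h
    · refine Or.inr (Set.mem_biUnion (Finset.mem_coe.2 (Finset.mem_univ i))
        (Set.mem_biUnion (Finset.mem_coe.2 (Finset.mem_powerset.2 hT)) ?_))
      rw [Set.mem_ofPred_eq]
      exact h
  -- Eight subsets each for the common messages and for the two private families give the constant
  -- `24`.
  have hc : ∀ i, (priv i).card = 3 := by decide
  have hc' : common.card = 3 := by decide
  refine (measureReal_mono hsub (measure_ne_top _ _)).trans ((measureReal_union_le _ _).trans ?_)
  refine (add_le_add (measureReal_biUnion_le_card_mul _ _ _ (e := v / (n * δ ^ 2)) fun T hT => ?_)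
    (measureReal_biUnion_le_card_mul _ _ _ (e := 8 * (v / (n * δ ^ 2))) fun i _ =>
      (measureReal_biUnion_le_card_mul _ _ _ (e := v / (n * δ ^ 2))
        fun T hT => ?_).trans_eq ?_)).trans_eq ?_
  · exact pi_prod_gt_le
      (fun t => (P t).hasMeanSurprisal_baseMass W (Finset.mem_powerset.1 hT)) (fun t => hv₀ t T)
      hn hδ (h₀ T (Finset.mem_powerset.1 hT))
  · exact pi_prod_gt_le
      (fun t => (P t).hasMeanSurprisal_sideMass W i (Finset.mem_powerset.1 hT))
      (fun t => hv₁ t T i) hn hδ (h₁ i T (Finset.mem_powerset.1 hT))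
  · rw [Finset.card_powerset, hc]
    norm_num
  · rw [Finset.card_powerset, hc', Finset.card_univ, Fintype.card_fin]
    norm_num
    ring

end BlockCode

/-! ### Sizes of the bins and of the message sets -/

section Sizes

/-- The number of bins for the exponent `a`. -/
def binSize (a : ℝ) : ℕ := ⌈(2 : ℝ) ^ a⌉₊

/-- The number of messages for the exponent `a`. -/
def msgSize (a : ℝ) : ℕ := max 1 ⌊(2 : ℝ) ^ a⌋₊

lemma le_binSize (a : ℝ) : (2 : ℝ) ^ a ≤ binSize a := Nat.le_ceil _

lemma binSize_pos (a : ℝ) : 0 < binSize a := Nat.ceil_pos.2 (Real.rpow_pos_of_pos two_pos a)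

lemma binSize_le {a : ℝ} (ha : 0 ≤ a) : (binSize a : ℝ) ≤ 2 ^ (a + 1) := by
  have h1 := Real.one_le_rpow one_le_two ha
  have h2 := Nat.ceil_lt_add_one (zero_le_one.trans h1)
  rw [Real.rpow_add_one two_ne_zero]
  unfold binSize
  linarith

lemma msgSize_pos (a : ℝ) : 0 < msgSize a := lt_of_lt_of_le one_pos (le_max_left _ _)

/-- Message sets must be non-empty, so for negative exponents the size exceeds `2 ^ a`, but then
there is nothing to transmit. -/
lemma msgSize_le_one_or (a : ℝ) : msgSize a = 1 ∨ (msgSize a : ℝ) ≤ 2 ^ a := by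
  rcases le_total ⌊(2 : ℝ) ^ a⌋₊ 1 with h | h
  · exact Or.inl (max_eq_left h)
  · right
    rw [msgSize, max_eq_right h]
    exact Nat.floor_le (Real.rpow_nonneg zero_le_two a)

lemma msgSize_le {a b : ℝ} (hab : a ≤ b) (hb : 0 ≤ b) : (msgSize a : ℝ) ≤ 2 ^ b := by
  rcases msgSize_le_one_or a with h | h
  · rw [h, Nat.cast_one]
    exact Real.one_le_rpow one_le_two hb
  · exact h.trans (Real.rpow_le_rpow_of_exponent_le one_le_two hab)

lemma le_logb_msgSize (a : ℝ) : a - 1 ≤ Real.logb 2 (msgSize a) := by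
  rw [Real.le_logb_iff_rpow_le one_lt_two (by exact_mod_cast msgSize_pos a),
    Real.rpow_sub_one two_ne_zero]
  have h1 := Nat.lt_floor_add_one ((2 : ℝ) ^ a)
  have h2 : ((1 : ℕ) : ℝ) ≤ msgSize a := Nat.cast_le.2 (le_max_left _ _)
  have h3 : (⌊(2 : ℝ) ^ a⌋₊ : ℝ) ≤ msgSize a := Nat.cast_le.2 (le_max_right _ _)
  push_cast at h2
  linarith

lemma sum_split_inter (T : Finset Msg) (f : Msg → ℝ) :
    ∑ s ∈ T, f s = ∑ s ∈ T ∩ common, f s + ∑ i, ∑ s ∈ T ∩ priv i, f s := by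
  -- The product formula, read additively.
  have h1 := prod_split (M := Multiplicative ℝ)
    fun s => Multiplicative.ofAdd (if s ∈ T then f s else 0)
  have h2 : ∑ s, (if s ∈ T then f s else 0) = ∑ s ∈ common, (if s ∈ T then f s else 0) +
    ∑ i, ∑ s ∈ priv i, (if s ∈ T then f s else 0) := h1
  simp only [Finset.sum_ite_mem, Finset.univ_inter] at h2
  rw [h2, Finset.inter_comm]
  simp only [Finset.inter_comm]

lemma card_msg_le (T : Finset Msg) : (T.card : ℝ) ≤ 9 := by
  exact_mod_cast T.card_le_univ.trans_eq (by decide)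

variable {ρ σ : Msg → ℝ} {x : ℝ}

/-- Each of at most nine components pays `2 * x` for the margin and `1` for rounding up. -/
lemma prod_binSize_le (hρ : ∀ s, 0 ≤ ρ s) (hx : 0 ≤ x) (T : Finset Msg) :
    ∏ s ∈ T, (binSize (ρ s + 2 * x) : ℝ) ≤ 2 ^ (∑ s ∈ T, ρ s + (18 * x + 9)) := by
  refine (Finset.prod_le_prod (fun s _ => Nat.cast_nonneg _) fun s _ =>
    binSize_le (by have := hρ s; positivity)).trans ?_
  rw [← Real.rpow_sum_of_pos two_pos]
  refine Real.rpow_le_rpow_of_exponent_le one_le_two ?_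
  simp only [add_assoc, Finset.sum_add_distrib, Finset.sum_const, nsmul_eq_mul]
  nlinarith [card_msg_le T]

lemma le_prod_binSize (hx : 0 ≤ x) {T : Finset Msg} (hT : T.Nonempty) :
    (2 : ℝ) ^ (∑ s ∈ T, ρ s + 2 * x) ≤ ∏ s ∈ T, (binSize (ρ s + 2 * x) : ℝ) := by
  refine le_trans ?_ (Finset.prod_le_prod (fun s _ => Real.rpow_nonneg zero_le_two _)
    fun s _ => le_binSize (ρ s + 2 * x))
  rw [← Real.rpow_sum_of_pos two_pos]
  refine Real.rpow_le_rpow_of_exponent_le one_le_two ?_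
  simp only [Finset.sum_add_distrib, Finset.sum_const, nsmul_eq_mul]
  have : (1 : ℝ) ≤ T.card := by exact_mod_cast hT.card_pos
  nlinarith

/-- One non-trivial message set already supplies the whole saving `29 * x`; the other factors are at
most `2 ^ σ s` because `σ s` is non-negative. If all message sets are trivial the bound can fail,
which is why the hashing bound leaves such `T` out. -/
lemma prod_msgSize_le (hσ : ∀ s, 0 ≤ σ s) (hx : 0 ≤ x) {T : Finset Msg}
    (hT : ∏ s ∈ T, msgSize (σ s - 29 * x) ≠ 1) :
    ∏ s ∈ T, (msgSize (σ s - 29 * x) : ℝ) ≤ 2 ^ (∑ s ∈ T, σ s - 29 * x) := by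
  obtain ⟨s₀, hs₀, h₀⟩ : ∃ s ∈ T, msgSize (σ s - 29 * x) ≠ 1 := by
    by_contra! h
    exact hT (Finset.prod_eq_one h)
  have h₀ := (msgSize_le_one_or _).resolve_left h₀
  rw [← Finset.mul_prod_erase T _ hs₀, ← Finset.add_sum_erase T _ hs₀, add_sub_right_comm,
    Real.rpow_add two_pos, Real.rpow_sum_of_pos two_pos]
  refine mul_le_mul h₀ ?_ (Finset.prod_nonneg fun s _ => Nat.cast_nonneg _)
    (Real.rpow_nonneg zero_le_two _)
  exact Finset.prod_le_prod (fun s _ => Nat.cast_nonneg _) fun s _ =>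
    msgSize_le (by linarith) (hσ s)

end Sizes

/-! ### Codes for blocks: matching the exponents -/

section BlockCode

variable {Z : Msg → Type} [∀ s, Fintype (Z s)] [∀ s, MeasurableSpace (Z s)]
  [∀ s, MeasurableSingletonClass (Z s)] [∀ s, Nonempty (Z s)] [∀ s, StandardBorelSpace (Z s)]
  {X Y : Fin 2 → Type*} [∀ i, MeasurableSpace (X i)] [∀ j, MeasurableSpace (Y j)] {n : ℕ}

/-- A good code for a block of letters. -/
theorem exists_block_crng (P : Fin n → Source Z X) (W : Kernel (∀ i, X i) (∀ j, Y j))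
    [IsMarkovKernel W] (hn : 0 < n) {δ v : ℝ} (hδ : 0 < δ) (hv : 0 ≤ v) {σ ρ : Msg → ℝ}
    (hσ : ∀ s, 0 ≤ σ s) (hρ : ∀ s, 0 ≤ ρ s)
    (h₀ : ∀ T ⊆ common, ∑ s ∈ T, (σ s + ρ s) ≤
      ∑ t, entropy ((P t).joint W) fun ω => T.restrict ω.1)
    (h₁ : ∀ i, ∀ T ⊆ priv i, ∑ s ∈ T, (σ s + ρ s) ≤ ∑ t, condEntropy ((P t).joint W)
      (fun ω => T.restrict ω.1) (fun ω => common.restrict ω.1))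
    (h₂ : ∀ j, ∀ T ⊆ decoded j, ∑ t, condEntropy ((P t).joint W)
      (fun ω => T.restrict ω.1) (fun ω => (ω.2 j, (decoded j \ T).restrict ω.1)) ≤ ∑ s ∈ T, ρ s)
    (hv₀ : ∀ t T, Var[fun ω => -Real.logb 2 ((P t).baseMass T ω.1); (P t).joint W] ≤ v)
    (hv₁ : ∀ t T i, Var[fun ω => -Real.logb 2 ((P t).sideMass i T ω.1); (P t).joint W] ≤ v)
    (hv₂ : ∀ t T j, Var[fun ω => -Real.logb 2 (((P t).decKernel W j T
        (ω.2 j, (decoded j \ T).restrict ω.1)).real {T.restrict ω.1}); (P t).joint W] ≤ v) :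
    ∃ G : CRNG (fun s => Fin n → Z s) (fun i => Fin n → X i)
        (fun s => msgSize (σ s - 29 * (n * δ))),
      G.errorProb (memoryless W n) ≤ ENNReal.ofReal (7 * (64 * (v / (n * δ ^ 2))) +
        2 ^ 8 * 2 ^ (-(n * δ)) + 3 * 2 ^ (9 - 4 * (n * δ))) := by
  classical
  set x : ℝ := n * δ with hx
  have hx0 : 0 ≤ x := by positivity
  have hp : ∀ a : ℝ, 0 ≤ (2 : ℝ) ^ a := fun a => Real.rpow_nonneg zero_le_two a
  -- A single `ε` has to serve both the encoders and the decoders.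
  have he : 24 * (v / (n * δ ^ 2)) ≤ 64 * (v / (n * δ ^ 2)) :=
    mul_le_mul_of_nonneg_right (by norm_num) (by positivity)
  set 𝒯 : Set (∀ s, Fin n → Z s) := {z |
      (∀ T ⊆ common, (Source.block P).baseMass T z ≤ 2 ^ (x - ∑ s ∈ T, (σ s + ρ s))) ∧
      ∀ i, ∀ T ⊆ priv i, (Source.block P).sideMass i T z ≤ 2 ^ (x - ∑ s ∈ T, (σ s + ρ s))} with h𝒯
  -- The slack per block is `x = n * δ`. In the hashing bound the bins cost `18 * x + 9`, the three
  -- mass bounds cost `3 * x` and the messages save `29 * x`, hence `Q = 2 ^ (9 - 8 * x)`; taking `t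
  -- = 2 ^ (9 - 4 * x)` makes `t ^ 2` equal to `2 ^ 9 * Q`.
  refine (Source.block P).exists_crng (memoryless W n)
    (L := fun s => binSize (ρ s + 2 * x)) (N := fun s => msgSize (σ s - 29 * x))
    (Q := 2 ^ (9 - 8 * x)) (𝒯 := 𝒯)
    (α₀ := fun T => 2 ^ (x - ∑ s ∈ T, (σ s + ρ s)))
    (α := fun _ T => 2 ^ (x - ∑ s ∈ T, (σ s + ρ s)))
    (B := fun j z => {y | ∀ T, ∀ hT : T ⊆ decoded j, 2 ^ (-x - ∑ s ∈ T, ρ s) ≤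
        blockDec P W j hT z y})
    (fun s => binSize_pos _) (fun s => msgSize_pos _) (hp _) (hp _)
    (Real.rpow_pos_of_pos two_pos _) ?_ ?_ ?_ (fun T => hp _) (fun i T => hp _) ?_ ?_ ?_ ?_ ?_
  · rw [← Real.rpow_natCast, ← Real.rpow_natCast, ← Real.rpow_mul zero_le_two,
      ← Real.rpow_add two_pos]
    refine Real.rpow_le_rpow_of_exponent_le one_le_two ?_
    push_cast
    linarith
  · rw [Source.sum_prob_notMem _ (memoryless W n)]
    exact (block_enc_typical P W hn hδ h₀ h₁ hv₀ hv₁).trans he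
  · exact ⟨fun T hT z hz => hz.1 T hT, fun i T hT z hz => hz.2 i T hT⟩
  · intro T hT
    have e1 := prod_binSize_le hρ hx0 T
    have e2 := prod_msgSize_le hσ hx0 hT
    have e3 := sum_split_inter T fun s => σ s + ρ s
    have e4 : ∑ s ∈ T ∩ common, σ s ≤ ∑ s ∈ T, σ s :=
      Finset.sum_le_sum_of_subset_of_nonneg Finset.inter_subset_left fun s _ _ => hσ s
    rw [Finset.sum_add_distrib, Fin.sum_univ_two] at e3
    rw [Fin.prod_univ_two]
    refine (mul_le_mul_of_nonneg_right (mul_le_mul e1 e2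
      (Finset.prod_nonneg fun s _ => Nat.cast_nonneg _) (hp _))
      (mul_nonneg (hp _) (mul_nonneg (hp _) (hp _)))).trans ?_
    rw [← Real.rpow_add two_pos, ← Real.rpow_add two_pos, ← Real.rpow_add two_pos,
      ← Real.rpow_add two_pos]
    refine Real.rpow_le_rpow_of_exponent_le one_le_two ?_
    linarith
  · intro i T _ hT
    have e1 := prod_binSize_le hρ hx0 T
    have e2 := prod_msgSize_le hσ hx0 hT
    refine (mul_le_mul_of_nonneg_right (mul_le_mul e1 e2
      (Finset.prod_nonneg fun s _ => Nat.cast_nonneg _) (hp _)) (hp _)).trans ?_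
    rw [← Real.rpow_add two_pos, ← Real.rpow_add two_pos]
    refine Real.rpow_le_rpow_of_exponent_le one_le_two ?_
    rw [Finset.sum_add_distrib]
    linarith
  · intro j z
    simp only [Set.ofPred_forall]
    exact MeasurableSet.iInter fun T => MeasurableSet.iInter fun hT =>
      measurableSet_le measurable_const (measurable_blockDec P W j hT z)
  · intro j
    exact block_dec_typical P W j hn hδ (h₂ j) fun t T => hv₂ t T j
  -- There are at most `2 ^ (x + ∑ ρ)` typical candidates and at least `2 ^ (2 * x + ∑ ρ)` bins,
  -- which gives `θ = 2 ^ (-x)`.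
  · intro j y z T hT hne S hS
    have e2 := le_prod_binSize (ρ := ρ) hx0 hne
    have e3 : (2 : ℝ) ^ (-x - ∑ s ∈ T, ρ s) * 2 ^ (x + ∑ s ∈ T, ρ s) = 1 := by
      rw [← Real.rpow_add two_pos]
      simp
    have e4 : (2 : ℝ) ^ (x + ∑ s ∈ T, ρ s) = 2 ^ (-x) * 2 ^ (∑ s ∈ T, ρ s + 2 * x) := by
      rw [← Real.rpow_add two_pos]
      congr 1
      ring
    refine le_trans ?_ (mul_le_mul_of_nonneg_left e2 (hp _))
    rw [← e4, ← mul_le_mul_iff_of_pos_right (Real.rpow_pos_of_pos two_pos (-x - ∑ s ∈ T, ρ s)),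
      mul_comm (2 ^ (x + ∑ s ∈ T, ρ s)), e3]
    exact card_mul_le_of_le_blockDec P W j hT z y _ S fun z' hz' =>
      ⟨(hS z' hz').1, (hS z' hz').2 T hT⟩

/-- Good codes for all blocks of letters drawn from a finite collection of laws. -/
theorem exists_block_crng_uniform {ι : Type*} [Finite ι] (P : ι → Source Z X)
    (W : Kernel (∀ i, X i) (∀ j, Y j)) [IsMarkovKernel W] {R r : ι → Msg → ℝ}
    (hR : ∀ a s, 0 ≤ R a s) (hr : ∀ a s, 0 ≤ r a s)
    (h₀ : ∀ a, ∀ T ⊆ common, ∑ s ∈ T, (R a s + r a s) ≤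
      entropy ((P a).joint W) fun ω => T.restrict ω.1)
    (h₁ : ∀ a i, ∀ T ⊆ priv i, ∑ s ∈ T, (R a s + r a s) ≤ condEntropy ((P a).joint W)
      (fun ω => T.restrict ω.1) (fun ω => common.restrict ω.1))
    (h₂ : ∀ a j, ∀ T ⊆ decoded j, condEntropy ((P a).joint W)
      (fun ω => T.restrict ω.1) (fun ω => (ω.2 j, (decoded j \ T).restrict ω.1)) ≤
        ∑ s ∈ T, r a s) {δ : ℝ} (hδ : 0 < δ) :
    ∃ η : ℕ → ℝ, Tendsto η atTop (𝓝 0) ∧ ∀ n, 0 < n → ∀ q : Fin n → ι,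
      ∃ (N : Msg → ℕ) (G : CRNG (fun s => Fin n → Z s) (fun i => Fin n → X i) N),
        (∀ s, 0 < N s) ∧ (∀ s, ∑ t, R (q t) s - 29 * (n * δ) - 1 ≤ Real.logb 2 (N s)) ∧
        G.errorProb (memoryless W n) ≤ ENNReal.ofReal (η n) := by
  obtain ⟨v, hv, hvar⟩ := exists_variance_le P W
  refine ⟨fun n => 7 * (64 * (v / (n * δ ^ 2))) + 2 ^ 8 * 2 ^ (-(n * δ)) +
    3 * 2 ^ (9 - 4 * (n * δ)), ?_, fun n hn q => ?_⟩
  · have hn : Tendsto (fun n : ℕ => (n : ℝ)) atTop atTop := tendsto_natCast_atTop_atTop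
    have hexp : Tendsto (fun y : ℝ => (2 : ℝ) ^ y) atBot (𝓝 0) :=
      tendsto_rpow_atBot_of_base_gt_one 2 one_lt_two
    have t1 : Tendsto (fun n : ℕ => v / (n * δ ^ 2)) atTop (𝓝 0) :=
      tendsto_const_nhds.div_atTop (hn.atTop_mul_const (by positivity))
    have t2 : Tendsto (fun n : ℕ => (2 : ℝ) ^ (-(n * δ))) atTop (𝓝 0) :=
      hexp.comp (tendsto_neg_atTop_atBot.comp (hn.atTop_mul_const hδ))
    have t3 : Tendsto (fun n : ℕ => (2 : ℝ) ^ (9 - 4 * (n * δ))) atTop (𝓝 0) := by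
      refine hexp.comp (tendsto_atBot_add_const_left _ 9 ?_)
      exact tendsto_neg_atTop_atBot.comp ((hn.atTop_mul_const hδ).const_mul_atTop four_pos)
    simpa using ((t1.const_mul 64).const_mul 7).add (t2.const_mul (2 ^ 8)) |>.add (t3.const_mul 3)
  · have hsum : ∀ T : Finset Msg, ∑ s ∈ T, (∑ t, R (q t) s + ∑ t, r (q t) s) =
        ∑ t, ∑ s ∈ T, (R (q t) s + r (q t) s) := by
      intro T
      rw [Finset.sum_comm]
      simp only [Finset.sum_add_distrib]
    obtain ⟨G, hG⟩ := exists_block_crng (fun t => P (q t)) W hn hδ hv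
      (σ := fun s => ∑ t, R (q t) s) (ρ := fun s => ∑ t, r (q t) s)
      (fun s => Finset.sum_nonneg fun t _ => hR _ s) (fun s => Finset.sum_nonneg fun t _ => hr _ s)
      (fun T hT => (hsum T).trans_le (Finset.sum_le_sum fun t _ => h₀ _ T hT))
      (fun i T hT => (hsum T).trans_le (Finset.sum_le_sum fun t _ => h₁ _ i T hT))
      (fun j T hT => (Finset.sum_le_sum fun t _ => h₂ _ j T hT).trans_eq Finset.sum_comm)
      (fun t T => (hvar (q t) T).1) (fun t T => (hvar (q t) T).2.1)
      (fun t T => (hvar (q t) T).2.2)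
    exact ⟨_, G, fun s => msgSize_pos _, fun s => le_logb_msgSize _, hG⟩

end BlockCode

/-! ### Enlarging the auxiliary alphabets -/

section Embed

/-- Surprisal is unchanged by injective renaming. The left inverse `c` of `b` writes the conditional
law as a kernel on the enlarged space without any assumption on the range of `b`. -/
lemma condEntropy_map {Ω Ω' α α' β β' : Type*} [MeasurableSpace Ω] [MeasurableSpace Ω']
    [Fintype α] [MeasurableSpace α] [MeasurableSingletonClass α] [Nonempty α]
    [StandardBorelSpace α] [Fintype α'] [MeasurableSpace α'] [MeasurableSingletonClass α']
    [Nonempty α'] [StandardBorelSpace α'] [MeasurableSpace β] [MeasurableSpace β']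
    (μ : Measure Ω) [IsProbabilityMeasure μ] (μ' : Measure Ω') [IsProbabilityMeasure μ']
    {E : Ω → Ω'} (hE : Measurable E) (hμ : μ' = μ.map E) {A : Ω → α} {B : Ω → β}
    (hA : Measurable A) (hB : Measurable B) {A' : Ω' → α'} {B' : Ω' → β'}
    (hA' : Measurable A') (hB' : Measurable B') {a : α → α'} (ha : Function.Injective a)
    {b : β → β'} {c : β' → β} (hb : Measurable b) (hc : Measurable c)
    (hcb : Function.LeftInverse c b) (hAE : ∀ ω, A' (E ω) = a (A ω))
    (hBE : ∀ ω, B' (E ω) = b (B ω)) :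
    condEntropy μ' A' B' = condEntropy μ A B := by
  have ham : Measurable a := measurable_of_finite a
  set κ := condDistrib A B μ with hκ
  have hκμ : μ.map (fun ω => (B ω, A ω)) = μ.map B ⊗ₘ κ :=
    (compProd_map_condDistrib hA.aemeasurable).symm
  have : IsMarkovKernel ((κ.comap c hc).map a) := Kernel.IsMarkovKernel.map _ ham
  have : IsProbabilityMeasure (μ.map B) := Measure.isProbabilityMeasure_map hB.aemeasurable
  have h1 : μ'.map B' = (μ.map B).map b := by
    rw [hμ, Measure.map_map hB' hE, Measure.map_map hb hB]
    exact congrArg (fun f => μ.map f) (funext hBE)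
  have h2 : μ'.map (fun ω => (B' ω, A' ω)) = μ'.map B' ⊗ₘ (κ.comap c hc).map a := by
    have h3 : μ'.map (fun ω => (B' ω, A' ω)) =
        (μ.map fun ω => (B ω, A ω)).map (Prod.map b a) := by
      rw [hμ, Measure.map_map (hB'.prodMk hA') hE, Measure.map_map (hb.prodMap ham) (hB.prodMk hA)]
      refine congrArg (fun f => μ.map f) (funext fun ω => ?_)
      simp [hAE, hBE]
    have : IsProbabilityMeasure ((μ.map B).map b) := Measure.isProbabilityMeasure_map hb.aemeasurable
    rw [h3, hκμ, h1]
    ext S hS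
    rw [Measure.map_apply (hb.prodMap ham) hS, Measure.compProd_apply hS,
      Measure.compProd_apply ((hb.prodMap ham) hS),
      lintegral_map (Kernel.measurable_kernel_prodMk_left hS) hb]
    refine lintegral_congr fun y => ?_
    rw [Kernel.map_apply' _ ham _ (measurable_prodMk_left hS), Kernel.comap_apply, hcb]
    rfl
  have hm : Measurable fun ω => surprisal ((κ.comap c hc).map a) (B' ω, A' ω) :=
    (measurable_surprisal _).comp (hB'.prodMk hA')
  rw [condEntropy_eq_integral_surprisal hA' hB' h2, condEntropy_eq_integral_surprisal hA hB hκμ, hμ,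
    integral_map hE.aemeasurable hm.aestronglyMeasurable]
  refine integral_congr_ae (Eventually.of_forall fun ω => ?_)
  simp only [surprisal, hAE, hBE]
  rw [Kernel.map_apply _ ham, map_measureReal_apply ham (MeasurableSet.singleton _),
    Kernel.comap_apply, hcb, ← Set.image_singleton, Set.preimage_image_eq _ ha]

/-- Letters outside the range of `a` have mass zero and contribute nothing. -/
lemma entropy_map {Ω Ω' α α' : Type*} [MeasurableSpace Ω] [MeasurableSpace Ω']
    [Fintype α] [MeasurableSpace α] [MeasurableSingletonClass α]
    [Fintype α'] [MeasurableSpace α'] [MeasurableSingletonClass α']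
    (μ : Measure Ω) (μ' : Measure Ω') {E : Ω → Ω'} (hE : Measurable E) (hμ : μ' = μ.map E)
    {A : Ω → α} (hA : Measurable A) {A' : Ω' → α'} (hA' : Measurable A') {a : α → α'}
    (ha : Function.Injective a) (hAE : ∀ ω, A' (E ω) = a (A ω)) :
    entropy μ' A' = entropy μ A := by
  have ham : Measurable a := measurable_of_finite a
  have h1 : μ'.map A' = (μ.map A).map a := by
    rw [hμ, Measure.map_map hA' hE, Measure.map_map ham hA]
    exact congrArg (fun f => μ.map f) (funext hAE)
  rw [entropy, entropy, h1]
  refine (Fintype.sum_of_injective a ha _ _ (fun x hx => ?_) fun x => ?_).symm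
  · rw [map_measureReal_apply ham (MeasurableSet.singleton _)]
    have : a ⁻¹' {x} = ∅ := by
      ext y
      simpa using fun h => hx ⟨y, h⟩
    simp [this]
  · rw [map_measureReal_apply ham (MeasurableSet.singleton _), ← Set.image_singleton,
      Set.preimage_image_eq _ ha]

variable {Z Z' : Msg → Type} [∀ s, Fintype (Z s)] [∀ s, MeasurableSpace (Z s)]
  [∀ s, MeasurableSingletonClass (Z s)] [∀ s, Fintype (Z' s)] [∀ s, MeasurableSpace (Z' s)]
  [∀ s, MeasurableSingletonClass (Z' s)]
  {X Y : Fin 2 → Type*} [∀ i, MeasurableSpace (X i)] [∀ j, MeasurableSpace (Y j)]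

/-- Applies functions to the components of a tuple. -/
def tupleMap (e : ∀ s, Z s → Z' s) (T : Finset Msg) (z : Tuple Z T) : Tuple Z' T :=
  fun s => e s (z s)

lemma tupleMap_injective {e : ∀ s, Z s → Z' s} (he : ∀ s, Function.Injective (e s))
    (T : Finset Msg) : Function.Injective (tupleMap e T) :=
  fun _ _ h => funext fun s => he s (congrFun h s)

lemma tupleMap_leftInverse {e : ∀ s, Z s → Z' s} {ℓ : ∀ s, Z' s → Z s}
    (h : ∀ s, Function.LeftInverse (ℓ s) (e s)) (T : Finset Msg) :
    Function.LeftInverse (tupleMap ℓ T) (tupleMap e T) :=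
  fun _ => funext fun s => h s _

/-- The source with the letters renamed by `e`; the function `ℓ` reads the old names. -/
def Source.embed (P : Source Z X) (e : ∀ s, Z s → Z' s) (ℓ : ∀ s, Z' s → Z s) : Source Z' X where
  base := P.base.map (tupleMap e common)
  side i := ((P.side i).comap (tupleMap ℓ common) (measurable_of_finite _)).map (tupleMap e (priv i))
  input i := (P.input i).comap (Prod.map (tupleMap ℓ common) (tupleMap ℓ (priv i)))
    (measurable_of_finite _)
  base_prob := Measure.isProbabilityMeasure_map (measurable_of_finite _).aemeasurable
  side_markov _ := Kernel.IsMarkovKernel.map _ (measurable_of_finite _)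
  input_markov _ := inferInstance

lemma map_tupleMap_singleton {e : ∀ s, Z s → Z' s} (he : ∀ s, Function.Injective (e s))
    {T : Finset Msg} (μ : Measure (Tuple Z T)) (z : Tuple Z T) :
    μ.map (tupleMap e T) {tupleMap e T z} = μ {z} := by
  rw [Measure.map_apply (measurable_of_finite _) (MeasurableSet.singleton _),
    ← Set.image_singleton, Set.preimage_image_eq _ (tupleMap_injective he T)]

lemma map_tupleMap_singleton_eq_zero {e : ∀ s, Z s → Z' s} {T : Finset Msg}
    (μ : Measure (Tuple Z T)) {z' : Tuple Z' T} {s : T} (hs : z' s ∉ Set.range (e s)) :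
    μ.map (tupleMap e T) {z'} = 0 := by
  rw [Measure.map_apply (measurable_of_finite _) (MeasurableSet.singleton _)]
  have : tupleMap e T ⁻¹' {z'} = ∅ := by
    ext y
    simp only [Set.mem_preimage, Set.mem_singleton_iff, Set.mem_empty_iff_false, iff_false]
    exact fun h => hs ⟨y s, congrFun h s⟩
  simp [this]

/-- A family with some entry outside the range of `e` has weight zero; on the range, `ℓ` recovers
the old letters, so weights and output laws are unchanged. -/
lemma Source.embed_joint (P : Source Z X) {e : ∀ s, Z s → Z' s} {ℓ : ∀ s, Z' s → Z s}
    (h : ∀ s, Function.LeftInverse (ℓ s) (e s)) (V : Kernel (∀ i, X i) (∀ j, Y j))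
    [IsMarkovKernel V] :
    (P.embed e ℓ).joint V = (P.joint V).map fun ω => (fun s => e s (ω.1 s), ω.2) := by
  have hm : Measurable fun ω : (∀ s, Z s) × (∀ j, Y j) => ((fun s => e s (ω.1 s) : ∀ s, Z' s), ω.2) :=
    (measurable_of_fst fun (z : ∀ s, Z s) s => e s (z s)).prodMk measurable_snd
  have he : ∀ s, Function.Injective (e s) := fun s => (h s).injective
  have hinj : Function.Injective fun (z : ∀ s, Z s) s => e s (z s) :=
    fun _ _ h => funext fun s => he s (congrFun h s)
  ext S hS
  rw [Measure.map_apply hm hS, Source.joint_apply _ _ hS, Source.joint_apply _ _ (hm hS)]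
  refine (Fintype.sum_of_injective _ hinj _ _ (fun z' hz' => ?_) fun z => ?_).symm
  · obtain ⟨s, hs⟩ : ∃ s, z' s ∉ Set.range (e s) := by
      by_contra! hcon
      choose z hz using hcon
      exact hz' ⟨z, funext hz⟩
    have hw : (P.embed e ℓ).weight z' = 0 := by
      rcases mem_parts s with hs' | ⟨i, hs'⟩
      · rw [Source.weight, show (P.embed e ℓ).base {common.restrict z'} = 0 from
          map_tupleMap_singleton_eq_zero (e := e) P.base (s := ⟨s, hs'⟩) hs, zero_mul]
      · refine mul_eq_zero_of_right _ (Finset.prod_eq_zero (Finset.mem_univ i) ?_)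
        simp only [Source.embed]
        rw [Kernel.map_apply _ (measurable_of_finite _)]
        exact map_tupleMap_singleton_eq_zero (e := e) _ (s := ⟨s, hs'⟩) hs
    rw [hw, zero_mul]
  · have hr : ∀ T : Finset Msg, tupleMap ℓ T (T.restrict fun s => e s (z s)) = T.restrict z :=
      fun T => funext fun s => h s (z s)
    have hw : (P.embed e ℓ).weight (fun s => e s (z s)) = P.weight z := by
      refine congrArg₂ (· * ·) (map_tupleMap_singleton he P.base (common.restrict z))
        (Finset.prod_congr rfl fun i _ => ?_)
      simp only [Source.embed]
      rw [Kernel.map_apply _ (measurable_of_finite _), Kernel.comap_apply, hr]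
      exact map_tupleMap_singleton he _ ((priv i).restrict z)
    have ho : (P.embed e ℓ).out V (fun s => e s (z s)) = P.out V z := by
      unfold Source.out Source.inputs
      simp only [Source.embed, Kernel.comap_apply, Prod.map_apply, hr]
    rw [hw, ho]
    rfl

end Embed

/-! ### The rate region and the size of the auxiliary alphabets -/

section Region

variable {X Y : Fin 2 → Type*} [∀ i, MeasurableSpace (X i)] [∀ j, MeasurableSpace (Y j)]

/-- Larger auxiliary alphabets allow at least as many rate vectors. -/
lemma regionOf_mono_alphabet (W : Kernel (∀ i, X i) (∀ j, Y j)) [IsMarkovKernel W]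
    {k K : Msg → ℕ} (hkK : ∀ s, k s ≤ K s) (P : Source (fun s => Fin (k s + 1)) X) {R : Msg → ℝ}
    (hR : R ∈ regionOf W P) : ∃ P' : Source (fun s => Fin (K s + 1)) X, R ∈ regionOf W P' := by
  let e : ∀ s, Fin (k s + 1) → Fin (K s + 1) := fun s => Fin.castLE (Nat.succ_le_succ (hkK s))
  let ℓ : ∀ s, Fin (K s + 1) → Fin (k s + 1) := fun s => Function.invFun (e s)
  have h : ∀ s, Function.LeftInverse (ℓ s) (e s) := fun s =>
    Function.leftInverse_invFun (Fin.castLE_injective _)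
  have he : ∀ s, Function.Injective (e s) := fun s => (h s).injective
  have hE : Measurable fun ω : (∀ s, Fin (k s + 1)) × (∀ j, Y j) =>
      ((fun s => e s (ω.1 s) : ∀ s, Fin (K s + 1)), ω.2) :=
    (measurable_of_fst fun (z : ∀ s, Fin (k s + 1)) s => e s (z s)).prodMk measurable_snd
  have hJ := P.embed_joint h W
  have hr : ∀ T : Finset Msg, Measurable fun ω : (∀ s, Fin (k s + 1)) × (∀ j, Y j) =>
    T.restrict ω.1 := fun T => measurable_of_fst (T.restrict : (∀ s, Fin (k s + 1)) → _)
  have hr' : ∀ T : Finset Msg, Measurable fun ω : (∀ s, Fin (K s + 1)) × (∀ j, Y j) =>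
    T.restrict ω.1 := fun T => measurable_of_fst (T.restrict : (∀ s, Fin (K s + 1)) → _)
  obtain ⟨h0, r, hr0, h1, h2, h3⟩ := hR
  refine ⟨P.embed e ℓ, h0, r, hr0, fun T hT => ?_, fun i T hT => ?_, fun j T hT => ?_⟩
  · refine (h1 T hT).trans_eq (Eq.symm ?_)
    exact entropy_map _ _ hE hJ (hr T) (hr' T) (tupleMap_injective he T) fun ω => rfl
  · refine (h2 i T hT).trans_eq (Eq.symm ?_)
    exact condEntropy_map _ _ hE hJ (hr T) (hr common) (hr' T) (hr' common)
      (tupleMap_injective he T) (measurable_of_finite _) (measurable_of_finite _)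
      (tupleMap_leftInverse h common) (fun ω => rfl) fun ω => rfl
  · refine le_of_eq_of_le ?_ (h3 j T hT)
    refine condEntropy_map _ _ hE hJ (hr T) ?_ (hr' T) ?_
      (tupleMap_injective he T) (b := Prod.map id (tupleMap e _)) (c := Prod.map id (tupleMap ℓ _))
      (measurable_id.prodMap (measurable_of_finite _))
      (measurable_id.prodMap (measurable_of_finite _))
      (fun p => Prod.ext rfl (tupleMap_leftInverse h _ p.2)) (fun ω => rfl) fun ω => rfl
    · exact ((measurable_pi_apply j).comp measurable_snd).prodMk (hr _)
    · exact ((measurable_pi_apply j).comp measurable_snd).prodMk (hr' _)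

end Region

/-! ### Time sharing, closure, and the sequence of codes -/

section Main

variable {X Y : Fin 2 → Type*} [∀ i, MeasurableSpace (X i)] [∀ j, MeasurableSpace (Y j)]

/-- A finite sequence in which every element has at least its share of the positions. -/
lemma exists_seq_sum_ge {ι : Type*} [Fintype ι] [Nonempty ι] {w : ι → ℝ} (hw : ∀ a, 0 ≤ w a)
    (hw1 : ∑ a, w a = 1) (n : ℕ) : ∃ q : Fin n → ι, ∀ f : ι → ℝ, (∀ a, 0 ≤ f a) →
      n * ∑ a, w a * f a - ∑ a, f a ≤ ∑ t, f (q t) := by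
  -- Each `a` gets `⌊n * w a⌋₊` reserved positions, and the leftover ones go to an arbitrary
  -- element. Rounding loses at most one position per element, and surplus positions do no harm as
  -- `f` is non-negative.
  have hcard : Fintype.card (Σ a, Fin ⌊n * w a⌋₊) ≤ Fintype.card (Fin n) := by
    simp only [Fintype.card_sigma, Fintype.card_fin]
    rw [← Nat.cast_le (α := ℝ), Nat.cast_sum]
    calc ∑ a, (⌊n * w a⌋₊ : ℝ) ≤ ∑ a, n * w a :=
          Finset.sum_le_sum fun a _ => Nat.floor_le (mul_nonneg n.cast_nonneg (hw a))
      _ = n := by rw [← Finset.mul_sum, hw1, mul_one]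
  obtain ⟨e⟩ := Function.Embedding.nonempty_of_card_le hcard
  obtain ⟨a₀⟩ := ‹Nonempty ι›
  refine ⟨Function.extend e Sigma.fst fun _ => a₀, fun f hf => ?_⟩
  calc n * ∑ a, w a * f a - ∑ a, f a = ∑ a, (n * w a - 1) * f a := by
        rw [Finset.mul_sum, ← Finset.sum_sub_distrib]
        exact Finset.sum_congr rfl fun a _ => by ring
    _ ≤ ∑ a, (⌊n * w a⌋₊ : ℝ) * f a := Finset.sum_le_sum fun a _ =>
        mul_le_mul_of_nonneg_right (Nat.sub_one_lt_floor _).le (hf a)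
    _ = ∑ p : (Σ a, Fin ⌊n * w a⌋₊), f p.1 := by
        rw [Fintype.sum_sigma]
        simp
    _ = ∑ p, f (Function.extend e Sigma.fst (fun _ => a₀) (e p)) :=
        Finset.sum_congr rfl fun p _ => by rw [e.injective.extend_apply]
    _ = ∑ t ∈ Finset.univ.map e, f (Function.extend e Sigma.fst (fun _ => a₀) t) := by
        rw [Finset.sum_map]
    _ ≤ _ := Finset.sum_le_sum_of_subset_of_nonneg (Finset.subset_univ _) fun t _ _ => hf _

/-- There is a code of length `n` whose rates are at least `R - δ` and whose error probability is
at most `δ`. -/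
def HasCode (W : Kernel (∀ i, X i) (∀ j, Y j)) [IsMarkovKernel W] (R : Msg → ℝ) (δ : ℝ)
    (n : ℕ) : Prop :=
  ∃ (N k : Msg → ℕ) (G : CRNG (fun s => Fin n → Fin (k s + 1)) (fun i => Fin n → X i) N),
    (∀ s, 0 < N s) ∧ (∀ s, R s - δ ≤ Real.logb 2 (N s) / n) ∧
    G.errorProb (memoryless W n) ≤ ENNReal.ofReal δ

/-- Time sharing: the positions of the block are divided among the laws in proportion to the
weights, and one code is built for the resulting non-stationary source. -/
lemma eventually_hasCode_of_mem_convexHull (W : Kernel (∀ i, X i) (∀ j, Y j)) [IsMarkovKernel W]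
    {R : Msg → ℝ} (hR : R ∈ convexHull ℝ
      (⋃ (k : Msg → ℕ) (P : Source (fun s => Fin (k s + 1)) X), regionOf W P))
    {δ : ℝ} (hδ : 0 < δ) : ∀ᶠ n in atTop, HasCode W R δ n := by
  obtain ⟨ι, _, w, z, hw, hw1, hz, rfl⟩ := mem_convexHull_iff_exists_fintype.1 hR
  have : Nonempty ι := by
    by_contra h
    rw [not_nonempty_iff] at h
    simp at hw1
  simp only [Set.mem_iUnion] at hz
  choose k P hP using hz
  -- The alphabets must not depend on the position, so all laws are moved to one large alphabet.
  have hex : ∀ a, ∃ P' : Source (fun s => Fin (∑ a, k a s + 1)) X, z a ∈ regionOf W P' := fun a =>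
    regionOf_mono_alphabet W (fun s => Finset.single_le_sum (f := fun a => k a s)
      (fun _ _ => Nat.zero_le _) (Finset.mem_univ a)) (P a) (hP a)
  choose P' hP' using hex
  choose hR0 r hr h₀ h₁ h₂ using hP'
  -- The rate loss `29 * (δ / 58)` is half of `δ`; the other half pays for rounding.
  obtain ⟨η, hη, hcode⟩ := exists_block_crng_uniform P' W hR0 hr h₀ h₁ h₂
    (show 0 < δ / 58 by positivity)
  have hev : ∀ s, ∀ᶠ n : ℕ in atTop, (∑ a, z a s + 1) / n ≤ δ / 2 := fun s =>
    (tendsto_const_div_atTop_nhds_zero_nat _).eventually_le_const (half_pos hδ)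
  filter_upwards [hη.eventually_le_const hδ, eventually_gt_atTop 0, eventually_all.2 hev]
    with n hn hn0 hns
  obtain ⟨q, hq⟩ := exists_seq_sum_ge hw hw1 n
  obtain ⟨N, G, hN, hNR, hG⟩ := hcode n hn0 q
  refine ⟨N, _, G, hN, fun s => ?_, hG.trans (ENNReal.ofReal_le_ofReal hn)⟩
  have hn' : (0 : ℝ) < n := by exact_mod_cast hn0
  have h1 := hq (fun a => z a s) fun a => hR0 a s
  have h2 := hNR s
  have h3 := hns s
  rw [div_le_iff₀ hn'] at h3
  rw [le_div_iff₀ hn', Finset.sum_apply]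
  simp only [Pi.smul_apply, smul_eq_mul]
  linarith

lemma eventually_hasCode (W : Kernel (∀ i, X i) (∀ j, Y j)) [IsMarkovKernel W]
    {R : Msg → ℝ} (hR : R ∈ region W) {δ : ℝ} (hδ : 0 < δ) : ∀ᶠ n in atTop, HasCode W R δ n := by
  obtain ⟨R', hR', hd⟩ := Metric.mem_closure_iff.1 hR (δ / 2) (half_pos hδ)
  filter_upwards [eventually_hasCode_of_mem_convexHull W hR' (half_pos hδ)] with n hn
  obtain ⟨N, k, G, hN, hNR, hG⟩ := hn
  refine ⟨N, k, G, hN, fun s => ?_, hG.trans (ENNReal.ofReal_le_ofReal (by linarith))⟩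
  have h1 := (dist_le_pi_dist R R' s).trans hd.le
  rw [Real.dist_eq] at h1
  linarith [le_abs_self (R s - R' s), hNR s]

/-- A source exists as soon as the region is not empty. -/
lemma nonempty_source_of_mem_region (W : Kernel (∀ i, X i) (∀ j, Y j)) [IsMarkovKernel W]
    {R : Msg → ℝ} (hR : R ∈ region W) :
    ∃ k : Msg → ℕ, Nonempty (Source (fun s => Fin (k s + 1)) X) := by
  obtain ⟨R', hR'⟩ := closure_nonempty_iff.1 ⟨R, hR⟩
  obtain ⟨R'', hR''⟩ := convexHull_nonempty_iff.1 ⟨R', hR'⟩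
  simp only [Set.mem_iUnion] at hR''
  obtain ⟨k, P, _⟩ := hR''
  exact ⟨k, ⟨P⟩⟩

/-- Diagonal choice: the largest `m ≤ n` for which `p m n` holds. It is meaningful as soon as `p 0
n` holds. -/
lemma exists_tendsto_atTop_of_eventually {p : ℕ → ℕ → Prop} (h : ∀ m, ∀ᶠ n in atTop, p m n) :
    ∃ m : ℕ → ℕ, Tendsto m atTop atTop ∧ ∀ᶠ n in atTop, p (m n) n := by
  classical
  refine ⟨fun n => Nat.findGreatest (p · n) n, tendsto_atTop.2 fun M => ?_, ?_⟩
  · filter_upwards [h M, eventually_ge_atTop M] with n hn hMn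
    exact Nat.le_findGreatest hMn hn
  · filter_upwards [h 0] with n hn
    exact Nat.findGreatest_spec (P := (p · n)) (Nat.zero_le n) hn

theorem crngAchievable_of_mem_region (W : Kernel (∀ i, X i) (∀ j, Y j)) [IsMarkovKernel W]
    {R : Msg → ℝ} (hR : R ∈ region W) : CRNGAchievable W R := by
  obtain ⟨k₀, ⟨P₀⟩⟩ := nonempty_source_of_mem_region W hR
  obtain ⟨m, hm, hcode⟩ := exists_tendsto_atTop_of_eventually
    (p := fun m n => HasCode W R (1 / ((m : ℝ) + 1)) n)
    fun m => eventually_hasCode W hR (by positivity)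
  have hδ : Tendsto (fun n => 1 / ((m n : ℝ) + 1)) atTop (𝓝 0) :=
    tendsto_one_div_add_atTop_nhds_zero_nat.comp hm
  have hall : ∀ n, ∃ (N k : Msg → ℕ)
      (G : CRNG (fun s => Fin n → Fin (k s + 1)) (fun i => Fin n → X i) N), (∀ s, 0 < N s) ∧
      (HasCode W R (1 / ((m n : ℝ) + 1)) n →
        (∀ s, R s - 1 / ((m n : ℝ) + 1) ≤ Real.logb 2 (N s) / n) ∧
        G.errorProb (memoryless W n) ≤ ENNReal.ofReal (1 / ((m n : ℝ) + 1))) := by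
    intro n
    by_cases h : HasCode W R (1 / ((m n : ℝ) + 1)) n
    · obtain ⟨N, k, G, hN, hNR, hG⟩ := h
      exact ⟨N, k, G, hN, fun _ => ⟨hNR, hG⟩⟩
    -- Lengths without a good code get a dummy with one message; building it needs some source,
    -- which the non-empty region provides.
    · exact ⟨fun _ => 1, k₀, ⟨Source.block fun _ => P₀, fun _ => 1, fun _ _ => 0, fun _ _ => 0,
        fun _ => 0⟩, fun _ => one_pos, fun h' => absurd h' h⟩
  choose N k G hN hG using hall
  choose τ K hτ hK using fun n => (G n).exists_implements (memoryless W n) (hN n)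
  have hGlim : Tendsto (fun n => (G n).errorProb (memoryless W n)) atTop (𝓝 0) := by
    refine tendsto_of_tendsto_of_tendsto_of_le_of_le' tendsto_const_nhds
      (h := fun n => ENNReal.ofReal (1 / ((m n : ℝ) + 1))) ?_
      (Eventually.of_forall fun n => zero_le) ?_
    · simpa using ENNReal.tendsto_ofReal hδ
    · filter_upwards [hcode] with n hn using (hG n hn).2
  refine ⟨N, k, G, τ, K, ⟨hN, fun s => ?_⟩, hGlim, hτ, ?_⟩
  · have h1 : Tendsto (fun n => ((R s - 1 / ((m n : ℝ) + 1) : ℝ) : EReal)) atTop (𝓝 (R s)) := by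
      refine EReal.tendsto_coe.2 ?_
      simpa using hδ.const_sub (R s)
    rw [← h1.liminf_eq]
    refine liminf_le_liminf ?_
    filter_upwards [hcode] with n hn
    exact EReal.coe_le_coe_iff.2 ((hG n hn).1 s)
  · exact tendsto_of_tendsto_of_tendsto_of_le_of_le tendsto_const_nhds hGlim
      (fun n => zero_le) hK

theorem CRNGAchievable.achievable {W : Kernel (∀ i, X i) (∀ j, Y j)} [IsMarkovKernel W]
    {R : Msg → ℝ} (h : CRNGAchievable W R) : Achievable W R := by
  obtain ⟨N, _, _, _, K, hN, _, _, hK⟩ := h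
  exact ⟨N, K, hN, hK⟩

end Main

end

end InterferenceChannel

theorem mainTheorem6 {X Y : Fin 2 → Type*} [∀ i, MeasurableSpace (X i)]
    [∀ j, MeasurableSpace (Y j)]
    (W : ProbabilityTheory.Kernel (∀ i, X i) (∀ j, Y j)) [ProbabilityTheory.IsMarkovKernel W]
    (R : InterferenceChannel.Msg → ℝ) (hR : R ∈ InterferenceChannel.region W) :
    InterferenceChannel.Achievable W R ∧ InterferenceChannel.CRNGAchievable W R := by
  have h := InterferenceChannel.crngAchievable_of_mem_region W hR
  exact ⟨h.achievable, h⟩
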